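/- **Network.** A wireless network is a directed graph with a finite set $E$ of links, a bound $D$ on path lengths, $m=\max\{|E|,D\}$, and a matrix $W\in[0,1]^{E\times E}$ with $W_{e,e}=1$. Every packet has a fixed path, a nonempty directed walk with at most $D$ links. A demand vector $R\in\mathbb{R}_{\ge0}^E$ has interference measure $\|WR\|_\infty$. **Stochastic injection.** There are finitely many generators. In each time slot each generator injects at most one packet, at random; the distribution (of whether a packet is injected, and along which path) is the same in every slot, and injections are independent across generators and slots. The injection rate is at most $\lambda$: with $F(e)$ the expected number of times the packets injected in one slot have to be transmitted via $e$ (with multiplicity, if a path uses $e$ repeatedly), every component of $W F$ is at most $\lambda$. **Static algorithm.** Let $\mathcal A(I,n)$ be a randomized algorithm that schedules a finite set of single-link requests, serving at most one request per link and slot, such that whenever there are at most $n$ requests (where $n\ge 1$) of interference measure at most $I$, then with probability at least $1-\frac1{2n^4}$ all of them are served within $f(m)\,I+g(m,n)$ slots. Here $f(m)>0$, and $g(m,n)$ is nondecreasing and sublinear in $n$ (i.e. $g(m,n)=o(n)$). **Protocol.** Let $0<\varepsilon\le\frac12$, $\lambda=(1-\varepsilon)/f(m)$, let the frame length $T\in\mathbb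 N$ satisfy $$T\ge\frac{100f(m)}{\varepsilon^3}+\frac{48f(m)\ln m}{\varepsilon^2},\qquad T\ge\frac{4f(m)}{\varepsilon^2}\,g\Big(m,\frac{m}{f(m)}T\Big),$$ and let $J=(1+\varepsilon)\lambda T$. Time is divided into frames of $T$ slots, and the system starts empty. A packet first waits for the frame after the one of its injection. Each frame consists of two phases. 1. $\mathcal A(J,mJ)$ is executed for $\lfloor f(m)J+g(m,mJ)\rfloor$ slots on the next hops of all undelivered packets that were injected before the frame and have not failed so far. A packet that is not served in this execution *fails*; it is from then on scheduled only in second phases. 2. Each link whose buffer of failed packets is nonempty independently selects, with probability $1/m$, the packet in its buffer whose failure is longest ago (ties are broken by an arbitrary rule). $\mathcal A(1,mJ)$ is then executed for $\lfloor f(m)+g(m,mJ)\rfloor$ slots on the selected packets; those that are not served stay in their buffers. All executions of $\mathcal A$ and all selections use fresh randomness, independent of each other and of the injections. The latency of a packet is the number of slots from its injection until it reaches the end of its path ($\infty$ if it never does). **Theorem.** There is an absolute constant $C$ such that in every such system, for every generator, every time slot $t$ and every path with $d$ links, the latency $L$ of the packet that the generator injects in slot $t$ is measurable, and conditioned on the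 event that a packet with this path is injected by this generator in slot $t$ (if this event has positive probability), $$\mathbb E[L]\le C\cdot d\cdot T .$$ That is, the expected latency of a packet of path length $d$ is $O(d\cdot T)$. -/

import Mathlib

open MeasureTheory ProbabilityTheory
open scoped ENNReal Matrix

namespace PacketScheduling

/-- A wireless network: a directed graph with node type `V` and link type `E`, a bound `D` on the
length of the routes, and a matrix `W` of relative interference between links. -/
structure Network (V E : Type*) where
  src : E → V
  dst : E → V
  D : ℕ
  W : Matrix E E ℝ
  W_nonneg : ∀ e e', 0 ≤ W e e'
  W_le_one : ∀ e e', W e e' ≤ 1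
  W_diag : ∀ e, W e e = 1

/-- The significant network size `m = max {|E|, D}`. -/
def Network.m {V E : Type*} [Fintype E] (N : Network V E) : ℕ := max (Fintype.card E) N.D

/-- The interference measure `‖W · R‖_∞` induced by the demand vector `R`. -/
noncomputable def Network.interference {V E : Type*} [Fintype E] (N : Network V E)
    (R : E → ℝ) : ℝ := ‖N.W *ᵥ R‖

/-- A route: a nonempty directed walk with at most `D` links. It may revisit nodes and links. -/
structure Route {V E : Type*} (N : Network V E) where
  links : List E
  ne_nil : links ≠ []
  isWalk : links.IsChain (fun e e' => N.dst e = N.src e')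
  length_le : links.length ≤ N.D

/-! ### Static scheduling -/

open Classical in
/-- `demand Q e` is the number of requests in `Q` for link `e`. A request is a pair consisting of
the label of a packet and the link over which that packet has to be transmitted. -/
noncomputable def demand {κ E : Type*} (Q : Finset (κ × E)) (e : E) : ℝ :=
  ((Q.filter (fun r => r.2 = e)).card : ℝ)

/-- A randomized static scheduling algorithm `𝒜(I, n)`. With the random seed `σ`, which has the
law `seedLaw`, and the set `Q` of requests as its input, `run I n Q σ r` is the time slot (counted
from `0`) in which the request `r` is served successfully, or `none` if `r` is never served.
Over each link at most one packet is transmitted per slot. -/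
structure StaticAlgorithm (κ E S : Type*) [MeasurableSpace S] where
  seedLaw : Measure S
  isProbabilityMeasure : IsProbabilityMeasure seedLaw
  run : ℝ → ℝ → Finset (κ × E) → S → κ × E → Option ℕ
  measurableSet_run : ∀ I n Q r s, MeasurableSet {σ | run I n Q σ r = some s}
  one_per_link : ∀ I n Q σ, ∀ r ∈ Q, ∀ r' ∈ Q, r.2 = r'.2 →
    ∀ s, run I n Q σ r = some s → run I n Q σ r' = some s → r = r'

/-- If there are at most `n` requests and their interference measure is at most `I`, then with
probability at least `1 - 1 / (2 n ^ 4)` all of them are served within `a * I + b n` slots. -/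
def StaticAlgorithm.Guarantee {V κ E S : Type*} [Fintype E] [MeasurableSpace S]
    (A : StaticAlgorithm κ E S) (N : Network V E) (a : ℝ) (b : ℝ → ℝ) : Prop :=
  ∀ (I n : ℝ), 1 ≤ n → ∀ Q : Finset (κ × E), (Q.card : ℝ) ≤ n → N.interference (demand Q) ≤ I →
    1 - 1 / (2 * n ^ 4) ≤
      A.seedLaw.real {σ | ∀ r ∈ Q, ∃ s : ℕ, A.run I n Q σ r = some s ∧ (s : ℝ) + 1 ≤ a * I + b n}

/-! ### The dynamic protocol -/

/-- A packet is identified by its generator and the time slot of its injection. -/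
abbrev Packet (G : Type*) := G × ℕ

/-- The ingredients of the protocol: the static algorithm, the functions `f(m)` and `g(m, n)` of
its schedule length, the gap `ε` of the injection rate, the frame length `T`, and a rule `tie`
which, in each frame and on each link, chooses one packet among those whose failure is
longest ago. -/
structure Protocol {V E : Type*} (N : Network V E) (G S : Type*) [MeasurableSpace S] where
  alg : StaticAlgorithm (Packet G) E S
  f : ℕ → ℝ
  g : ℕ → ℝ → ℝ
  ε : ℝ
  T : ℕ
  tie : ℕ → E → Finset (Packet G) → Packet G
  tie_mem : ∀ k e B, B.Nonempty → tie k e B ∈ B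

/-- One outcome of all random choices: the route of the packet injected by each generator in each
slot (if there is one), the seeds of the two executions of the static algorithm in each frame, and
the experiment of each link in each clean-up phase. -/
structure Sample {V E : Type*} (N : Network V E) (G S : Type*) where
  inj : ℕ → G → Option (Route N)
  seed₁ : ℕ → S
  seed₂ : ℕ → S
  coin : ℕ → E → Bool

/-- The status of a packet: the number of links crossed so far, the frame in which it failed
(if it did), and the slot in which it reached its destination (if it did). -/
structure Status where
  pos : ℕ
  failedAt : Option ℕ
  deliveredAt : Option ℕ

/-- The `i`-th link (counted from `0`) on the route of packet `p`; it is `none` if there is no such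
packet or if its route has at most `i` links. -/
def Sample.hop {V E : Type*} {N : Network V E} {G S : Type*} (x : Sample N G S)
    (p : Packet G) (i : ℕ) : Option E :=
  (x.inj p.2 p.1).bind (fun r => r.links[i]?)

/-- Packet `p` crosses its next link in time slot `slot`. -/
def Sample.advance {V E : Type*} {N : Network V E} {G S : Type*} (x : Sample N G S)
    (st : Packet G → Status) (p : Packet G) (slot : ℕ) : Status where
  pos := (st p).pos + 1
  failedAt := (st p).failedAt
  deliveredAt := if (x.hop p ((st p).pos + 1)).isNone then some slot else none

open Classical in
/-- The effect of executing an algorithm on the set `Q` of requests for `len` slots beginning with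
slot `start`, where `out` is the schedule. Each request served in time crosses its link; to the
packet of each other request `onFail` is applied. -/
noncomputable def Sample.afterRun {V E : Type*} {N : Network V E} {G S : Type*} (x : Sample N G S)
    (st : Packet G → Status) (Q : Finset (Packet G × E)) (out : Packet G × E → Option ℕ)
    (start len : ℕ) (onFail : Status → Status) (p : Packet G) : Status :=
  match x.hop p (st p).pos with
  | none => st p
  | some e =>
    if (p, e) ∈ Q then
      match out (p, e) with
      | some s => if s < len then x.advance st p (start + s) else onFail (st p)
      | none => onFail (st p)
    else st p

namespace Protocol

variable {V E : Type*} [Fintype E] {N : Network V E} {G S : Type*} [Fintype G] [MeasurableSpace S]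

/-- The injection rate `λ = (1 - ε) / f(m)`. -/
noncomputable def rate (P : Protocol N G S) : ℝ := (1 - P.ε) / P.f N.m

/-- The planned interference per frame `J = (1 + ε) λ T`. -/
noncomputable def J (P : Protocol N G S) : ℝ := (1 + P.ε) * P.rate * P.T

/-- The length `f(m) J + g(m, m J)` of the first phase of a frame, in full slots. -/
noncomputable def firstLength (P : Protocol N G S) : ℕ :=
  ⌊P.f N.m * P.J + P.g N.m (N.m * P.J)⌋₊

/-- The length `f(m) + g(m, m J)` of the execution in the clean-up phase, in full slots. -/
noncomputable def cleanLength (P : Protocol N G S) : ℕ :=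
  ⌊P.f N.m * 1 + P.g N.m (N.m * P.J)⌋₊

open Classical in
/-- The next hops of all unfailed and undelivered packets injected before frame `k`, which begins
with slot `k * T`. -/
noncomputable def firstRequests (P : Protocol N G S) (x : Sample N G S) (k : ℕ)
    (st : Packet G → Status) : Finset (Packet G × E) :=
  (((Finset.univ : Finset G) ×ˢ Finset.range (k * P.T)) ×ˢ (Finset.univ : Finset E)).filter
    (fun r => (st r.1).failedAt = none ∧ x.hop r.1 (st r.1).pos = some r.2)

/-- The first phase of frame `k`: `𝒜(J, m J)` is executed on the next hops of the unfailed packets.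
Packets that are not served fail. -/
noncomputable def firstPhase (P : Protocol N G S) (x : Sample N G S) (k : ℕ)
    (st : Packet G → Status) : Packet G → Status :=
  x.afterRun st (P.firstRequests x k st)
    (P.alg.run P.J (N.m * P.J) (P.firstRequests x k st) (x.seed₁ k))
    (k * P.T) P.firstLength (fun s => ⟨s.pos, some k, s.deliveredAt⟩)

open Classical in
/-- The buffer of failed packets waiting to cross link `e`. -/
noncomputable def buffer (P : Protocol N G S) (x : Sample N G S) (k : ℕ)
    (st : Packet G → Status) (e : E) : Finset (Packet G) :=
  ((Finset.univ : Finset G) ×ˢ Finset.range (k * P.T)).filter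
    (fun p => (st p).failedAt.isSome ∧ x.hop p (st p).pos = some e)

open Classical in
/-- The packets in the buffer of link `e` whose failure is longest ago. -/
noncomputable def oldest (P : Protocol N G S) (x : Sample N G S) (k : ℕ)
    (st : Packet G → Status) (e : E) : Finset (Packet G) :=
  (P.buffer x k st e).filter (fun p => ∀ q ∈ P.buffer x k st e,
    ∀ i j, (st p).failedAt = some i → (st q).failedAt = some j → i ≤ j)

open Classical in
/-- The requests of the clean-up phase: each link with a nonempty buffer whose experiment is
successful selects a failed packet whose failure is longest ago. -/
noncomputable def cleanRequests (P : Protocol N G S) (x : Sample N G S) (k : ℕ)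
    (st : Packet G → Status) : Finset (Packet G × E) :=
  ((Finset.univ : Finset E).filter (fun e => x.coin k e = true ∧ (P.buffer x k st e).Nonempty)).image
    (fun e => (P.tie k e (P.oldest x k st e), e))

/-- The clean-up phase of frame `k`: `𝒜(1, m J)` is executed on the selected failed packets. -/
noncomputable def cleanPhase (P : Protocol N G S) (x : Sample N G S) (k : ℕ)
    (st : Packet G → Status) : Packet G → Status :=
  x.afterRun st (P.cleanRequests x k st)
    (P.alg.run 1 (N.m * P.J) (P.cleanRequests x k st) (x.seed₂ k))
    (k * P.T + P.firstLength) P.cleanLength id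

/-- The status of all packets at the beginning of frame `k`. -/
noncomputable def state (P : Protocol N G S) (x : Sample N G S) : ℕ → Packet G → Status
  | 0 => fun _ => ⟨0, none, none⟩
  | k + 1 => P.cleanPhase x k (P.firstPhase x k (state P x k))

/-- The latency of packet `p`: the number of time slots from its injection to its delivery, and
`∞` if it is never delivered. -/
noncomputable def latency (P : Protocol N G S) (x : Sample N G S) (p : Packet G) : ℝ≥0∞ :=
  ⨅ (k : ℕ) (s : ℕ) (_ : (P.state x k p).deliveredAt = some s), ((s - p.2 : ℕ) : ℝ≥0∞)

end Protocol

/-! ### Stochastic injection and the law of the protocol's random choices -/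

/-- The sources of randomness: the injection of generator `g` in slot `t`, the experiment of link
`e` in frame `k`, and the seeds of the two executions of the static algorithm in frame `k`. -/
inductive Source (G E : Type*)
  | inject (t : ℕ) (g : G)
  | coin (k : ℕ) (e : E)
  | first (k : ℕ)
  | second (k : ℕ)

/-- The σ-algebra on `Ω` generated by a source of randomness. -/
@[reducible] def Source.sigma {V E : Type*} {N : Network V E} {G S Ω : Type*} [MeasurableSpace S]
    (x : Ω → Sample N G S) : Source G E → MeasurableSpace Ω
  | .inject t g => MeasurableSpace.comap (fun ω => (x ω).inj t g) ⊤
  | .coin k e => MeasurableSpace.comap (fun ω => (x ω).coin k e) ⊤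
  | .first k => MeasurableSpace.comap (fun ω => (x ω).seed₁ k) inferInstance
  | .second k => MeasurableSpace.comap (fun ω => (x ω).seed₂ k) inferInstance

open Classical in
/-- `F(e)`: the expected number of times that the packets injected in one slot have to be
transmitted via link `e`. A route that uses `e` several times is counted that many times. -/
noncomputable def averageUse {V E : Type*} {N : Network V E} {G S Ω : Type*} [Fintype G]
    [MeasurableSpace Ω] (μ : Measure Ω) (x : Ω → Sample N G S) (e : E) : ℝ :=
  ∑ g, ∫ ω, ((x ω).inj 0 g).elim (0 : ℝ) (fun r => (r.links.count e : ℝ)) ∂μ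

/-- The law of the random choices: in each slot each generator injects at most one packet, with a
distribution that does not depend on the slot and such that each component of `W · F` is at most
the injection rate; each experiment succeeds with probability `1 / m`; each execution of the static
algorithm uses a seed with the right law; and all of these choices are independent. -/
structure IsExecution {V E : Type*} [Fintype E] {N : Network V E} {G S Ω : Type*} [Fintype G]
    [MeasurableSpace S] [MeasurableSpace Ω] (P : Protocol N G S) (μ : Measure Ω)
    (x : Ω → Sample N G S) : Prop where
  measurable_inj : ∀ t g (o : Option (Route N)), MeasurableSet {ω | (x ω).inj t g = o}
  measurable_coin : ∀ k e, Measurable (fun ω => (x ω).coin k e)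
  measurable_seed₁ : ∀ k, Measurable (fun ω => (x ω).seed₁ k)
  measurable_seed₂ : ∀ k, Measurable (fun ω => (x ω).seed₂ k)
  inj_identDistrib : ∀ t g (o : Option (Route N)),
    μ {ω | (x ω).inj t g = o} = μ {ω | (x ω).inj 0 g = o}
  inj_rate : ∀ e, (N.W *ᵥ averageUse μ x) e ≤ P.rate
  coin_law : ∀ k e, μ.real {ω | (x ω).coin k e = true} = 1 / (N.m : ℝ)
  seed₁_law : ∀ k, μ.map (fun ω => (x ω).seed₁ k) = P.alg.seedLaw
  seed₂_law : ∀ k, μ.map (fun ω => (x ω).seed₂ k) = P.alg.seedLaw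
  indep : iIndep (Source.sigma x) μ

end PacketScheduling

/-!
A packet that has not failed crosses exactly one link per frame, so a packet with `d` links that
never fails is delivered within `d + 1` frames after its injection. The whole difficulty is to show that
the failed packets add only a bounded number of frames per link to the expected latency.

*Failures are rare.* As long as no packet fails, the position of a packet in a frame is determined
by its injection slot. The first phase of a frame therefore serves a subset of the *planned*
requests, which depend only on the injections in the `D` preceding frames. Their interference at a
link is a sum of independent variables in `[0, 1]` with mean at most `λ T`, so by a Chernoff bound it
exceeds `J = (1 + ε) λ T` with probability of order `m exp (-ε² λ T / 4)` only
(`Protocol.measure_overload_le`). Otherwise the guarantee of the static algorithm applies, and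
a request is left over with probability at most `1 / (2 (m J) ^ 4)`. The frame length is chosen such
that both are tiny, and such that the two phases fit into a frame (`Protocol.calibrated`). This uses
`f ≥ 1`, which follows from the fact that requests on one link have to be served one after the
other (`StaticAlgorithm.Guarantee.one_le`).

*Few packets are failed at any time.* The potential `Φ` is the number of links that the failed
packets still have to cross. If it is positive, then with probability at least `1 / (6 m)` exactly one
experiment succeeds, at a link with a nonempty buffer, and the selected packet is served: the clean-up
phase decreases `Φ`. This holds conditionally on the past and on all injections. Hence the moment
`E exp (θ Φ)` satisfies a recursion in which each frame contributes a contracting factor and the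
exponential of the burst that an overload causes. Bursts of frames closer than `D` are dependent;
the convexity of the exponential function separates the frames into residue classes modulo `D`,
within which they are independent (`Protocol.lintegral_burstWeight_le`). The moment turns out to be
at most `3` at all times (`Protocol.lintegral_exp_potential_le`).

*Failed packets leave quickly.* Buffers are served in the order of failure, so for a packet that
fails in frame `j` only the packets that failed no later than `j` matter. Their potential never
increases after frame `j` and decreases with probability at least `1 / (6 m)` as long as it is
positive, which takes at most `6 m` times its initial value in expectation
(`Protocol.tsum_lintegral_potential_pos_le`). The expected potential that a packet finds when it
fails is at most `1 / m`: failing and finding a large potential are not independent, but the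
inequality `θ Φ ≤ u + exp (θ Φ - u)` reduces this expectation to the failure probability and the
exponential moment (`Protocol.lintegral_fail_mul_potential_le`). So each of the `d` frames in which
a packet can fail adds at most `6` frames to its expected latency
(`Protocol.lintegral_latency_le`).

*Conditioning.* All of this is carried out under the law conditioned on the injection of the packet
in question. It keeps the independence of all sources of randomness and the laws of all of them
but one (`IsExecution.isRun_cond`), and the remaining one changes the exponential moments of the
interference by a factor of at most `2` (`Protocol.tailBound_cond`).
-/

namespace PacketScheduling

/-! ### Measurability of functions with discrete values -/

/-- `f` is measurable with respect to `m` and the discrete `σ`-algebra on its codomain. -/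
def DMeas {Ω α : Type*} (m : MeasurableSpace Ω) (f : Ω → α) : Prop :=
  ∀ s : Set α, MeasurableSet[m] (f ⁻¹' s)

namespace DMeas

variable {Ω α β : Type*} {m : MeasurableSpace Ω}

theorem of_fiber [Countable α] {f : Ω → α} (h : ∀ a, MeasurableSet[m] {ω | f ω = a}) :
    DMeas m f := by
  intro s
  have : f ⁻¹' s = ⋃ a ∈ s, {ω | f ω = a} := by ext; simp
  rw [this]
  exact MeasurableSet.biUnion s.to_countable (fun a _ => h a)

theorem mono {m' : MeasurableSpace Ω} (hm : m ≤ m') {f : Ω → α} (h : DMeas m f) : DMeas m' f :=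
  fun s => hm _ (h s)

theorem const (a : α) : DMeas m (fun _ : Ω => a) := fun _ => MeasurableSet.const _

theorem comp {f : Ω → α} (h : DMeas m f) (F : α → β) : DMeas m (fun ω => F (f ω)) :=
  fun s => h (F ⁻¹' s)

theorem setOf {f : Ω → α} (h : DMeas m f) (p : α → Prop) : MeasurableSet[m] {ω | p (f ω)} :=
  h {a | p a}

theorem measurable [MeasurableSpace β] {f : Ω → α} (h : DMeas m f) (F : α → β) :
    Measurable[m] (fun ω => F (f ω)) :=
  fun s _ => h (F ⁻¹' s)

/-- A countable random parameter may be frozen when proving measurability. -/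
theorem bind [Countable α] {f : Ω → α} (hf : DMeas m f) {h : α → Ω → β}
    (hh : ∀ a, DMeas m (h a)) : DMeas m (fun ω => h (f ω) ω) := by
  intro s
  have : (fun ω => h (f ω) ω) ⁻¹' s = ⋃ a, ({ω | f ω = a} ∩ h a ⁻¹' s) := by ext; simp
  rw [this]
  exact MeasurableSet.iUnion (fun a => (hf.setOf (· = a)).inter (hh a s))

theorem prodMk [Countable α] {f : Ω → α} {g : Ω → β} (hf : DMeas m f) (hg : DMeas m g) :
    DMeas m (fun ω => (f ω, g ω)) :=
  hf.bind (fun a => hg.comp (fun b => (a, b)))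

theorem of_prop {p : Ω → Prop} (h : MeasurableSet[m] {ω | p ω}) : DMeas m p := by
  refine of_fiber (fun a => ?_)
  by_cases ha : a
  · simpa only [ha, eq_iff_iff, iff_true] using h
  · simp only [ha, eq_iff_iff, iff_false]
    exact h.compl

theorem prop {p : Ω → Prop} (h : DMeas m p) : MeasurableSet[m] {ω | p ω} := h.setOf id

theorem pi {ι : Type*} [Finite ι] [Countable α] {f : ι → Ω → α} (h : ∀ i, DMeas m (f i)) :
    DMeas m (fun ω i => f i ω) := by
  refine of_fiber (fun a => ?_)
  have : {ω | (fun i => f i ω) = a} = ⋂ i, {ω | f i ω = a i} := by ext; simp [funext_iff]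
  rw [this]
  exact MeasurableSet.iInter (fun i => (h i).setOf (· = a i))

theorem finset [Countable α] {s : Ω → Finset α} (h : ∀ a, MeasurableSet[m] {ω | a ∈ s ω}) :
    DMeas m s := by
  refine of_fiber (fun t => ?_)
  have : {ω | s ω = t} = ⋂ a, {ω | a ∈ s ω ↔ a ∈ t} := by ext; simp [Finset.ext_iff]
  rw [this]
  exact MeasurableSet.iInter (fun a => ((of_prop (h a)).comp (fun q => (q ↔ a ∈ t))).prop)

end DMeas

/-! ### Independent sources of randomness -/

section Independence

variable {Ω ι κ : Type*} [mΩ : MeasurableSpace Ω] {μ : Measure Ω}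

theorem lintegral_discrete [Countable κ] {Z : Ω → κ} (hZ : DMeas mΩ Z) {G : κ → Ω → ℝ≥0∞}
    (hG : ∀ z, Measurable (G z)) :
    ∫⁻ ω, G (Z ω) ω ∂μ = ∑' z, ∫⁻ ω, {ω | Z ω = z}.indicator (G z) ω ∂μ := by
  rw [← lintegral_tsum (fun z => ((hG z).indicator (hZ.setOf (· = z))).aemeasurable)]
  refine lintegral_congr (fun ω => ?_)
  rw [tsum_eq_single (Z ω)]
  · simp
  · intro z hz
    simp [Ne.symm hz]

/-- Fubini's theorem for a fresh source of randomness `m₂`: a discrete parameter and a weight that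
depend only on the past `m₁` may be frozen while the fresh randomness is averaged out. -/
theorem lintegral_mul_freeze {Ω κ : Type*} {m₁ m₂ mΩ : MeasurableSpace Ω} {μ : Measure Ω}
    [Countable κ] (h₁ : m₁ ≤ mΩ)
    (h₂ : m₂ ≤ mΩ) (hind : Indep m₁ m₂ μ) {ψ : Ω → ℝ≥0∞} (hψ : Measurable[m₁] ψ) {Z : Ω → κ}
    (hZ : DMeas m₁ Z) {φ : κ → Ω → ℝ≥0∞} (hφ : ∀ z, Measurable[m₂] (φ z)) :
    ∫⁻ ω, ψ ω * φ (Z ω) ω ∂μ = ∫⁻ ω, ψ ω * ∫⁻ ω', φ (Z ω) ω' ∂μ ∂μ := by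
  have hψ' : Measurable ψ := hψ.mono h₁ le_rfl
  rw [lintegral_discrete (G := fun z ω => ψ ω * φ z ω) (hZ.mono h₁)
      (fun z => hψ'.mul ((hφ z).mono h₂ le_rfl)),
    lintegral_discrete (G := fun z ω => ψ ω * ∫⁻ ω', φ z ω' ∂μ) (hZ.mono h₁)
      (fun z => hψ'.mul_const _)]
  refine tsum_congr (fun z => ?_)
  have hm : Measurable[m₁] ({ω | Z ω = z}.indicator ψ) :=
    Measurable.indicator hψ (hZ.setOf (· = z))
  have e : ∀ c : Ω → ℝ≥0∞, {ω | Z ω = z}.indicator (fun ω => ψ ω * c ω)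
      = fun ω => {ω | Z ω = z}.indicator ψ ω * c ω := by
    intro c
    ext ω
    by_cases h : Z ω = z <;> simp [h]
  rw [e, e, lintegral_mul_eq_lintegral_mul_lintegral_of_independent_measurableSpace h₁ h₂ hind hm
    (hφ z), lintegral_mul_const _ (hm.mono h₁ le_rfl)]

theorem lintegral_mul_freeze_le {Ω κ : Type*} {m₁ m₂ mΩ : MeasurableSpace Ω} {μ : Measure Ω}
    [Countable κ] (h₁ : m₁ ≤ mΩ)
    (h₂ : m₂ ≤ mΩ) (hind : Indep m₁ m₂ μ) {ψ : Ω → ℝ≥0∞} (hψ : Measurable[m₁] ψ) {Z : Ω → κ}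
    (hZ : DMeas m₁ Z) {φ : κ → Ω → ℝ≥0∞} (hφ : ∀ z, Measurable[m₂] (φ z)) {c : ℝ≥0∞}
    (hc : ∀ z, ∫⁻ ω, φ z ω ∂μ ≤ c) :
    ∫⁻ ω, ψ ω * φ (Z ω) ω ∂μ ≤ c * ∫⁻ ω, ψ ω ∂μ := by
  rw [lintegral_mul_freeze h₁ h₂ hind hψ hZ hφ, mul_comm,
    ← lintegral_mul_const _ (hψ.mono h₁ le_rfl)]
  gcongr
  exact hc _

/-- Expectations of products of functions of disjoint sets of sources factorize. -/
theorem lintegral_prod_le_of_iIndep [IsProbabilityMeasure μ] {m : ι → MeasurableSpace Ω}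
    (hle : ∀ i, m i ≤ mΩ) (hind : iIndep m μ) {J : Type*} {U : J → Set ι} {h : J → Ω → ℝ≥0∞}
    (hmeas : ∀ j, Measurable[⨆ i ∈ U j, m i] (h j)) (S : Finset J)
    (hdisj : (S : Set J).PairwiseDisjoint U) (K : J → ℝ≥0∞)
    (hK : ∀ j ∈ S, ∫⁻ ω, h j ω ∂μ ≤ K j) :
    ∫⁻ ω, ∏ j ∈ S, h j ω ∂μ ≤ ∏ j ∈ S, K j := by
  classical
  have hle' : ∀ V : Set ι, (⨆ i ∈ V, m i) ≤ mΩ := fun V => iSup₂_le (fun i _ => hle i)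
  induction S using Finset.induction_on with
  | empty => simp
  | insert a S ha ih =>
    simp_rw [Finset.prod_insert ha]
    have hd : Disjoint (U a) (⋃ j ∈ S, U j) := by
      rw [Set.disjoint_iUnion₂_right]
      intro j hj
      exact hdisj (by simp) (by simp [hj]) (by rintro rfl; exact ha hj)
    have hm : Measurable[⨆ i ∈ ⋃ j ∈ S, U j, m i] (fun ω => ∏ j ∈ S, h j ω) := by
      refine Finset.measurable_fun_prod S (fun j hj => (hmeas j).mono ?_ le_rfl)
      exact biSup_mono (fun i hi => Set.mem_biUnion hj hi)
    rw [lintegral_mul_eq_lintegral_mul_lintegral_of_independent_measurableSpace (hle' _) (hle' _)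
      (indep_iSup_of_disjoint hle hind hd) (hmeas a) hm]
    gcongr
    · exact hK a (by simp)
    · exact ih (hdisj.subset (by simp)) (fun j hj => hK j (by simp [hj]))

/-- Conditioning on an event of one source does not change the law of the other sources. -/
theorem cond_apply_of_iIndep [IsProbabilityMeasure μ] {m : ι → MeasurableSpace Ω}
    (hle : ∀ i, m i ≤ mΩ) (hind : iIndep m μ) {i₀ : ι} {A : Set Ω}
    (hA : MeasurableSet[m i₀] A) (hA0 : μ A ≠ 0) {i : ι} (hi : i ≠ i₀) {B : Set Ω}
    (hB : MeasurableSet[m i] B) : μ[|A] B = μ B := by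
  have h := (Indep_iff _ _ _).1 (hind.indep hi.symm) A B hA hB
  rw [cond_apply (hle _ _ hA), h, ← mul_assoc, ENNReal.inv_mul_cancel hA0 (measure_ne_top _ _),
    one_mul]

/-- Independent sources of randomness stay independent when one conditions on an event of one
of them. -/
theorem iIndep_cond [IsProbabilityMeasure μ] {m : ι → MeasurableSpace Ω}
    (hle : ∀ i, m i ≤ mΩ) (hind : iIndep m μ) {i₀ : ι} {A : Set Ω}
    (hA : MeasurableSet[m i₀] A) (hA0 : μ A ≠ 0) : iIndep m μ[|A] := by
  classical
  have hA1 := measure_ne_top μ A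
  have hA' := hle _ _ hA
  rw [iIndep_iff]
  intro s f hf
  have key : ∀ s' : Finset ι, i₀ ∉ s' → (∀ i ∈ s', MeasurableSet[m i] (f i)) →
      ∀ B, MeasurableSet[m i₀] B →
      μ[|A] (B ∩ ⋂ i ∈ s', f i) = μ[|A] B * ∏ i ∈ s', μ[|A] (f i) := by
    intro s' hs' hf' B hB
    have h1 := (iIndep_iff _ _).1 hind (insert i₀ s') (f := fun i => if i = i₀ then A ∩ B else f i)
      (by
        intro i hi
        by_cases h : i = i₀
        · subst h; simpa using hA.inter hB
        · simp only [h, if_false]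
          exact hf' i ((Finset.mem_insert.1 hi).resolve_left h))
    rw [Finset.prod_insert hs', Finset.set_biInter_insert] at h1
    have e1 : (⋂ x ∈ s', if x = i₀ then A ∩ B else f x) = ⋂ x ∈ s', f x := by
      refine Set.iInter₂_congr (fun i hi => ?_)
      rw [if_neg (by rintro rfl; exact hs' hi)]
    have e2 : ∏ i ∈ s', μ (if i = i₀ then A ∩ B else f i) = ∏ i ∈ s', μ[|A] (f i) := by
      refine Finset.prod_congr rfl (fun i hi => ?_)
      have hne : i ≠ i₀ := by rintro rfl; exact hs' hi
      rw [if_neg hne, cond_apply_of_iIndep hle hind hA hA0 hne (hf' i hi)]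
    rw [e1, e2, if_pos rfl] at h1
    rw [cond_apply hA', cond_apply hA', ← Set.inter_assoc, h1, mul_assoc]
  by_cases hs : i₀ ∈ s
  · have h2 := key (s.erase i₀) (by simp) (fun i hi => hf i (Finset.mem_of_mem_erase hi)) (f i₀)
      (hf i₀ hs)
    rw [Finset.mul_prod_erase s (fun i => μ[|A] (f i)) hs] at h2
    rw [← h2, ← Finset.set_biInter_insert, Finset.insert_erase hs]
  · have h2 := key s hs hf Set.univ MeasurableSet.univ
    have : IsProbabilityMeasure μ[|A] := cond_isProbabilityMeasure hA0
    simpa using h2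

end Independence

/-- Convexity of the exponential function, used to split a sum over time into residue classes. -/
theorem exp_sum_le_residues {D : ℕ} (hD : 0 < D) (a : ℕ → ℝ) (S : Finset ℕ) :
    Real.exp (∑ i ∈ S, a i) ≤
      ∑ c ∈ Finset.range D, (1 / (D : ℝ)) *
        Real.exp (∑ i ∈ S.filter (fun i => i % D = c), D * a i) := by
  have hD' : (D : ℝ) ≠ 0 := by positivity
  have h := convexOn_exp.map_sum_le (t := Finset.range D) (w := fun _ => 1 / (D : ℝ))
    (p := fun c => ∑ i ∈ S.filter (fun i => i % D = c), D * a i)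
    (fun _ _ => by positivity) (by simp [hD']) (fun _ _ => Set.mem_univ _)
  simp only [smul_eq_mul] at h
  refine le_trans (le_of_eq ?_) h
  congr 1
  rw [← Finset.sum_fiberwise_of_maps_to (t := Finset.range D) (g := fun i => i % D)
    (fun i _ => Finset.mem_range.2 (Nat.mod_lt _ hD))]
  refine Finset.sum_congr rfl (fun c _ => ?_)
  rw [← Finset.mul_sum, ← mul_assoc, one_div, inv_mul_cancel₀ hD', one_mul]

/-! ### The dynamics of the protocol on a fixed outcome -/

section Dynamics

set_option linter.unusedSectionVars false

variable {V E : Type*} {N : Network V E} {G S : Type*}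

/-- The number of links on the route of packet `p`; it is `0` if there is no such packet. -/
def Sample.len (x : Sample N G S) (p : Packet G) : ℕ :=
  (x.inj p.2 p.1).elim 0 (fun r => r.links.length)

theorem Sample.hop_eq_none_iff (x : Sample N G S) (p : Packet G) (i : ℕ) :
    x.hop p i = none ↔ x.len p ≤ i := by
  unfold Sample.hop Sample.len
  cases x.inj p.2 p.1 <;> simp

theorem Sample.lt_len_of_hop {x : Sample N G S} {p : Packet G} {i : ℕ} {e : E}
    (h : x.hop p i = some e) : i < x.len p := by
  by_contra hc
  rw [(x.hop_eq_none_iff p i).2 (not_lt.1 hc)] at h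
  cases h

theorem Sample.exists_hop {x : Sample N G S} {p : Packet G} {i : ℕ} (h : i < x.len p) :
    ∃ e, x.hop p i = some e := by
  rw [← Option.ne_none_iff_exists']
  intro hc
  exact absurd ((x.hop_eq_none_iff p i).1 hc) (not_le.2 h)

theorem Sample.len_le (x : Sample N G S) (p : Packet G) : x.len p ≤ N.D := by
  unfold Sample.len
  cases x.inj p.2 p.1 with
  | none => simp
  | some r => exact r.length_le

/-- The three things that an execution can do to a packet: nothing, if it has no request; an advance
by one link, if its request is served in time; and `onFail`, otherwise. -/
theorem Sample.afterRun_cases (x : Sample N G S) (st : Packet G → Status)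
    (Q : Finset (Packet G × E)) (out : Packet G × E → Option ℕ) (start len : ℕ)
    (onFail : Status → Status) (p : Packet G) :
    (x.afterRun st Q out start len onFail p = st p ∧
      ∀ e, x.hop p (st p).pos = some e → (p, e) ∉ Q) ∨
    (∃ e s, x.hop p (st p).pos = some e ∧ (p, e) ∈ Q ∧ out (p, e) = some s ∧ s < len ∧
      x.afterRun st Q out start len onFail p = x.advance st p (start + s)) ∨
    (∃ e, x.hop p (st p).pos = some e ∧ (p, e) ∈ Q ∧ (∀ s, out (p, e) = some s → len ≤ s) ∧
      x.afterRun st Q out start len onFail p = onFail (st p)) := by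
  unfold Sample.afterRun
  cases h : x.hop p (st p).pos with
  | none => simp
  | some e =>
    by_cases hQ : (p, e) ∈ Q
    · cases ho : out (p, e) with
      | none => simp [hQ, ho]
      | some s =>
        by_cases hs : s < len
        · simp [hQ, ho, hs]
        · simp [hQ, ho, hs, not_lt.1 hs]
    · simp [hQ]

/-- No packet has moved beyond the end of its route, and every packet at the end of its route was
delivered before slot `a`. -/
def Sample.Tracked (x : Sample N G S) (st : Packet G → Status) (a : ℕ) : Prop :=
  ∀ p, (st p).pos ≤ x.len p ∧
    (0 < x.len p → (st p).pos = x.len p → ∃ s, s < a ∧ (st p).deliveredAt = some s)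

theorem Sample.Tracked.mono {x : Sample N G S} {st : Packet G → Status} {a b : ℕ}
    (h : x.Tracked st a) (hab : a ≤ b) : x.Tracked st b := by
  refine fun p => ⟨(h p).1, fun h0 h1 => ?_⟩
  obtain ⟨s, hs, h2⟩ := (h p).2 h0 h1
  exact ⟨s, hs.trans_le hab, h2⟩

theorem Sample.Tracked.afterRun {x : Sample N G S} {st : Packet G → Status} {start : ℕ}
    (h : x.Tracked st start) (Q : Finset (Packet G × E)) (out : Packet G × E → Option ℕ)
    (len : ℕ) (onFail : Status → Status) (h₁ : ∀ s, (onFail s).pos = s.pos)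
    (h₂ : ∀ s, (onFail s).deliveredAt = s.deliveredAt) :
    x.Tracked (x.afterRun st Q out start len onFail) (start + len) := by
  intro p
  rcases x.afterRun_cases st Q out start len onFail p with
    ⟨h', -⟩ | ⟨e, s, he, -, -, hs, h'⟩ | ⟨e, he, -, -, h'⟩
  · rw [h']
    exact h.mono (Nat.le_add_right _ _) p
  · rw [h']
    have hlt := Sample.lt_len_of_hop he
    refine ⟨hlt, fun _ h1 => ⟨start + s, by omega, ?_⟩⟩
    have : x.hop p ((st p).pos + 1) = none := (x.hop_eq_none_iff _ _).2 (le_of_eq h1.symm)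
    simp [Sample.advance, this]
  · rw [h', h₁, h₂]
    exact h.mono (Nat.le_add_right _ _) p

namespace Protocol

variable [Fintype E] [Fintype G] [MeasurableSpace S] (P : Protocol N G S)

theorem tracked_state (hT : P.firstLength + P.cleanLength ≤ P.T) (x : Sample N G S) (k : ℕ) :
    x.Tracked (P.state x k) (k * P.T) := by
  induction k with
  | zero =>
    intro p
    refine ⟨Nat.zero_le _, fun h0 h1 => ?_⟩
    simp only [Protocol.state] at h1
    omega
  | succ k ih =>
    have h1 := ih.afterRun (P.firstRequests x k (P.state x k))
      (P.alg.run P.J (N.m * P.J) (P.firstRequests x k (P.state x k)) (x.seed₁ k))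
      P.firstLength (fun s => ⟨s.pos, some k, s.deliveredAt⟩) (fun _ => rfl) (fun _ => rfl)
    have h2 := h1.afterRun (P.cleanRequests x k (P.firstPhase x k (P.state x k)))
      (P.alg.run 1 (N.m * P.J) (P.cleanRequests x k (P.firstPhase x k (P.state x k)))
        (x.seed₂ k)) P.cleanLength id (fun _ => rfl) (fun _ => rfl)
    exact h2.mono (by rw [Nat.succ_mul]; omega)

theorem latency_le_of_delivered (hT : P.firstLength + P.cleanLength ≤ P.T) (x : Sample N G S)
    (p : Packet G) (k : ℕ) (h0 : 0 < x.len p) (h1 : (P.state x k p).pos = x.len p) :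
    P.latency x p ≤ ((k * P.T - p.2 : ℕ) : ℝ≥0∞) := by
  obtain ⟨s, hs, h2⟩ := (P.tracked_state hT x k p).2 h0 h1
  refine (iInf_le_of_le k (iInf_le_of_le s (iInf_le_of_le h2 le_rfl))).trans ?_
  exact_mod_cast Nat.sub_le_sub_right hs.le _

/-- The latency is at most one frame plus the frames, from the first one in which the packet takes
part, at whose beginning it is undelivered. -/
theorem latency_le_tsum (hT : P.firstLength + P.cleanLength ≤ P.T) (hT0 : 0 < P.T)
    (x : Sample N G S) (p : Packet G) (h0 : 0 < x.len p) :
    P.latency x p ≤ P.T * (1 + ∑' k, {k | p.2 / P.T + 1 ≤ k ∧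
      (P.state x k p).pos < x.len p}.indicator (fun _ => (1 : ℝ≥0∞)) k) := by
  classical
  set k₀ := p.2 / P.T + 1
  have hk₀ : k₀ * P.T ≤ p.2 + P.T := by
    have := Nat.div_mul_le_self p.2 P.T
    simp only [k₀, Nat.add_mul, one_mul]
    omega
  by_cases h : ∃ n, (P.state x (k₀ + n) p).pos = x.len p
  · have hn := Nat.find_spec h
    have hmin : ∀ i, i < Nat.find h → (P.state x (k₀ + i) p).pos < x.len p := fun i hi =>
      lt_of_le_of_ne (P.tracked_state hT x _ p).1 (Nat.find_min h hi)
    set n := Nat.find h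
    have hsum : (n : ℝ≥0∞) ≤ ∑' k, {k | k₀ ≤ k ∧
        (P.state x k p).pos < x.len p}.indicator (fun _ => (1 : ℝ≥0∞)) k := by
      refine le_trans (le_of_eq ?_) (ENNReal.sum_le_tsum (Finset.Ico k₀ (k₀ + n)))
      rw [Finset.sum_congr rfl (g := fun _ => (1 : ℝ≥0∞))]
      · simp
      · intro k hk
        rw [Finset.mem_Ico] at hk
        rw [Set.indicator_of_mem]
        refine ⟨hk.1, ?_⟩
        have := hmin (k - k₀) (by omega)
        rwa [Nat.add_sub_cancel' hk.1] at this
    calc P.latency x p ≤ (((k₀ + n) * P.T - p.2 : ℕ) : ℝ≥0∞) :=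
          P.latency_le_of_delivered hT x p _ h0 hn
      _ ≤ ((P.T * (1 + n) : ℕ) : ℝ≥0∞) := by
          refine Nat.cast_le.2 ?_
          have : (k₀ + n) * P.T = k₀ * P.T + P.T * n := by ring
          rw [this, Nat.mul_add]
          omega
      _ ≤ _ := by
          push_cast
          gcongr
  · push Not at h
    have hlt : ∀ n, (P.state x (k₀ + n) p).pos < x.len p := fun n =>
      lt_of_le_of_ne (P.tracked_state hT x _ p).1 (h n)
    have htop : ∑' k, {k | k₀ ≤ k ∧
        (P.state x k p).pos < x.len p}.indicator (fun _ => (1 : ℝ≥0∞)) k = ⊤ := by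
      refine ENNReal.eq_top_of_forall_nnreal_le (fun r => ?_)
      obtain ⟨n, hn⟩ := exists_nat_ge r
      refine le_trans ?_ (ENNReal.sum_le_tsum (Finset.Ico k₀ (k₀ + n)))
      rw [Finset.sum_congr rfl (g := fun _ => (1 : ℝ≥0∞))]
      · simp only [Finset.sum_const, Nat.card_Ico, add_tsub_cancel_left, nsmul_eq_mul, mul_one]
        exact_mod_cast hn
      · intro k hk
        rw [Finset.mem_Ico] at hk
        rw [Set.indicator_of_mem]
        refine ⟨hk.1, ?_⟩
        have := hlt (k - k₀)
        rwa [Nat.add_sub_cancel' hk.1] at this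
    rw [htop]
    simp [ENNReal.mul_top, hT0.ne']

/-- The failure records in a status: packets fail only while they take part in first phases, in
a frame before `k`, and packets that have not failed have crossed one link in each of the `n`
frames that they have seen, where the first frame seen is the one after their injection. -/
def Punctual (x : Sample N G S) (k : ℕ) (st : Packet G → Status) : Prop :=
  ∀ p, (∀ j, (st p).failedAt = some j →
      j < k ∧ p.2 / P.T + 1 ≤ j ∧ j - (p.2 / P.T + 1) < x.len p) ∧
    ((st p).failedAt = none → (st p).pos = min (x.len p) (k - (p.2 / P.T + 1)))

theorem mem_firstRequests {x : Sample N G S} {k : ℕ} {st : Packet G → Status} {p : Packet G}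
    {e : E} : (p, e) ∈ P.firstRequests x k st ↔
      p.2 < k * P.T ∧ (st p).failedAt = none ∧ x.hop p (st p).pos = some e := by
  simp [firstRequests]

theorem mem_buffer {x : Sample N G S} {k : ℕ} {st : Packet G → Status} {p : Packet G}
    {e : E} : p ∈ P.buffer x k st e ↔
      p.2 < k * P.T ∧ (st p).failedAt.isSome ∧ x.hop p (st p).pos = some e := by
  simp [buffer]

theorem oldest_nonempty {x : Sample N G S} {k : ℕ} {st : Packet G → Status} {e : E}
    (h : (P.buffer x k st e).Nonempty) : (P.oldest x k st e).Nonempty := by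
  classical
  obtain ⟨p, hp, hmin⟩ := Finset.exists_min_image _ (fun p => (st p).failedAt.getD 0) h
  refine ⟨p, ?_⟩
  simp only [oldest, Finset.mem_filter]
  refine ⟨hp, fun q hq i j hi hj => ?_⟩
  simpa [hi, hj] using hmin q hq

theorem tie_mem_oldest {x : Sample N G S} {k : ℕ} {st : Packet G → Status} {e : E}
    (h : (P.buffer x k st e).Nonempty) : P.tie k e (P.oldest x k st e) ∈ P.oldest x k st e :=
  P.tie_mem k e _ (P.oldest_nonempty h)

theorem oldest_subset {x : Sample N G S} {k : ℕ} {st : Packet G → Status} {e : E} :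
    P.oldest x k st e ⊆ P.buffer x k st e := by
  classical
  exact Finset.filter_subset _ _

theorem mem_cleanRequests {x : Sample N G S} {k : ℕ} {st : Packet G → Status} {p : Packet G}
    {e : E} : (p, e) ∈ P.cleanRequests x k st ↔
      x.coin k e = true ∧ (P.buffer x k st e).Nonempty ∧ P.tie k e (P.oldest x k st e) = p := by
  simp only [cleanRequests, Finset.mem_image, Finset.mem_filter, Finset.mem_univ, true_and,
    Prod.mk.injEq]
  constructor
  · rintro ⟨e', ⟨h1, h2⟩, h3, rfl⟩
    exact ⟨h1, h2, h3⟩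
  · rintro ⟨h1, h2, h3⟩
    exact ⟨e, ⟨h1, h2⟩, h3, rfl⟩

theorem mem_buffer_of_mem_cleanRequests {x : Sample N G S} {k : ℕ} {st : Packet G → Status}
    {p : Packet G} {e : E} (h : (p, e) ∈ P.cleanRequests x k st) : p ∈ P.buffer x k st e := by
  obtain ⟨-, h1, rfl⟩ := P.mem_cleanRequests.1 h
  exact P.oldest_subset (P.tie_mem_oldest h1)

theorem cleanPhase_failedAt (x : Sample N G S) (k : ℕ) (st : Packet G → Status) (p : Packet G) :
    (P.cleanPhase x k st p).failedAt = (st p).failedAt := by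
  unfold cleanPhase
  rcases x.afterRun_cases st _ _ _ _ id p with
    ⟨h', -⟩ | ⟨e, s, -, -, -, -, h'⟩ | ⟨e, -, -, -, h'⟩ <;> rw [h'] <;> rfl

theorem pos_le_cleanPhase (x : Sample N G S) (k : ℕ) (st : Packet G → Status) (p : Packet G) :
    (st p).pos ≤ (P.cleanPhase x k st p).pos := by
  unfold cleanPhase
  rcases x.afterRun_cases st _ _ _ _ id p with
    ⟨h', -⟩ | ⟨e, s, -, -, -, -, h'⟩ | ⟨e, -, -, -, h'⟩ <;> rw [h'] <;> simp [Sample.advance]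

theorem cleanPhase_pos_of_not_failed (x : Sample N G S) (k : ℕ) (st : Packet G → Status)
    (p : Packet G) (hp : (st p).failedAt = none) :
    (P.cleanPhase x k st p).pos = (st p).pos := by
  unfold cleanPhase
  rcases x.afterRun_cases st (P.cleanRequests x k st) (P.alg.run 1 (N.m * P.J)
      (P.cleanRequests x k st) (x.seed₂ k)) (k * P.T + P.firstLength) P.cleanLength id p with
    ⟨h', -⟩ | ⟨e, s, -, hm, -, -, h'⟩ | ⟨e, -, -, -, h'⟩
  · rw [h']
  · have := (P.mem_buffer.1 (P.mem_buffer_of_mem_cleanRequests hm)).2.1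
    simp [hp] at this
  · rw [h']; rfl

theorem punctual_firstPhase (hT0 : 0 < P.T) {x : Sample N G S} {k : ℕ} {st : Packet G → Status}
    (h : P.Punctual x k st) : P.Punctual x (k + 1) (P.firstPhase x k st) := by
  intro p
  have hp := h p
  have hdiv : p.2 < k * P.T ↔ p.2 / P.T + 1 ≤ k := by
    rw [← Nat.div_lt_iff_lt_mul hT0, Nat.lt_iff_add_one_le]
  unfold firstPhase
  rcases x.afterRun_cases st (P.firstRequests x k st) (P.alg.run P.J (N.m * P.J)
      (P.firstRequests x k st) (x.seed₁ k)) (k * P.T) P.firstLength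
      (fun s => ⟨s.pos, some k, s.deliveredAt⟩) p with
    ⟨h', hn⟩ | ⟨e, s, he, hm, -, -, h'⟩ | ⟨e, he, hm, -, h'⟩
  · rw [h']
    refine ⟨fun j hj => ?_, fun hnone => ?_⟩
    · obtain ⟨h1, h2⟩ := hp.1 j hj
      exact ⟨h1.trans (Nat.lt_succ_self _), h2⟩
    · have h1 := hp.2 hnone
      by_cases hk : p.2 / P.T + 1 ≤ k
      · by_cases hl : (st p).pos < x.len p
        · obtain ⟨e, he⟩ := Sample.exists_hop hl
          exact absurd (P.mem_firstRequests.2 ⟨hdiv.2 hk, hnone, he⟩) (hn e he)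
        · omega
      · omega
  · rw [h']
    have hm' := P.mem_firstRequests.1 hm
    have h1 := hp.2 hm'.2.1
    have hlt := Sample.lt_len_of_hop he
    have hk := hdiv.1 hm'.1
    simp only [Sample.advance]
    refine ⟨fun j hj => ?_, fun _ => ?_⟩
    · rw [hm'.2.1] at hj; cases hj
    · omega
  · rw [h']
    have hm' := P.mem_firstRequests.1 hm
    have h1 := hp.2 hm'.2.1
    have hlt := Sample.lt_len_of_hop he
    have hk := hdiv.1 hm'.1
    refine ⟨fun j hj => ?_, fun hc => by simp at hc⟩
    simp only [Option.some.injEq] at hj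
    omega

theorem punctual_state (hT0 : 0 < P.T) (x : Sample N G S) (k : ℕ) :
    P.Punctual x k (P.state x k) := by
  induction k with
  | zero => intro p; simp [Protocol.state]
  | succ k ih =>
    have h := P.punctual_firstPhase hT0 ih
    intro p
    rw [Protocol.state, cleanPhase_failedAt]
    refine ⟨(h p).1, fun hn => ?_⟩
    rw [P.cleanPhase_pos_of_not_failed _ _ _ _ hn]
    exact (h p).2 hn

/-- The first phase ignores the packets that have failed before. -/
theorem firstPhase_failedAt_of_some (x : Sample N G S) (k : ℕ) (st : Packet G → Status)
    (p : Packet G) (hp : (st p).failedAt ≠ none) : P.firstPhase x k st p = st p := by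
  unfold firstPhase
  rcases x.afterRun_cases st (P.firstRequests x k st) (P.alg.run P.J (N.m * P.J)
      (P.firstRequests x k st) (x.seed₁ k)) (k * P.T) P.firstLength
      (fun s => ⟨s.pos, some k, s.deliveredAt⟩) p with
    ⟨h', -⟩ | ⟨e, s, -, hm, -, -, h'⟩ | ⟨e, -, hm, -, h'⟩
  · exact h'
  · exact absurd (P.mem_firstRequests.1 hm).2.1 hp
  · exact absurd (P.mem_firstRequests.1 hm).2.1 hp

theorem state_failedAt_succ (x : Sample N G S) (k j : ℕ) (p : Packet G)
    (h : (P.state x k p).failedAt = some j) : (P.state x (k + 1) p).failedAt = some j := by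
  rw [Protocol.state, cleanPhase_failedAt, P.firstPhase_failedAt_of_some _ _ _ _ (by simp [h]), h]

/-- A packet fails in the frame that its status records. -/
theorem state_failedAt_of_lt (hT0 : 0 < P.T) (x : Sample N G S) (k j : ℕ) (p : Packet G)
    (h : (P.state x k p).failedAt = some j) : (P.state x (j + 1) p).failedAt = some j := by
  have hjk := ((P.punctual_state hT0 x k p).1 j h).1
  have hmono : ∀ i n l, (P.state x l p).failedAt = some i →
      (P.state x (l + n) p).failedAt = some i := by
    intro i n l hl
    induction n with
    | zero => exact hl
    | succ n ih => exact P.state_failedAt_succ x _ i p ih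
  cases hf : (P.state x (j + 1) p).failedAt with
  | none =>
    exfalso
    obtain ⟨n, rfl⟩ : ∃ n, k = j + 1 + n := ⟨k - (j + 1), by omega⟩
    clear hjk
    induction n with
    | zero => simp [h] at hf
    | succ n ih =>
      by_cases hc : (P.state x (j + 1 + n) p).failedAt = none
      · have hn : (P.firstPhase x (j + 1 + n) (P.state x (j + 1 + n)) p).failedAt = some j := by
          rw [← cleanPhase_failedAt P x (j + 1 + n)]
          exact h
        unfold firstPhase at hn
        rcases x.afterRun_cases (P.state x (j + 1 + n)) _ _ ((j + 1 + n) * P.T) P.firstLength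
            (fun s => ⟨s.pos, some (j + 1 + n), s.deliveredAt⟩) p with
          ⟨h', -⟩ | ⟨e, s, -, -, -, -, h'⟩ | ⟨e, -, -, -, h'⟩
        · rw [h', hc] at hn; cases hn
        · rw [h'] at hn; simp [Sample.advance, hc] at hn
        · rw [h'] at hn; simp at hn; omega
      · obtain ⟨i, hi⟩ := Option.ne_none_iff_exists'.1 hc
        have := P.state_failedAt_succ x _ i p hi
        rw [Nat.add_assoc (j + 1), h] at this
        cases this
        exact ih hi
  | some i =>
    obtain ⟨n, rfl⟩ : ∃ n, k = j + 1 + n := ⟨k - (j + 1), by omega⟩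
    rw [← hmono i n _ hf, h]

/-! ### The potential of the failed packets -/

open Classical in
/-- The number of links that packet `p` still has to cross, provided that it failed in one of
the frames in `A`. -/
noncomputable def debt (x : Sample N G S) (A : Set ℕ) (st : Packet G → Status) (p : Packet G) : ℕ :=
  if ∃ i ∈ A, (st p).failedAt = some i then x.len p - (st p).pos else 0

/-- The potential at frame `k`: the number of transmissions needed by the packets that failed in
one of the frames in `A`. -/
noncomputable def pot (x : Sample N G S) (A : Set ℕ) (k : ℕ) (st : Packet G → Status) : ℕ :=
  ∑ p ∈ (Finset.univ : Finset G) ×ˢ Finset.range (k * P.T), debt x A st p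

/-- The potential at the beginning of frame `k`. -/
noncomputable def potential (x : Sample N G S) (A : Set ℕ) (k : ℕ) : ℕ :=
  P.pot x A k (P.state x k)

/-- The potential of frame `k` between its two phases. -/
noncomputable def midPotential (x : Sample N G S) (A : Set ℕ) (k : ℕ) : ℕ :=
  P.pot x A k (P.firstPhase x k (P.state x k))

theorem debt_le (x : Sample N G S) (A : Set ℕ) (st : Packet G → Status) (p : Packet G) :
    debt x A st p ≤ N.D := by
  unfold debt
  split_ifs
  · exact (Nat.sub_le _ _).trans (x.len_le p)
  · exact Nat.zero_le _

theorem debt_cleanPhase_le (x : Sample N G S) (A : Set ℕ) (k : ℕ) (st : Packet G → Status)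
    (p : Packet G) : debt x A (P.cleanPhase x k st) p ≤ debt x A st p := by
  unfold debt
  rw [cleanPhase_failedAt]
  split_ifs
  · exact Nat.sub_le_sub_left (P.pos_le_cleanPhase x k st p) _
  · exact le_rfl

theorem potential_zero (x : Sample N G S) (A : Set ℕ) : P.potential x A 0 = 0 := by
  simp [potential, pot]

theorem potential_succ (hT0 : 0 < P.T) (x : Sample N G S) (A : Set ℕ) (k : ℕ) :
    P.potential x A (k + 1) =
      P.pot x A k (P.cleanPhase x k (P.firstPhase x k (P.state x k))) := by
  unfold potential pot
  symm
  refine Finset.sum_subset ?_ (fun p _ hp2 => ?_)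
  · refine Finset.product_subset_product_right ?_
    exact Finset.range_mono (Nat.mul_le_mul_right _ (Nat.le_succ k))
  · unfold debt
    rw [if_neg]
    rintro ⟨j, -, hj⟩
    have h := (P.punctual_state hT0 x (k + 1) p).1 j hj
    refine hp2 (Finset.mem_product.2 ⟨Finset.mem_univ _, Finset.mem_range.2 ?_⟩)
    rw [← Nat.div_lt_iff_lt_mul hT0]
    omega

theorem potential_succ_le (hT0 : 0 < P.T) (x : Sample N G S) (A : Set ℕ) (k : ℕ) :
    P.potential x A (k + 1) ≤ P.midPotential x A k := by
  rw [P.potential_succ hT0]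
  exact Finset.sum_le_sum (fun p _ => P.debt_cleanPhase_le x A k _ p)

/-- All requests of the first phase of frame `k` are served in time. -/
def FirstServed (x : Sample N G S) (k : ℕ) (Q : Finset (Packet G × E)) : Prop :=
  ∀ r ∈ Q, ∃ s, P.alg.run P.J (N.m * P.J) Q (x.seed₁ k) r = some s ∧ s < P.firstLength

open Classical in
/-- The first phase of a frame increases the potential only if some request is not served, and then
by at most `D` for each request. -/
theorem midPotential_le (x : Sample N G S) (A : Set ℕ) (k : ℕ) :
    P.midPotential x A k ≤ P.potential x A k +
      if P.FirstServed x k (P.firstRequests x k (P.state x k)) then 0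
      else N.D * (P.firstRequests x k (P.state x k)).card := by
  set st := P.state x k
  set Q := P.firstRequests x k st
  have hdebt : ∀ p, debt x A (P.firstPhase x k st) p ≤ debt x A st p +
      if (¬ P.FirstServed x k Q) ∧ p ∈ Q.image Prod.fst then N.D else 0 := by
    intro p
    unfold firstPhase
    rcases x.afterRun_cases st (P.firstRequests x k st) (P.alg.run P.J (N.m * P.J)
        (P.firstRequests x k st) (x.seed₁ k)) (k * P.T) P.firstLength
        (fun s => ⟨s.pos, some k, s.deliveredAt⟩) p with
      ⟨h', -⟩ | ⟨e, s, -, hm, -, -, h'⟩ | ⟨e, -, hm, hf, h'⟩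
    · refine le_trans (le_of_eq ?_) (Nat.le_add_right _ _)
      simp only [debt, h']
    · refine le_trans (le_of_eq ?_) (Nat.zero_le _)
      have := (P.mem_firstRequests.1 hm).2.1
      simp [debt, h', Sample.advance, this]
    · refine (debt_le _ _ _ _).trans ?_
      rw [if_pos]
      · exact Nat.le_add_left _ _
      · refine ⟨fun hs => ?_, Finset.mem_image.2 ⟨_, hm, rfl⟩⟩
        obtain ⟨s, h1, h2⟩ := hs _ hm
        exact absurd (hf s h1) (not_le.2 h2)
  refine (Finset.sum_le_sum (fun p _ => hdebt p)).trans ?_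
  rw [Finset.sum_add_distrib]
  refine Nat.add_le_add_left ?_ _
  by_cases hs : P.FirstServed x k Q
  · simp [hs]
  · simp only [hs, not_false_eq_true, true_and, if_false]
    rw [← Finset.sum_filter, Finset.sum_const, smul_eq_mul, mul_comm]
    refine Nat.mul_le_mul_left _ ?_
    refine (Finset.card_le_card (fun p hp => (Finset.mem_filter.1 hp).2)).trans
      Finset.card_image_le

/-- Failures in the current frame do not affect the potential of the packets that failed before. -/
theorem midPotential_le_of_notMem (x : Sample N G S) (A : Set ℕ) (k : ℕ) (hk : k ∉ A) :
    P.midPotential x A k ≤ P.potential x A k := by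
  refine Finset.sum_le_sum (fun p _ => ?_)
  by_cases hp : (P.state x k p).failedAt = none
  · have h0 : debt x A (P.firstPhase x k (P.state x k)) p = 0 := by
      unfold debt
      rw [if_neg]
      rintro ⟨i, hi, hf⟩
      unfold firstPhase at hf
      rcases x.afterRun_cases (P.state x k) _ _ (k * P.T) P.firstLength
          (fun s => ⟨s.pos, some k, s.deliveredAt⟩) p with
        ⟨h', -⟩ | ⟨e, s, -, hm, -, -, h'⟩ | ⟨e, -, hm, -, h'⟩
      · rw [h', hp] at hf; cases hf
      · rw [h'] at hf; simp [Sample.advance, hp] at hf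
      · rw [h'] at hf
        simp only [Option.some.injEq] at hf
        exact hk (hf ▸ hi)
    rw [h0]
    exact Nat.zero_le _
  · unfold debt
    rw [P.firstPhase_failedAt_of_some _ _ _ _ hp]

open Classical in
/-- The links whose buffer holds a packet that failed in one of the frames in `A`. -/
noncomputable def hot (x : Sample N G S) (A : Set ℕ) (k : ℕ) (st : Packet G → Status) : Finset E :=
  Finset.univ.filter (fun e => ∃ p ∈ P.buffer x k st e, ∃ i ∈ A, (st p).failedAt = some i)

/-- A failed packet with a positive debt waits in the buffer of its next link. -/
theorem hot_nonempty (x : Sample N G S) (A : Set ℕ) (k : ℕ) (st : Packet G → Status)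
    (h : 0 < P.pot x A k st) : (P.hot x A k st).Nonempty := by
  obtain ⟨p, hp, h0⟩ := Finset.exists_ne_zero_of_sum_ne_zero h.ne'
  unfold debt at h0
  split_ifs at h0 with hc
  · obtain ⟨i, hi, hf⟩ := hc
    obtain ⟨e, he⟩ := Sample.exists_hop (x := x) (p := p) (i := (st p).pos) (by omega)
    refine ⟨e, ?_⟩
    simp only [hot, Finset.mem_filter, Finset.mem_univ, true_and]
    refine ⟨p, P.mem_buffer.2 ⟨?_, by simp [hf], he⟩, i, hi, hf⟩
    simpa using hp
  · exact absurd rfl h0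

/-- If the experiment of a link `e` is the only successful one, if the buffer of `e` holds a packet
that failed in one of the frames in the lower set `A`, and if the one request is served, then
the potential with respect to `A` decreases: the selected packet failed no later. -/
theorem pot_cleanPhase_lt (x : Sample N G S) {A : Set ℕ} (hA : IsLowerSet A) (k : ℕ)
    (st : Packet G → Status) {e : E} (he : e ∈ P.hot x A k st) (hcoin : x.coin k e = true)
    (hcoin' : ∀ e', e' ≠ e → x.coin k e' = false)
    (hserved : ∃ s, P.alg.run 1 (N.m * P.J) {(P.tie k e (P.oldest x k st e), e)} (x.seed₂ k)
      (P.tie k e (P.oldest x k st e), e) = some s ∧ s < P.cleanLength) :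
    P.pot x A k (P.cleanPhase x k st) + 1 ≤ P.pot x A k st := by
  classical
  simp only [hot, Finset.mem_filter, Finset.mem_univ, true_and] at he
  obtain ⟨q, hq, i, hi, hf⟩ := he
  set p := P.tie k e (P.oldest x k st e) with hp
  have hpo : p ∈ P.oldest x k st e := P.tie_mem_oldest ⟨q, hq⟩
  have hpb := P.mem_buffer.1 (P.oldest_subset hpo)
  obtain ⟨i', hi'⟩ := Option.isSome_iff_exists.1 hpb.2.1
  have hi'A : i' ∈ A := by
    simp only [oldest, Finset.mem_filter] at hpo
    exact hA (hpo.2 q hq i' i hi' hf) hi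
  have hQ : P.cleanRequests x k st = {(p, e)} := by
    ext ⟨p', e'⟩
    rw [P.mem_cleanRequests, Finset.mem_singleton]
    constructor
    · rintro ⟨h1, -, h3⟩
      by_cases hee : e' = e
      · subst hee
        exact Prod.ext h3.symm rfl
      · rw [hcoin' e' hee] at h1
        cases h1
    · intro h
      have h1 : p' = p := congrArg Prod.fst h
      have h2 : e' = e := congrArg Prod.snd h
      subst h2
      exact ⟨hcoin, ⟨q, hq⟩, h1.symm⟩
  have hadv : (P.cleanPhase x k st p).pos = (st p).pos + 1 := by
    unfold cleanPhase
    rw [hQ]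
    obtain ⟨s, hs, hsl⟩ := hserved
    rcases x.afterRun_cases st {(p, e)} (P.alg.run 1 (N.m * P.J) {(p, e)} (x.seed₂ k))
        (k * P.T + P.firstLength) P.cleanLength id p with
      ⟨-, h'⟩ | ⟨e', s', -, -, -, -, h'⟩ | ⟨e', h1, h2, h3, -⟩
    · exact absurd (Finset.mem_singleton_self _) (h' e hpb.2.2)
    · rw [h']; rfl
    · simp only [Finset.mem_singleton, Prod.mk.injEq, true_and] at h2
      subst h2
      exact absurd (h3 s hs) (not_le.2 hsl)
  have hlt := Sample.lt_len_of_hop hpb.2.2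
  refine Finset.sum_lt_sum (fun p' _ => P.debt_cleanPhase_le x A k st p') ⟨p, ?_, ?_⟩
  · simpa using hpb.1
  · unfold debt
    rw [cleanPhase_failedAt, if_pos ⟨i', hi'A, hi'⟩, if_pos ⟨i', hi'A, hi'⟩, hadv]
    omega

/-! ### The planned requests -/

open Classical in
/-- The requests that the first phase of frame `k` would have if no packet had ever failed. They
stem from the packets injected in the `D` preceding frames. -/
noncomputable def planned (x : Sample N G S) (k : ℕ) : Finset (Packet G × E) :=
  (((Finset.univ : Finset G) ×ˢ Finset.Ico ((k - N.D) * P.T) (k * P.T)) ×ˢ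
    (Finset.univ : Finset E)).filter (fun r => x.hop r.1 (k - (r.1.2 / P.T + 1)) = some r.2)

/-- A packet that has not failed is where it would be if no packet had ever failed, and it is
delivered within `D` frames. -/
theorem firstRequests_subset_planned (hT0 : 0 < P.T) (x : Sample N G S) (k : ℕ) :
    P.firstRequests x k (P.state x k) ⊆ P.planned x k := by
  rintro ⟨p, e⟩ hr
  obtain ⟨h1, h2, h3⟩ := P.mem_firstRequests.1 hr
  have hpos := (P.punctual_state hT0 x k p).2 h2
  have hlt := Sample.lt_len_of_hop h3
  have hlen := x.len_le p
  have hk := (Nat.div_lt_iff_lt_mul hT0).2 h1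
  have hpos' : (P.state x k p).pos = k - (p.2 / P.T + 1) := by omega
  simp only [planned, Finset.mem_filter, Finset.mem_product, Finset.mem_univ, Finset.mem_Ico,
    true_and, and_true]
  refine ⟨⟨?_, h1⟩, hpos' ▸ h3⟩
  refine le_trans (Nat.mul_le_mul_right _ ?_) (Nat.div_mul_le_self p.2 P.T)
  generalize p.2 / P.T = i at *
  omega

end Protocol

end Dynamics

/-! ### The frames in which a packet is undelivered -/

section Delay

set_option linter.unusedSectionVars false

variable {V E : Type*} {N : Network V E} {G S : Type*} [Fintype E] [Fintype G]
  [MeasurableSpace S] (P : Protocol N G S)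

namespace Protocol

/-- A packet that is undelivered although it has seen as many frames as its route has links has
failed, and it still contributes to the potential of the packets that failed no later. -/
theorem exists_failure_of_undelivered (hT0 : 0 < P.T) (x : Sample N G S) (p : Packet G) {k : ℕ}
    (hk : p.2 / P.T + 1 + x.len p ≤ k) (hpos : (P.state x k p).pos < x.len p) :
    ∃ j < x.len p, p.2 / P.T + 1 + j < k ∧
      (P.state x (p.2 / P.T + 1 + j + 1) p).failedAt = some (p.2 / P.T + 1 + j) ∧
      0 < P.potential x (Set.Iic (p.2 / P.T + 1 + j)) k := by
  have hp := P.punctual_state hT0 x k p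
  cases hf : (P.state x k p).failedAt with
  | none =>
    have := hp.2 hf
    omega
  | some i =>
    obtain ⟨h1, h2, h3⟩ := hp.1 i hf
    refine ⟨i - (p.2 / P.T + 1), h3, ?_⟩
    rw [Nat.add_sub_cancel' h2]
    refine ⟨h1, P.state_failedAt_of_lt hT0 x k i p hf, ?_⟩
    refine lt_of_lt_of_le ?_ (Finset.single_le_sum (f := debt x (Set.Iic i) (P.state x k))
      (fun _ _ => Nat.zero_le _) (a := p) ?_)
    · unfold debt
      rw [if_pos ⟨i, Set.mem_Iic.2 le_rfl, hf⟩]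
      omega
    · simp only [Finset.mem_product, Finset.mem_univ, Finset.mem_range, true_and]
      rw [← Nat.div_lt_iff_lt_mul hT0]
      omega

/-- The frames in which a packet is undelivered: one for each link of its route, and after a failure
those in which the potential of the packets that failed no later is positive. -/
theorem undelivered_indicator_le (hT0 : 0 < P.T) (x : Sample N G S) (p : Packet G) (k : ℕ) :
    {k | p.2 / P.T + 1 ≤ k ∧ (P.state x k p).pos < x.len p}.indicator
        (fun _ => (1 : ℝ≥0∞)) k ≤
      (Set.Ico (p.2 / P.T + 1) (p.2 / P.T + 1 + x.len p)).indicator (fun _ => 1) k +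
      ∑ j ∈ Finset.range (x.len p),
        {k | p.2 / P.T + 1 + j < k ∧
          (P.state x (p.2 / P.T + 1 + j + 1) p).failedAt = some (p.2 / P.T + 1 + j) ∧
          0 < P.potential x (Set.Iic (p.2 / P.T + 1 + j)) k}.indicator (fun _ => 1) k := by
  by_cases hk : k ∈ {k | p.2 / P.T + 1 ≤ k ∧ (P.state x k p).pos < x.len p}
  swap
  · rw [Set.indicator_of_notMem hk]
    exact bot_le
  rw [Set.indicator_of_mem hk]
  by_cases h : k < p.2 / P.T + 1 + x.len p
  · rw [Set.indicator_of_mem (show k ∈ Set.Ico _ _ from ⟨hk.1, h⟩)]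
    exact le_self_add
  · obtain ⟨j, hj, hj'⟩ := P.exists_failure_of_undelivered hT0 x p (not_lt.1 h) hk.2
    refine le_trans ?_ le_add_self
    refine le_trans ?_ (Finset.single_le_sum (fun _ _ => bot_le) (Finset.mem_range.2 hj))
    rw [Set.indicator_of_mem]
    exact hj'

end Protocol

end Delay

/-! ### Measurability of the protocol -/

section Measurability

set_option linter.unusedSectionVars false

variable {V E : Type*} {N : Network V E} {G S : Type*}

instance [Countable E] : Countable (Route N) :=
  Function.Injective.countable (f := Route.links) (fun a b h => by
    cases a; cases b; cases h; rfl)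

instance : Countable Status :=
  Function.Injective.countable (f := fun s : Status => (s.pos, s.failedAt, s.deliveredAt))
    (fun a b h => by
      cases a; cases b
      simp only [Prod.mk.injEq] at h
      obtain ⟨rfl, rfl, rfl⟩ := h
      rfl)

variable {Ω : Type*} [MeasurableSpace S]

/-- The `σ`-algebra generated by a set of sources of randomness. -/
@[reducible] def srcAlg (x : Ω → Sample N G S) (U : Set (Source G E)) : MeasurableSpace Ω :=
  ⨆ i ∈ U, Source.sigma x i

variable {x : Ω → Sample N G S}

theorem sigma_le_srcAlg {U : Set (Source G E)} {i : Source G E} (hi : i ∈ U) :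
    Source.sigma x i ≤ srcAlg x U := le_biSup (Source.sigma x) hi

theorem srcAlg_mono {U U' : Set (Source G E)} (h : U ⊆ U') : srcAlg x U ≤ srcAlg x U' :=
  biSup_mono h

theorem dmeas_inj {U : Set (Source G E)} {t : ℕ} {g : G} (h : Source.inject t g ∈ U) :
    DMeas (srcAlg x U) (fun ω => (x ω).inj t g) :=
  fun s => sigma_le_srcAlg h _ ⟨s, MeasurableSpace.measurableSet_top, rfl⟩

theorem dmeas_coin {U : Set (Source G E)} {k : ℕ} {e : E} (h : Source.coin k e ∈ U) :
    DMeas (srcAlg x U) (fun ω => (x ω).coin k e) :=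
  fun s => sigma_le_srcAlg h _ ⟨s, MeasurableSet.of_discrete, rfl⟩

theorem measurable_seed₁ {U : Set (Source G E)} {k : ℕ} (h : Source.first k ∈ U) :
    Measurable[srcAlg x U] (fun ω => (x ω).seed₁ k) :=
  fun s hs => sigma_le_srcAlg h _ ⟨s, hs, rfl⟩

theorem measurable_seed₂ {U : Set (Source G E)} {k : ℕ} (h : Source.second k ∈ U) :
    Measurable[srcAlg x U] (fun ω => (x ω).seed₂ k) :=
  fun s hs => sigma_le_srcAlg h _ ⟨s, hs, rfl⟩

/-- The sources that influence the system before frame `k`, and all injections. -/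
def Source.past (k : ℕ) : Set (Source G E)
  | .inject _ _ => True
  | .coin j _ => j < k
  | .first j => j < k
  | .second j => j < k

/-- The sources that influence the system before the clean-up phase of frame `k`, and all
injections. -/
def Source.mid (k : ℕ) : Set (Source G E)
  | .inject _ _ => True
  | .coin j _ => j < k
  | .first j => j ≤ k
  | .second j => j < k

theorem Source.inject_mem_past (k t : ℕ) (g : G) :
    (Source.inject t g : Source G E) ∈ Source.past k := trivial

theorem Source.inject_mem_mid (k t : ℕ) (g : G) :
    (Source.inject t g : Source G E) ∈ Source.mid k := trivial

theorem Source.past_subset_mid (k : ℕ) : Source.past k ⊆ (Source.mid k : Set (Source G E)) := by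
  rintro (_ | _ | j | _) h
  · exact h
  · exact h
  · exact Nat.le_of_lt h
  · exact h

theorem Source.mid_subset_past (k : ℕ) :
    Source.mid k ⊆ (Source.past (k + 1) : Set (Source G E)) := by
  rintro (_ | _ | j | _) h
  · exact h
  · exact Nat.lt_succ_of_lt h
  · exact Nat.lt_succ_of_le h
  · exact Nat.lt_succ_of_lt h

namespace Protocol

variable [Fintype E] [Fintype G] (P : Protocol N G S) {m : MeasurableSpace Ω}

/-- The schedule of an execution on random requests is measurable, because there are only countably
many request sets. -/
theorem dmeas_run {Q : Ω → Finset (Packet G × E)} (hQ : DMeas m Q) {seed : Ω → S}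
    (hseed : Measurable[m] seed) (I n : ℝ) (r : Packet G × E) :
    DMeas m (fun ω => P.alg.run I n (Q ω) (seed ω) r) := by
  refine hQ.bind (h := fun Q ω => P.alg.run I n Q (seed ω) r) (fun Q => ?_)
  have hs : ∀ s, MeasurableSet[m] {ω | P.alg.run I n Q (seed ω) r = some s} := fun s =>
    hseed (P.alg.measurableSet_run I n Q r s)
  refine DMeas.of_fiber (fun o => ?_)
  cases o with
  | some s => exact hs s
  | none =>
    have : {ω | P.alg.run I n Q (seed ω) r = none} =
        (⋃ s, {ω | P.alg.run I n Q (seed ω) r = some s})ᶜ := by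
      ext ω
      simp only [Set.mem_ofPred_eq, Set.mem_compl_iff, Set.mem_iUnion, not_exists]
      exact Option.eq_none_iff_forall_ne_some
    rw [this]
    exact (MeasurableSet.iUnion hs).compl

theorem dmeas_afterRun (hinj : ∀ t g, DMeas m (fun ω => (x ω).inj t g))
    {st : Ω → Packet G → Status} (hst : ∀ p, DMeas m (fun ω => st ω p))
    {Q : Ω → Finset (Packet G × E)} (hQ : DMeas m Q) {out : Ω → Packet G × E → Option ℕ}
    (hout : ∀ r, DMeas m (fun ω => out ω r)) (start len : ℕ) (onFail : Status → Status)
    (p : Packet G) :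
    DMeas m (fun ω => (x ω).afterRun (st ω) (Q ω) (out ω) start len onFail p) := by
  have hτ := (hinj p.2 p.1).prodMk ((hst p).prodMk (hQ.prodMk
    (DMeas.pi (f := fun (e : E) ω => out ω (p, e)) (fun e => hout (p, e)))))
  -- the new status is a function of the route, the old status, the requests and their schedule
  exact hτ.comp (fun τ => Sample.afterRun (⟨fun _ _ => τ.1, fun _ => (), fun _ => (),
    fun _ _ => true⟩ : Sample N G Unit) (fun _ => τ.2.1) τ.2.2.1 (fun r => τ.2.2.2 r.2)
    start len onFail p)

section Requests

variable (hinj : ∀ t g, DMeas m (fun ω => (x ω).inj t g))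
  {st : Ω → Packet G → Status} (hst : ∀ p, DMeas m (fun ω => st ω p)) (k : ℕ)

include hinj hst

theorem dmeas_firstRequests : DMeas m (fun ω => P.firstRequests (x ω) k (st ω)) := by
  refine DMeas.finset (fun ⟨p, e⟩ => ?_)
  simp_rw [mem_firstRequests]
  exact ((hinj p.2 p.1).prodMk (hst p)).setOf (fun τ => p.2 < k * P.T ∧ τ.2.failedAt = none ∧
    τ.1.bind (fun r => r.links[τ.2.pos]?) = some e)

theorem dmeas_buffer (e : E) : DMeas m (fun ω => P.buffer (x ω) k (st ω) e) := by
  refine DMeas.finset (fun p => ?_)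
  simp_rw [mem_buffer]
  exact ((hinj p.2 p.1).prodMk (hst p)).setOf (fun τ => p.2 < k * P.T ∧ τ.2.failedAt.isSome ∧
    τ.1.bind (fun r => r.links[τ.2.pos]?) = some e)

theorem dmeas_oldest (e : E) : DMeas m (fun ω => P.oldest (x ω) k (st ω) e) := by
  refine DMeas.finset (fun p => ?_)
  have hb := P.dmeas_buffer hinj hst k e
  have : {ω | p ∈ P.oldest (x ω) k (st ω) e} = {ω | p ∈ P.buffer (x ω) k (st ω) e} ∩
      ⋂ q, {ω | q ∈ P.buffer (x ω) k (st ω) e → ∀ i j, (st ω p).failedAt = some i →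
        (st ω q).failedAt = some j → i ≤ j} := by
    ext ω
    simp [oldest]
  rw [this]
  refine (hb.setOf (fun b => p ∈ b)).inter (MeasurableSet.iInter (fun q => ?_))
  exact (hb.prodMk ((hst p).prodMk (hst q))).setOf (fun τ => q ∈ τ.1 → ∀ i j,
    τ.2.1.failedAt = some i → τ.2.2.failedAt = some j → i ≤ j)

theorem dmeas_selected :
    DMeas m (fun ω (e : E) => P.tie k e (P.oldest (x ω) k (st ω) e)) :=
  DMeas.pi (fun e => (P.dmeas_oldest hinj hst k e).comp (P.tie k e))

theorem dmeas_hot (A : Set ℕ) : DMeas m (fun ω => P.hot (x ω) A k (st ω)) := by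
  refine DMeas.finset (fun e => ?_)
  have : {ω | e ∈ P.hot (x ω) A k (st ω)} = ⋃ p, {ω | p ∈ P.buffer (x ω) k (st ω) e ∧
      ∃ i ∈ A, (st ω p).failedAt = some i} := by
    ext ω
    simp [hot]
  rw [this]
  exact MeasurableSet.iUnion (fun p => ((P.dmeas_buffer hinj hst k e).prodMk (hst p)).setOf
    (fun τ => p ∈ τ.1 ∧ ∃ i ∈ A, τ.2.failedAt = some i))

theorem dmeas_cleanRequests (hcoin : ∀ e, DMeas m (fun ω => (x ω).coin k e)) :
    DMeas m (fun ω => P.cleanRequests (x ω) k (st ω)) := by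
  refine DMeas.finset (fun ⟨p, e⟩ => ?_)
  simp_rw [mem_cleanRequests]
  exact ((hcoin e).prodMk ((P.dmeas_buffer hinj hst k e).prodMk
    (P.dmeas_oldest hinj hst k e))).setOf
    (fun τ => τ.1 = true ∧ τ.2.1.Nonempty ∧ P.tie k e τ.2.2 = p)

theorem dmeas_debt (A : Set ℕ) (p : Packet G) : DMeas m (fun ω => debt (x ω) A (st ω) p) := by
  classical
  exact ((hinj p.2 p.1).prodMk (hst p)).comp (fun τ =>
    if ∃ i ∈ A, τ.2.failedAt = some i then
      τ.1.elim 0 (fun r => r.links.length) - τ.2.pos else 0)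

theorem dmeas_pot (A : Set ℕ) : DMeas m (fun ω => P.pot (x ω) A k (st ω)) := by
  unfold pot
  induction ((Finset.univ : Finset G) ×ˢ Finset.range (k * P.T)) using
    Finset.cons_induction_on with
  | empty => simpa using DMeas.const _
  | cons p s hp ih =>
    simp_rw [Finset.sum_cons]
    exact ((dmeas_debt hinj hst A p).prodMk ih).comp (fun τ => τ.1 + τ.2)

theorem dmeas_firstPhase (hseed : Measurable[m] (fun ω => (x ω).seed₁ k)) (p : Packet G) :
    DMeas m (fun ω => P.firstPhase (x ω) k (st ω) p) :=
  dmeas_afterRun hinj hst (P.dmeas_firstRequests hinj hst k)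
    (fun r => P.dmeas_run (P.dmeas_firstRequests hinj hst k) hseed _ _ r) _ _ _ p

theorem dmeas_cleanPhase (hcoin : ∀ e, DMeas m (fun ω => (x ω).coin k e))
    (hseed : Measurable[m] (fun ω => (x ω).seed₂ k)) (p : Packet G) :
    DMeas m (fun ω => P.cleanPhase (x ω) k (st ω) p) :=
  dmeas_afterRun hinj hst (P.dmeas_cleanRequests hinj hst k hcoin)
    (fun r => P.dmeas_run (P.dmeas_cleanRequests hinj hst k hcoin) hseed _ _ r) _ _ _ p

end Requests

theorem dmeas_state_mid (k : ℕ) (h : ∀ p, DMeas (srcAlg x (Source.past k))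
    (fun ω => P.state (x ω) k p)) (p : Packet G) :
    DMeas (srcAlg x (Source.mid k)) (fun ω => P.firstPhase (x ω) k (P.state (x ω) k) p) :=
  P.dmeas_firstPhase (fun _ _ => dmeas_inj (Source.inject_mem_mid _ _ _))
    (fun p => (h p).mono (srcAlg_mono (Source.past_subset_mid k))) k
    (measurable_seed₁ (le_refl k)) p

theorem dmeas_state (k : ℕ) (p : Packet G) :
    DMeas (srcAlg x (Source.past k)) (fun ω => P.state (x ω) k p) := by
  induction k generalizing p with
  | zero => exact DMeas.const _
  | succ k ih =>
    exact P.dmeas_cleanPhase (fun _ _ => dmeas_inj (Source.inject_mem_past _ _ _))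
      (fun p => (P.dmeas_state_mid k ih p).mono (srcAlg_mono (Source.mid_subset_past k))) k
      (fun e => dmeas_coin (Nat.lt_succ_self k)) (measurable_seed₂ (Nat.lt_succ_self k)) p

theorem dmeas_firstPhase_state (k : ℕ) (p : Packet G) :
    DMeas (srcAlg x (Source.mid k)) (fun ω => P.firstPhase (x ω) k (P.state (x ω) k) p) :=
  P.dmeas_state_mid k (P.dmeas_state k) p

theorem dmeas_potential (A : Set ℕ) (k : ℕ) :
    DMeas (srcAlg x (Source.past k)) (fun ω => P.potential (x ω) A k) :=
  P.dmeas_pot (fun _ _ => dmeas_inj (Source.inject_mem_past _ _ _)) (P.dmeas_state k) k A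

theorem dmeas_midPotential (A : Set ℕ) (k : ℕ) :
    DMeas (srcAlg x (Source.mid k)) (fun ω => P.midPotential (x ω) A k) :=
  P.dmeas_pot (fun _ _ => dmeas_inj (Source.inject_mem_mid _ _ _)) (P.dmeas_firstPhase_state k) k A

theorem measurable_latency [mΩ : MeasurableSpace Ω] (hle : ∀ i, Source.sigma x i ≤ mΩ)
    (p : Packet G) : Measurable (fun ω => P.latency (x ω) p) := by
  classical
  unfold latency
  refine Measurable.iInf (fun k => Measurable.iInf (fun s => ?_))
  have h : DMeas mΩ (fun ω => P.state (x ω) k p) :=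
    (P.dmeas_state k p).mono (iSup₂_le (fun i _ => hle i))
  refine (h.measurable (fun st => ⨅ (_ : st.deliveredAt = some s),
    ((s - p.2 : ℕ) : ℝ≥0∞)))

/-- The planned requests of frame `k` depend on the injections in the `D` preceding frames. -/
def window (k : ℕ) : Set (Source G E)
  | .inject t _ => (k - N.D) * P.T ≤ t ∧ t < k * P.T
  | _ => False

theorem dmeas_planned (k : ℕ) : DMeas (srcAlg x (P.window k)) (fun ω => P.planned (x ω) k) := by
  refine DMeas.finset (fun ⟨p, e⟩ => ?_)
  by_cases hp : (k - N.D) * P.T ≤ p.2 ∧ p.2 < k * P.T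
  · have h := dmeas_inj (x := x) (U := P.window k) (t := p.2) (g := p.1) hp
    simp only [planned, Finset.mem_filter, Finset.mem_product, Finset.mem_univ, Finset.mem_Ico,
      true_and, and_true]
    exact h.setOf (fun o => ((k - N.D) * P.T ≤ p.2 ∧ p.2 < k * P.T) ∧
      o.bind (fun r => r.links[k - (p.2 / P.T + 1)]?) = some e)
  · have : {ω | (p, e) ∈ P.planned (x ω) k} = ∅ := by
      ext ω
      simp only [planned, Finset.mem_filter, Finset.mem_product, Finset.mem_univ, Finset.mem_Ico,
        true_and, and_true, Set.mem_ofPred_eq, Set.mem_empty_iff_false, iff_false, not_and]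
      exact fun h => absurd h hp
    rw [this]
    exact @MeasurableSet.empty _ (srcAlg x (P.window k))

end Protocol

end Measurability

/-! ### Calibrated protocols -/

section Drift

set_option linter.unusedSectionVars false

variable {V E : Type*} [Fintype E] {N : Network V E} {G S : Type*} [Fintype G]
  [MeasurableSpace S]

/-- The exponent in the tail bound for the interference of the planned requests of a frame. -/
noncomputable def Protocol.tailExp (P : Protocol N G S) : ℝ := P.ε ^ 2 * P.rate * P.T / 4

/-- The consequences of the choice of the frame length on which the analysis rests. By
`le_exp_tailExp` the probability of an overload is small compared with the drift of the clean-up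
phases, which is of order `1 / (m ^ 4 J)`. -/
structure Protocol.Calibrated (P : Protocol N G S) : Prop where
  guarantee : P.alg.Guarantee N (P.f N.m) (P.g N.m)
  D_pos : 0 < N.D
  one_le_m : 1 ≤ N.m
  ε_pos : 0 < P.ε
  ε_le : P.ε ≤ 1 / 2
  rate_nonneg : 0 ≤ P.rate
  T_pos : 0 < P.T
  length_le : P.firstLength + P.cleanLength ≤ P.T
  J_ge : 600 ≤ P.J
  two_le : 2 ≤ P.ε * P.J
  tailExp_le : P.tailExp ≤ P.J
  le_exp_tailExp : 4 * (N.m : ℝ) ^ 5 * P.J ^ 2 ≤ Real.exp P.tailExp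

/-- The sources of randomness are independent, and the experiments and the seeds have the right
laws. In contrast to `IsExecution`, nothing is said about the law of the injections, so that this
property is stable under conditioning on the injection of a packet. -/
structure IsRun {Ω : Type*} [mΩ : MeasurableSpace Ω] (P : Protocol N G S) (ν : Measure Ω)
    (x : Ω → Sample N G S) : Prop where
  le : ∀ i, Source.sigma x i ≤ mΩ
  coin_law : ∀ k e, ν.real {ω | (x ω).coin k e = true} = 1 / (N.m : ℝ)
  seed₁_law : ∀ k, ν.map (fun ω => (x ω).seed₁ k) = P.alg.seedLaw
  seed₂_law : ∀ k, ν.map (fun ω => (x ω).seed₂ k) = P.alg.seedLaw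
  indep : iIndep (Source.sigma x) ν

/-- The failure probability of one execution of the static algorithm. -/
noncomputable def Protocol.failProb (P : Protocol N G S) : ℝ := 1 / (2 * (N.m * P.J) ^ 4)

/-! ### Single executions of the static algorithm -/

theorem StaticAlgorithm.measurableSet_served {κ : Type*} (A : StaticAlgorithm κ E S) (I n : ℝ)
    (Q : Finset (κ × E)) (len : ℕ) :
    MeasurableSet {σ | ∀ r ∈ Q, ∃ s, A.run I n Q σ r = some s ∧ s < len} := by
  have : {σ | ∀ r ∈ Q, ∃ s, A.run I n Q σ r = some s ∧ s < len} =
      ⋂ r ∈ Q, ⋃ s, ⋃ (_ : s < len), {σ | A.run I n Q σ r = some s} := by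
    ext σ
    simp only [Set.mem_ofPred_eq, Set.mem_iInter, Set.mem_iUnion, exists_prop]
    exact forall₂_congr (fun r _ => exists_congr (fun s => and_comm))
  rw [this]
  exact Finset.measurableSet_biInter Q (fun r _ => MeasurableSet.iUnion (fun s =>
    MeasurableSet.iUnion (fun _ => A.measurableSet_run I n Q r s)))

/-- The guarantee in terms of full slots: the time bound may be rounded down, since the number of
slots is an integer. -/
theorem StaticAlgorithm.Guarantee.not_served_le {κ : Type*} {A : StaticAlgorithm κ E S} {a : ℝ}
    {b : ℝ → ℝ} (h : A.Guarantee N a b) {I n : ℝ} (hn : 1 ≤ n) {Q : Finset (κ × E)}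
    (hQ : (Q.card : ℝ) ≤ n) (hI : N.interference (demand Q) ≤ I) :
    A.seedLaw {σ | ∀ r ∈ Q, ∃ s, A.run I n Q σ r = some s ∧ s < ⌊a * I + b n⌋₊}ᶜ ≤
      ENNReal.ofReal (1 / (2 * n ^ 4)) := by
  have := A.isProbabilityMeasure
  have h1 := h I n hn Q hQ hI
  have h2 : A.seedLaw.real {σ | ∀ r ∈ Q, ∃ s : ℕ, A.run I n Q σ r = some s ∧
      (s : ℝ) + 1 ≤ a * I + b n} ≤
      A.seedLaw.real {σ | ∀ r ∈ Q, ∃ s, A.run I n Q σ r = some s ∧ s < ⌊a * I + b n⌋₊} := by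
    refine measureReal_mono (fun σ hσ r hr => ?_)
    obtain ⟨s, hs, hle⟩ := hσ r hr
    exact ⟨s, hs, Nat.le_floor (by exact_mod_cast hle)⟩
  have h3 := probReal_compl_eq_one_sub (μ := A.seedLaw)
    (A.measurableSet_served I n Q ⌊a * I + b n⌋₊)
  rw [← ofReal_measureReal]
  exact ENNReal.ofReal_le_ofReal (by linarith)

theorem Network.interference_mono (N : Network V E) {R R' : E → ℝ} (h0 : 0 ≤ R) (h : R ≤ R') :
    N.interference R ≤ N.interference R' := by
  unfold Network.interference
  have hle : ∀ e, (N.W *ᵥ R) e ≤ (N.W *ᵥ R') e := fun e =>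
    Finset.sum_le_sum (fun e' _ => mul_le_mul_of_nonneg_left (h e') (N.W_nonneg e e'))
  have hnn : ∀ e, 0 ≤ (N.W *ᵥ R) e := fun e =>
    Finset.sum_nonneg (fun e' _ => mul_nonneg (N.W_nonneg e e') (h0 e'))
  refine (pi_norm_le_iff_of_nonneg (norm_nonneg _)).2 (fun e => ?_)
  rw [Real.norm_of_nonneg (hnn e)]
  exact (hle e).trans ((le_abs_self _).trans (norm_le_pi_norm (N.W *ᵥ R') e))

theorem demand_nonneg {κ : Type*} (Q : Finset (κ × E)) : 0 ≤ demand Q := fun e => by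
  unfold demand
  exact Nat.cast_nonneg _

theorem demand_mono {κ : Type*} {Q Q' : Finset (κ × E)} (h : Q ⊆ Q') : demand Q ≤ demand Q' := by
  classical
  intro e
  unfold demand
  exact Nat.cast_le.2 (Finset.card_le_card (Finset.filter_subset_filter _ h))

theorem mulVec_demand_nonneg {κ : Type*} (N : Network V E) (Q : Finset (κ × E)) (e : E) :
    0 ≤ (N.W *ᵥ demand Q) e :=
  Finset.sum_nonneg (fun e' _ => mul_nonneg (N.W_nonneg e e') (demand_nonneg Q e'))

/-- The number of requests is at most `m` times their interference measure, since `W` has a unit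
diagonal. -/
theorem card_le_interference {κ : Type*} (N : Network V E) (Q : Finset (κ × E)) :
    (Q.card : ℝ) ≤ N.m * N.interference (demand Q) := by
  classical
  have h1 : (Q.card : ℝ) = ∑ e, demand Q e := by
    rw [Finset.card_eq_sum_card_fiberwise (f := Prod.snd) (t := Finset.univ) (by simp)]
    push_cast
    refine Finset.sum_congr rfl (fun e _ => ?_)
    unfold demand
    congr!
  have h2 : ∀ e, demand Q e ≤ N.interference (demand Q) := by
    intro e
    have h3 : demand Q e ≤ (N.W *ᵥ demand Q) e := by
      have := Finset.single_le_sum (f := fun e' => N.W e e' * demand Q e')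
        (fun e' _ => mul_nonneg (N.W_nonneg e e') (demand_nonneg Q e')) (Finset.mem_univ e)
      rw [N.W_diag, one_mul] at this
      exact this
    exact h3.trans ((le_abs_self _).trans (norm_le_pi_norm (N.W *ᵥ demand Q) e))
  rw [h1]
  refine (Finset.sum_le_card_nsmul _ _ _ (fun e _ => h2 e)).trans ?_
  rw [nsmul_eq_mul, Finset.card_univ]
  refine mul_le_mul_of_nonneg_right ?_ (norm_nonneg _)
  exact_mod_cast le_max_left _ _

theorem interference_singleton_le {κ : Type*} (N : Network V E) (r : κ × E) :
    N.interference (demand {r}) ≤ 1 := by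
  classical
  refine (pi_norm_le_iff_of_nonneg zero_le_one).2 (fun e => ?_)
  rw [Real.norm_of_nonneg (mulVec_demand_nonneg N _ e)]
  have : ∀ e', demand {r} e' = if e' = r.2 then 1 else 0 := by
    intro e'
    unfold demand
    by_cases h : e' = r.2
    · subst h; simp [Finset.filter_singleton]
    · simp [Finset.filter_singleton, h, Ne.symm h]
  simp only [Matrix.mulVec, dotProduct, this]
  simpa using N.W_le_one e r.2

namespace Protocol

variable {P : Protocol N G S}

theorem Calibrated.one_le_mJ (hP : P.Calibrated) : 1 ≤ N.m * P.J := by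
  have h1 : (1 : ℝ) ≤ N.m := by exact_mod_cast hP.one_le_m
  nlinarith [hP.J_ge]

theorem Calibrated.J_pos (hP : P.Calibrated) : 0 < P.J := by linarith [hP.J_ge]

theorem failProb_nonneg (P : Protocol N G S) : 0 ≤ P.failProb := by
  unfold failProb
  positivity

variable {Ω : Type*} [mΩ : MeasurableSpace Ω] {ν : Measure Ω} {x : Ω → Sample N G S}

theorem _root_.PacketScheduling.IsRun.srcAlg_le (hx : IsRun P ν x) (U : Set (Source G E)) :
    srcAlg x U ≤ mΩ := iSup₂_le (fun i _ => hx.le i)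

theorem _root_.PacketScheduling.IsRun.indep_srcAlg (hx : IsRun P ν x)
    {U U' : Set (Source G E)} (h : Disjoint U U') : Indep (srcAlg x U) (srcAlg x U') ν :=
  indep_iSup_of_disjoint hx.le hx.indep h

/-! ### The first phase -/

/-- The request sets for which the guarantee applies in the first phase. -/
def Admissible (P : Protocol N G S) (Q : Finset (Packet G × E)) : Prop :=
  (Q.card : ℝ) ≤ N.m * P.J ∧ N.interference (demand Q) ≤ P.J

/-- The interference measure of the planned requests of frame `k` exceeds `J`. -/
def Overload (P : Protocol N G S) (x : Sample N G S) (k : ℕ) : Prop :=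
  P.J < N.interference (demand (P.planned x k))

/-- The static algorithm violates its guarantee in the first phase of frame `k`, when executed on
the set `Q` of requests. -/
def AlgFails (P : Protocol N G S) (x : Sample N G S) (k : ℕ) (Q : Finset (Packet G × E)) : Prop :=
  P.Admissible Q ∧ ¬ P.FirstServed x k Q

theorem admissible_firstRequests (hT0 : 0 < P.T) {x : Sample N G S} {k : ℕ}
    (h : ¬ P.Overload x k) : P.Admissible (P.firstRequests x k (P.state x k)) := by
  have hI : N.interference (demand (P.firstRequests x k (P.state x k))) ≤ P.J :=
    (N.interference_mono (demand_nonneg _)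
      (demand_mono (P.firstRequests_subset_planned hT0 x k))).trans (not_lt.1 h)
  exact ⟨(card_le_interference N _).trans (by gcongr), hI⟩

theorem measurableSet_firstServed (k : ℕ) (Q : Finset (Packet G × E)) :
    MeasurableSet[srcAlg x {Source.first k}] {ω | P.FirstServed (x ω) k Q} :=
  measurable_seed₁ (U := {Source.first k}) rfl
    (P.alg.measurableSet_served P.J (N.m * P.J) Q P.firstLength)

theorem not_firstServed_le (hP : P.Calibrated) (hx : IsRun P ν x) (k : ℕ)
    {Q : Finset (Packet G × E)} (hQ : P.Admissible Q) :
    ν {ω | ¬ P.FirstServed (x ω) k Q} ≤ ENNReal.ofReal P.failProb := by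
  have hm : Measurable (fun ω => (x ω).seed₁ k) :=
    (measurable_seed₁ (U := {Source.first k}) rfl).mono (hx.srcAlg_le _) le_rfl
  have h := hP.guarantee.not_served_le hP.one_le_mJ hQ.1 hQ.2
  rw [← hx.seed₁_law k, Measure.map_apply hm
    (P.alg.measurableSet_served _ _ Q _).compl] at h
  exact h

theorem dmeas_algFails (k : ℕ) (Q : Finset (Packet G × E)) :
    DMeas (srcAlg x {Source.first k}) (fun ω => P.AlgFails (x ω) k Q) :=
  (DMeas.of_prop (measurableSet_firstServed k Q)).comp (fun p => P.Admissible Q ∧ ¬ p)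

open Classical in
/-- The weight `K` if the static algorithm fails on an admissible request set, and `1` otherwise. -/
noncomputable def failWeight (P : Protocol N G S) (k : ℕ) (K : ℝ≥0∞) (Q : Finset (Packet G × E))
    (x : Sample N G S) : ℝ≥0∞ :=
  if P.AlgFails x k Q then K else 1

theorem measurable_failWeight (k : ℕ) (K : ℝ≥0∞) (Q : Finset (Packet G × E)) :
    Measurable[srcAlg x {Source.first k}] (fun ω => P.failWeight k K Q (x ω)) := by
  classical
  unfold failWeight
  exact (dmeas_algFails k Q).measurable (fun p => if p then K else 1)

/-- On a fixed request set the algorithm violates its guarantee with probability at most `failProb`;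
if the set is not admissible, then there is no guarantee to violate. -/
theorem lintegral_failWeight_le [IsProbabilityMeasure ν] (hP : P.Calibrated) (hx : IsRun P ν x)
    (k : ℕ) (K : ℝ≥0∞) (Q : Finset (Packet G × E)) :
    ∫⁻ ω, P.failWeight k K Q (x ω) ∂ν ≤ 1 + K * ENNReal.ofReal P.failProb := by
  classical
  by_cases hQ : P.Admissible Q
  · have hm : MeasurableSet {ω | ¬ P.FirstServed (x ω) k Q} :=
      (hx.srcAlg_le _ _ (measurableSet_firstServed k Q)).compl
    calc ∫⁻ ω, P.failWeight k K Q (x ω) ∂ν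
        ≤ ∫⁻ ω, 1 + {ω | ¬ P.FirstServed (x ω) k Q}.indicator (fun _ => K) ω ∂ν := by
          refine lintegral_mono (fun ω => ?_)
          unfold failWeight
          by_cases h : P.FirstServed (x ω) k Q <;> simp [AlgFails, h, hQ]
      _ = 1 + K * ν {ω | ¬ P.FirstServed (x ω) k Q} := by
          rw [lintegral_add_left measurable_const, lintegral_indicator_const hm]
          simp
      _ ≤ _ := by
          gcongr
          exact not_firstServed_le hP hx k hQ
  · unfold failWeight
    simp [AlgFails, hQ]

/-- The increase of the potential in frame `k` due to an overload of planned requests. -/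
noncomputable def burst (P : Protocol N G S) (x : Sample N G S) (k : ℕ) : ℕ :=
  open Classical in if P.Overload x k then N.m * (P.planned x k).card else 0

/-- The growth of the potential in the first phase is at most the burst in an overload, and at most
`m ^ 2 J` if the algorithm fails on an admissible request set. The burst is a function of the
injections alone, and the other event has small probability given the past. -/
theorem exp_midPotential_le (hP : P.Calibrated) {θ : ℝ} (hθ : 0 ≤ θ) (x : Sample N G S)
    (A : Set ℕ) (k : ℕ) :
    ENNReal.ofReal (Real.exp (θ * P.midPotential x A k)) ≤
      ENNReal.ofReal (Real.exp (θ * P.burst x k)) *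
        ENNReal.ofReal (Real.exp (θ * P.potential x A k)) *
        P.failWeight k (ENNReal.ofReal (Real.exp (θ * (N.m ^ 2 * P.J))))
          (P.firstRequests x k (P.state x k)) x := by
  classical
  set Q := P.firstRequests x k (P.state x k)
  have hmid := P.midPotential_le x A k
  rw [← ENNReal.ofReal_mul (Real.exp_nonneg _), ← Real.exp_add]
  have hK : (1 : ℝ≥0∞) ≤ ENNReal.ofReal (Real.exp (θ * (N.m ^ 2 * P.J))) := by
    rw [← ENNReal.ofReal_one]
    refine ENNReal.ofReal_le_ofReal (Real.one_le_exp ?_)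
    have := hP.J_pos
    positivity
  have hw : 1 ≤ P.failWeight k (ENNReal.ofReal (Real.exp (θ * (N.m ^ 2 * P.J)))) Q x := by
    unfold failWeight
    split_ifs
    · exact hK
    · exact le_rfl
  have hDm : N.D ≤ N.m := le_max_right _ _
  by_cases hs : P.FirstServed x k Q
  · have h1 : P.midPotential x A k ≤ P.potential x A k := by simpa [hs, Q] using hmid
    refine le_mul_of_le_of_one_le (ENNReal.ofReal_le_ofReal (Real.exp_le_exp.2 ?_)) hw
    rw [← mul_add]
    refine mul_le_mul_of_nonneg_left ?_ hθ
    have : (0 : ℝ) ≤ P.burst x k := Nat.cast_nonneg _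
    have : (P.midPotential x A k : ℝ) ≤ P.potential x A k := by exact_mod_cast h1
    linarith
  · have h1 : P.midPotential x A k ≤ P.potential x A k + N.D * Q.card := by
      rwa [if_neg hs] at hmid
    have h1' : (P.midPotential x A k : ℝ) ≤ P.potential x A k + N.D * Q.card := by
      exact_mod_cast h1
    by_cases ho : P.Overload x k
    · refine le_mul_of_le_of_one_le (ENNReal.ofReal_le_ofReal (Real.exp_le_exp.2 ?_)) hw
      rw [← mul_add]
      refine mul_le_mul_of_nonneg_left ?_ hθ
      have hb : N.D * Q.card ≤ P.burst x k := by
        rw [burst, if_pos ho]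
        exact Nat.mul_le_mul hDm
          (Finset.card_le_card (P.firstRequests_subset_planned hP.T_pos x k))
      have hb' : (N.D * Q.card : ℝ) ≤ P.burst x k := by exact_mod_cast hb
      linarith
    · have hadm : P.Admissible Q := admissible_firstRequests hP.T_pos ho
      have hw' : P.failWeight k (ENNReal.ofReal (Real.exp (θ * (N.m ^ 2 * P.J)))) Q x =
          ENNReal.ofReal (Real.exp (θ * (N.m ^ 2 * P.J))) := if_pos ⟨hadm, hs⟩
      rw [hw', ← ENNReal.ofReal_mul (Real.exp_nonneg _), ← Real.exp_add, ← mul_add, ← mul_add]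
      refine ENNReal.ofReal_le_ofReal (Real.exp_le_exp.2 (mul_le_mul_of_nonneg_left ?_ hθ))
      have : (0 : ℝ) ≤ P.burst x k := Nat.cast_nonneg _
      have h2 : (N.D * Q.card : ℝ) ≤ N.m * (N.m * P.J) := by
        refine mul_le_mul (by exact_mod_cast hDm) hadm.1 (Nat.cast_nonneg _) (Nat.cast_nonneg _)
      nlinarith

theorem _root_.PacketScheduling.Source.past_disjoint_first (k : ℕ) :
    Disjoint (Source.past k : Set (Source G E)) {Source.first k} := by
  rw [Set.disjoint_singleton_right]
  exact fun h => lt_irrefl k h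

/-- The growth of the exponential of the potential in the first phase, in expectation. The weight
`ψ` and the burst may depend on all injections. -/
theorem lintegral_exp_midPotential_le [IsProbabilityMeasure ν] (hP : P.Calibrated)
    (hx : IsRun P ν x) {θ : ℝ} (hθ : 0 ≤ θ) (A : Set ℕ) (k : ℕ) {ψ : Ω → ℝ≥0∞}
    (hψ : Measurable[srcAlg x (Source.past k)] ψ)
    (hb : Measurable[srcAlg x (Source.past k)] (fun ω => P.burst (x ω) k)) :
    ∫⁻ ω, ψ ω * ENNReal.ofReal (Real.exp (θ * P.midPotential (x ω) A k)) ∂ν ≤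
      (1 + ENNReal.ofReal (Real.exp (θ * (N.m ^ 2 * P.J))) * ENNReal.ofReal P.failProb) *
      ∫⁻ ω, ψ ω * (ENNReal.ofReal (Real.exp (θ * P.burst (x ω) k)) *
        ENNReal.ofReal (Real.exp (θ * P.potential (x ω) A k))) ∂ν := by
  have hQ : DMeas (srcAlg x (Source.past k))
      (fun ω => P.firstRequests (x ω) k (P.state (x ω) k)) :=
    P.dmeas_firstRequests (fun _ _ => dmeas_inj (Source.inject_mem_past _ _ _))
      (P.dmeas_state k) k
  have hψ' : Measurable[srcAlg x (Source.past k)] (fun ω => ψ ω *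
      (ENNReal.ofReal (Real.exp (θ * P.burst (x ω) k)) *
        ENNReal.ofReal (Real.exp (θ * P.potential (x ω) A k)))) := by
    exact hψ.mul (((measurable_of_countable
        (fun n : ℕ => ENNReal.ofReal (Real.exp (θ * n)))).comp hb).mul
      ((P.dmeas_potential A k).measurable (fun n => ENNReal.ofReal (Real.exp (θ * n)))))
  have h := lintegral_mul_freeze_le (μ := ν) (hx.srcAlg_le _) (hx.srcAlg_le _)
    (hx.indep_srcAlg (Source.past_disjoint_first k)) hψ' hQ
    (φ := fun Q ω => P.failWeight k (ENNReal.ofReal (Real.exp (θ * (N.m ^ 2 * P.J)))) Q (x ω))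
    (fun Q => measurable_failWeight k _ Q)
    (fun Q => lintegral_failWeight_le hP hx k _ Q)
  refine le_trans (lintegral_mono (fun ω => ?_)) h
  rw [mul_assoc]
  refine mul_le_mul_right ?_ _
  exact exp_midPotential_le hP hθ (x ω) A k

/-- A packet that fails in frame `k` witnesses an overload or a failure of the static algorithm. -/
theorem measure_fail_le [IsProbabilityMeasure ν] (hP : P.Calibrated) (hx : IsRun P ν x)
    (k : ℕ) (p : Packet G) :
    ν {ω | (P.state (x ω) (k + 1) p).failedAt = some k} ≤
      ENNReal.ofReal P.failProb + ν {ω | P.Overload (x ω) k} := by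
  classical
  have hQ : DMeas (srcAlg x (Source.past k))
      (fun ω => P.firstRequests (x ω) k (P.state (x ω) k)) :=
    P.dmeas_firstRequests (fun _ _ => dmeas_inj (Source.inject_mem_past _ _ _))
      (P.dmeas_state k) k
  have hsub : {ω | (P.state (x ω) (k + 1) p).failedAt = some k} ⊆
      {ω | P.AlgFails (x ω) k (P.firstRequests (x ω) k (P.state (x ω) k))} ∪
      {ω | P.Overload (x ω) k} := by
    intro ω hω
    by_cases ho : P.Overload (x ω) k
    · exact Or.inr ho
    · refine Or.inl ⟨admissible_firstRequests hP.T_pos ho, fun hs => ?_⟩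
      have hω' : (P.firstPhase (x ω) k (P.state (x ω) k) p).failedAt = some k := by
        rw [← cleanPhase_failedAt P (x ω) k]
        exact hω
      have hne : (P.state (x ω) k p).failedAt ≠ some k := fun hc =>
        lt_irrefl k ((P.punctual_state hP.T_pos (x ω) k p).1 k hc).1
      unfold firstPhase at hω'
      rcases (x ω).afterRun_cases (P.state (x ω) k) (P.firstRequests (x ω) k (P.state (x ω) k))
          (P.alg.run P.J (N.m * P.J) (P.firstRequests (x ω) k (P.state (x ω) k))
            ((x ω).seed₁ k)) (k * P.T) P.firstLength
          (fun s => ⟨s.pos, some k, s.deliveredAt⟩) p with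
        ⟨h', -⟩ | ⟨e, s, -, -, -, -, h'⟩ | ⟨e, -, hm, hf, -⟩
      · rw [h'] at hω'; exact hne hω'
      · rw [h'] at hω'; exact hne hω'
      · obtain ⟨s, h1, h2⟩ := hs _ hm
        exact absurd (hf s h1) (not_le.2 h2)
  refine (measure_mono hsub).trans ((measure_union_le _ _).trans (add_le_add_left ?_ _))
  have hd := fun Q => dmeas_algFails (P := P) (x := x) k Q
  have h := lintegral_mul_freeze_le (μ := ν) (hx.srcAlg_le _) (hx.srcAlg_le _)
    (hx.indep_srcAlg (Source.past_disjoint_first k)) (ψ := fun _ => 1) measurable_const hQ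
    (φ := fun Q ω => if P.AlgFails (x ω) k Q then 1 else 0)
    (c := ENNReal.ofReal P.failProb)
    (fun Q => (hd Q).measurable (fun p => if p then (1 : ℝ≥0∞) else 0))
    (fun Q => ?_)
  · simp only [one_mul, lintegral_one, measure_univ, mul_one] at h
    refine le_trans (le_of_eq ?_) h
    have hm := ((hQ.mono (hx.srcAlg_le _)).bind
      (h := fun Q ω => P.AlgFails (x ω) k Q)
      (fun Q => (hd Q).mono (hx.srcAlg_le _))).prop
    rw [← lintegral_indicator_one hm]
    rfl
  · have hm := ((hd Q).mono (hx.srcAlg_le _)).prop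
    calc ∫⁻ ω, (if P.AlgFails (x ω) k Q then 1 else 0) ∂ν
        = ν {ω | P.AlgFails (x ω) k Q} := by
          rw [← lintegral_indicator_one hm]
          rfl
      _ ≤ _ := by
          by_cases hQ : P.Admissible Q
          · simpa only [AlgFails, hQ, true_and] using not_firstServed_le hP hx k hQ
          · simp [AlgFails, hQ]

end Protocol

end Drift

/-! ### The clean-up phase -/

/-- The probability that a given one of at most `m` independent experiments with success
probability `1 / m` is the only successful one is at least `1 / (3 m)`. -/
theorem one_div_three_mul_le {m c : ℕ} (hm : 1 ≤ m) (hc : c + 1 ≤ m) :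
    1 / (3 * (m : ℝ)) ≤ 1 / m * (1 - 1 / m) ^ c := by
  obtain ⟨n, rfl⟩ : ∃ n, m = n + 1 := ⟨m - 1, by omega⟩
  have hn1 : (0 : ℝ) < n + 1 := by positivity
  have h3 : 1 - 1 / ((n : ℝ) + 1) = n / (n + 1) := by field_simp; ring
  have h0 : 0 ≤ (n : ℝ) / (n + 1) := by positivity
  have h1 : (n : ℝ) / (n + 1) ≤ 1 := by rw [div_le_one hn1]; linarith
  have key : 1 / 3 ≤ ((n : ℝ) / (n + 1)) ^ n := by
    rcases Nat.eq_zero_or_pos n with rfl | hn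
    · norm_num
    · have hn' : (0 : ℝ) < n := by exact_mod_cast hn
      have h4 : (1 / (n : ℝ) + 1) ^ n ≤ 3 := by
        calc (1 / (n : ℝ) + 1) ^ n ≤ (Real.exp (1 / n)) ^ n :=
              pow_le_pow_left₀ (by positivity) (Real.add_one_le_exp _) n
          _ = Real.exp 1 := by
              rw [← Real.exp_nat_mul]
              congr 1
              field_simp
          _ ≤ 3 := by linarith [Real.exp_one_lt_d9]
      have h5 : (n : ℝ) / (n + 1) = (1 / (n : ℝ) + 1)⁻¹ := by field_simp; ring
      rw [h5, inv_pow, one_div]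
      exact inv_anti₀ (by positivity) h4
  push_cast
  rw [h3]
  calc 1 / (3 * ((n : ℝ) + 1)) = 1 / (n + 1) * (1 / 3) := by field_simp
    _ ≤ 1 / (n + 1) * ((n : ℝ) / (n + 1)) ^ n := by gcongr
    _ ≤ 1 / (n + 1) * ((n : ℝ) / (n + 1)) ^ c := by
        gcongr 1 / ((n : ℝ) + 1) * ?_
        exact pow_le_pow_of_le_one h0 h1 (by omega)

section Clean

set_option linter.unusedSectionVars false

variable {V E : Type*} [Fintype E] {N : Network V E} {G S : Type*} [Fintype G]
  [MeasurableSpace S]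

/-- The sources used in the clean-up phase of frame `k`. -/
def Source.clean (k : ℕ) : Set (Source G E)
  | .coin j _ => j = k
  | .second j => j = k
  | _ => False

theorem Source.mid_disjoint_clean (k : ℕ) :
    Disjoint (Source.mid k : Set (Source G E)) (Source.clean k) := by
  rw [Set.disjoint_left]
  rintro (_ | _ | _ | _) h1 h2
  · exact h2
  · exact (Nat.ne_of_lt h1) h2
  · exact h2
  · exact (Nat.ne_of_lt h1) h2

namespace Protocol

variable {P : Protocol N G S} {Ω : Type*} [mΩ : MeasurableSpace Ω] {ν : Measure Ω}
  {x : Ω → Sample N G S}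

/-- The lower bound `1 / (6 m)` for the probability that the clean-up phase reduces a positive
potential. -/
noncomputable def cleanProb (_ : Protocol N G S) : ℝ := 1 / (6 * N.m)

/-- A clean-up phase in which the only successful experiment is that of link `e`, and in which the
request `(sel e, e)` is served. -/
def OnlySuccess (P : Protocol N G S) (x : Sample N G S) (k : ℕ) (sel : E → Packet G) (e : E) :
    Prop :=
  (∀ e', x.coin k e' = true ↔ e' = e) ∧
    ∀ r ∈ ({(sel e, e)} : Finset (Packet G × E)),
      ∃ s, P.alg.run 1 (N.m * P.J) {(sel e, e)} (x.seed₂ k) r = some s ∧ s < P.cleanLength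

/-- The clean-up phase is successful for one particular link out of a nonempty set `H`. -/
def CleanSuccess (P : Protocol N G S) (x : Sample N G S) (k : ℕ)
    (z : Finset E × (E → Packet G)) : Prop :=
  ∃ h : z.1.Nonempty, P.OnlySuccess x k z.2 h.choose

/-- The sources of the experiments and of the seed of one clean-up phase. -/
def cleanSource (G : Type*) {E : Type*} (k : ℕ) : Option E → Source G E
  | some e => .coin k e
  | none => .second k

/-- The requests of a clean-up phase with a single request are served with probability at
least `1 / 2`. -/
theorem half_le_measure_served [IsProbabilityMeasure ν] (hP : P.Calibrated) (hx : IsRun P ν x)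
    (k : ℕ) (r₀ : Packet G × E) :
    1 / 2 ≤ ν.real {ω | ∀ r ∈ ({r₀} : Finset (Packet G × E)),
      ∃ s, P.alg.run 1 (N.m * P.J) {r₀} ((x ω).seed₂ k) r = some s ∧ s < P.cleanLength} := by
  have hgm := P.alg.measurableSet_served 1 (N.m * P.J) {r₀} P.cleanLength
  have hsm : Measurable (fun ω => (x ω).seed₂ k) :=
    (measurable_seed₂ (U := {Source.second k}) rfl).mono (hx.srcAlg_le _) le_rfl
  have h := hP.guarantee.not_served_le hP.one_le_mJ (Q := {r₀})
    (by simpa using hP.one_le_mJ) (interference_singleton_le N _)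
  have hs := P.alg.isProbabilityMeasure
  have h1 := ENNReal.toReal_le_of_le_ofReal (by positivity) h
  rw [← measureReal_def, show ⌊P.f N.m * 1 + P.g N.m (N.m * P.J)⌋₊ = P.cleanLength from rfl,
    probReal_compl_eq_one_sub hgm] at h1
  have h2 : 1 / (2 * (N.m * P.J) ^ 4) ≤ 1 / 2 := by
    refine one_div_le_one_div_of_le (by norm_num) ?_
    have := one_le_pow₀ hP.one_le_mJ (n := 4)
    linarith
  have h3 := map_measureReal_apply (μ := ν) hsm hgm
  rw [hx.seed₂_law k] at h3
  refine le_trans ?_ (le_of_eq h3)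
  change _ ≤ P.alg.seedLaw.real {σ | ∀ r ∈ ({r₀} : Finset (Packet G × E)),
      ∃ s, P.alg.run 1 (N.m * P.J) {r₀} σ r = some s ∧ s < P.cleanLength}
  refine le_trans ?_ (sub_le_comm.1 h1)
  linarith

/-- The probability `1 / (6 m)` comes from `1 / (3 m)` for the experiments and `1 / 2` for the
execution of the static algorithm on a single request. -/
theorem le_measure_onlySuccess [IsProbabilityMeasure ν] (hP : P.Calibrated) (hx : IsRun P ν x)
    (k : ℕ) (sel : E → Packet G) (e : E) :
    ENNReal.ofReal P.cleanProb ≤ ν {ω | P.OnlySuccess (x ω) k sel e} := by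
  classical
  have hBs := half_le_measure_served hP hx k (sel e, e)
  have hgm := P.alg.measurableSet_served 1 (N.m * P.J) {(sel e, e)} P.cleanLength
  set good : Set Ω := {ω | ∀ r ∈ ({(sel e, e)} : Finset (Packet G × E)),
      ∃ s, P.alg.run 1 (N.m * P.J) {(sel e, e)} ((x ω).seed₂ k) r = some s ∧
        s < P.cleanLength} with hgood
  have hinj : Function.Injective (cleanSource G k : Option E → Source G E) := by
    intro a b h
    cases a <;> cases b <;> simp_all [cleanSource]
  have hind := (iIndep_iff _ _).1 (hx.indep.precomp hinj) Finset.univ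
    (f := fun o => o.elim good (fun e' => {ω | (x ω).coin k e' = decide (e' = e)})) (by
    intro o _
    cases o with
    | some e' => exact ⟨{decide (e' = e)}, MeasurableSet.of_discrete, rfl⟩
    | none => exact ⟨_, hgm, rfl⟩)
  -- an intersection of independent events, one for each experiment and one for the seed
  have hset : {ω | P.OnlySuccess (x ω) k sel e} = ⋂ o ∈ (Finset.univ : Finset (Option E)),
      o.elim good (fun e' => {ω | (x ω).coin k e' = decide (e' = e)}) := by
    ext ω
    simp only [Finset.mem_univ, Set.iInter_true, Set.mem_iInter, Option.forall, Option.elim]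
    change _ ∧ _ ↔ _
    rw [and_comm]
    refine and_congr Iff.rfl (forall_congr' (fun e' => ?_))
    by_cases h : e' = e <;> simp [h]
  clear_value good
  have hcoinm : ∀ e', MeasurableSet {ω | (x ω).coin k e' = true} := fun e' =>
    hx.srcAlg_le _ _ ((dmeas_coin (x := x) (U := {Source.coin k e'})
      (Set.mem_singleton _)).setOf (fun b => b = true))
  have hm1 : (1 : ℝ) ≤ N.m := by exact_mod_cast hP.one_le_m
  have hB1 : ν.real {ω | (x ω).coin k e = decide (e = e)} = 1 / N.m := by
    rw [← hx.coin_law k e]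
    simp
  have hB0 : ∀ e', e' ≠ e → ν.real {ω | (x ω).coin k e' = decide (e' = e)} = 1 - 1 / N.m := by
    intro e' he'
    rw [← hx.coin_law k e', ← probReal_compl_eq_one_sub (hcoinm e')]
    congr 1
    ext ω
    simp [he']
  have hcard : 0 < Fintype.card E := Fintype.card_pos_iff.2 ⟨e⟩
  have hprod : ν.real {ω | P.OnlySuccess (x ω) k sel e} =
      ν.real good * (1 / N.m * (1 - 1 / N.m) ^ (Fintype.card E - 1)) := by
    rw [hset, measureReal_def, hind, ENNReal.toReal_prod, Fintype.prod_option]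
    simp only [Option.elim, ← measureReal_def]
    congr 1
    rw [← Finset.mul_prod_erase Finset.univ _ (Finset.mem_univ e), hB1]
    congr 1
    refine (Finset.prod_congr rfl (fun e' he' => hB0 e' (Finset.ne_of_mem_erase he'))).trans ?_
    rw [Finset.prod_const, Finset.card_erase_of_mem (Finset.mem_univ e), Finset.card_univ]
  rw [← ofReal_measureReal, hprod]
  refine ENNReal.ofReal_le_ofReal ?_
  have h6 := one_div_three_mul_le hP.one_le_m (c := Fintype.card E - 1) (by
    have : Fintype.card E ≤ N.m := le_max_left _ _
    omega)
  have h7 : P.cleanProb = 1 / 2 * (1 / (3 * (N.m : ℝ))) := by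
    unfold cleanProb
    field_simp
    norm_num
  rw [h7]
  exact mul_le_mul hBs h6 (by positivity) measureReal_nonneg

theorem dmeas_cleanSuccess (k : ℕ) (z : Finset E × (E → Packet G)) :
    DMeas (srcAlg x (Source.clean k)) (fun ω => P.CleanSuccess (x ω) k z) := by
  unfold CleanSuccess
  by_cases h : z.1.Nonempty
  · simp only [h, exists_true_left]
    refine DMeas.of_prop ?_
    have h1 : ∀ e', MeasurableSet[srcAlg x (Source.clean k)]
        {ω | (x ω).coin k e' = true ↔ e' = h.choose} := fun e' =>
      (dmeas_coin (x := x) (U := Source.clean k) rfl).setOf (fun b => b = true ↔ e' = h.choose)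
    have h2 := measurable_seed₂ (x := x) (U := Source.clean k) (k := k) rfl
      (P.alg.measurableSet_served 1 (N.m * P.J) {(z.2 h.choose, h.choose)} P.cleanLength)
    have h3 := (MeasurableSet.iInter h1).inter h2
    convert h3 using 1
    ext ω
    simp [OnlySuccess]
  · simp only [h, IsEmpty.exists_iff]
    exact DMeas.const _

theorem le_measure_cleanSuccess [IsProbabilityMeasure ν] (hP : P.Calibrated) (hx : IsRun P ν x)
    (k : ℕ) {z : Finset E × (E → Packet G)} (hz : z.1.Nonempty) :
    ENNReal.ofReal P.cleanProb ≤ ν {ω | P.CleanSuccess (x ω) k z} := by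
  simp only [CleanSuccess, hz, exists_true_left]
  exact le_measure_onlySuccess hP hx k z.2 _

/-- The links with packets that failed in a frame in `A`, and the packets selected from all
buffers, at the beginning of the clean-up phase of frame `k`. -/
noncomputable def cleanChoice (P : Protocol N G S) (x : Sample N G S) (A : Set ℕ) (k : ℕ) :
    Finset E × (E → Packet G) :=
  (P.hot x A k (P.firstPhase x k (P.state x k)),
    fun e => P.tie k e (P.oldest x k (P.firstPhase x k (P.state x k)) e))

theorem dmeas_cleanChoice (A : Set ℕ) (k : ℕ) :
    DMeas (srcAlg x (Source.mid k)) (fun ω => P.cleanChoice (x ω) A k) :=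
  (P.dmeas_hot (fun _ _ => dmeas_inj (Source.inject_mem_mid _ _ _))
    (P.dmeas_firstPhase_state k) k A).prodMk
  (P.dmeas_selected (fun _ _ => dmeas_inj (Source.inject_mem_mid _ _ _))
    (P.dmeas_firstPhase_state k) k)

theorem potential_succ_lt_of_cleanSuccess (hT0 : 0 < P.T) {x : Sample N G S} {A : Set ℕ}
    (hA : IsLowerSet A) {k : ℕ} (h : P.CleanSuccess x k (P.cleanChoice x A k)) :
    P.potential x A (k + 1) + 1 ≤ P.midPotential x A k := by
  obtain ⟨hne, hcoin, hserved⟩ := h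
  rw [P.potential_succ hT0]
  refine P.pot_cleanPhase_lt x hA k _ hne.choose_spec ((hcoin _).2 rfl) (fun e' he' => ?_)
    (hserved _ (Finset.mem_singleton_self _))
  rw [← Bool.not_eq_true, hcoin]
  exact he'

theorem cleanChoice_nonempty {x : Sample N G S} {A : Set ℕ} {k : ℕ}
    (h : 0 < P.midPotential x A k) : (P.cleanChoice x A k).1.Nonempty :=
  P.hot_nonempty x A k _ h

/-- The expected decrease of the potential in the clean-up phase. -/
theorem lintegral_potential_succ_add_le [IsProbabilityMeasure ν] (hP : P.Calibrated)
    (hx : IsRun P ν x) {A : Set ℕ} (hA : IsLowerSet A) (k : ℕ) {ψ : Ω → ℝ≥0∞}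
    (hψ : Measurable[srcAlg x (Source.mid k)] ψ) :
    ENNReal.ofReal P.cleanProb *
        ∫⁻ ω, ψ ω * {ω | 0 < P.midPotential (x ω) A k}.indicator 1 ω ∂ν +
      ∫⁻ ω, ψ ω * P.potential (x ω) A (k + 1) ∂ν ≤ ∫⁻ ω, ψ ω * P.midPotential (x ω) A k ∂ν := by
  classical
  have hmid := P.dmeas_midPotential (x := x) A k
  have hψ' : Measurable[srcAlg x (Source.mid k)]
      (fun ω => ψ ω * {ω | 0 < P.midPotential (x ω) A k}.indicator 1 ω) :=
    hψ.mul (Measurable.indicator (f := fun _ => (1 : ℝ≥0∞)) measurable_const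
      (hmid.setOf (fun n => 0 < n)))
  have hψ0 : Measurable (fun ω => ψ ω * {ω | 0 < P.midPotential (x ω) A k}.indicator 1 ω) :=
    hψ'.mono (hx.srcAlg_le _) le_rfl
  have hfr := lintegral_mul_freeze (μ := ν) (hx.srcAlg_le _) (hx.srcAlg_le _)
    (hx.indep_srcAlg (Source.mid_disjoint_clean k)) hψ' (P.dmeas_cleanChoice A k)
    (φ := fun z ω => if P.CleanSuccess (x ω) k z then 1 else 0)
    (fun z => (dmeas_cleanSuccess k z).measurable (fun p => if p then (1 : ℝ≥0∞) else 0))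
  have hint : ∀ z, ∫⁻ ω, (if P.CleanSuccess (x ω) k z then 1 else 0) ∂ν =
      ν {ω | P.CleanSuccess (x ω) k z} := fun z => by
    rw [← lintegral_indicator_one ((dmeas_cleanSuccess k z).mono (hx.srcAlg_le _)).prop]
    rfl
  have hle : ENNReal.ofReal P.cleanProb *
      ∫⁻ ω, ψ ω * {ω | 0 < P.midPotential (x ω) A k}.indicator 1 ω ∂ν ≤
      ∫⁻ ω, (ψ ω * {ω | 0 < P.midPotential (x ω) A k}.indicator 1 ω) *
        (if P.CleanSuccess (x ω) k (P.cleanChoice (x ω) A k) then 1 else 0) ∂ν := by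
    rw [hfr, mul_comm, ← lintegral_mul_const _ hψ0]
    refine lintegral_mono (fun ω => ?_)
    by_cases h : 0 < P.midPotential (x ω) A k
    · refine mul_le_mul_right ?_ _
      rw [hint]
      exact le_measure_cleanSuccess hP hx k (cleanChoice_nonempty h)
    · simp [h]
  refine (add_le_add_left hle _).trans ?_
  have hpot : Measurable (fun ω => ψ ω * (P.potential (x ω) A (k + 1) : ℝ≥0∞)) :=
    (hψ.mono (hx.srcAlg_le _) le_rfl).mul
      (((P.dmeas_potential A (k + 1)).mono (hx.srcAlg_le _)).measurable (fun n => (n : ℝ≥0∞)))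
  rw [← lintegral_add_right _ hpot]
  refine lintegral_mono (fun ω => ?_)
  dsimp only
  rw [mul_assoc, ← mul_add]
  refine mul_le_mul_right ?_ _
  by_cases hs : P.CleanSuccess (x ω) k (P.cleanChoice (x ω) A k)
  · have h1 := potential_succ_lt_of_cleanSuccess hP.T_pos hA hs
    have h2 : 0 < P.midPotential (x ω) A k := by omega
    have h3 : ω ∈ {ω | 0 < P.midPotential (x ω) A k} := h2
    rw [Set.indicator_of_mem h3, if_pos hs, add_comm]
    simp only [Pi.one_apply, mul_one]
    exact_mod_cast h1
  · simp only [hs, if_false, mul_zero, zero_add]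
    exact_mod_cast P.potential_succ_le hP.T_pos (x ω) A k

/-- The expected decrease of the exponential of the potential in the clean-up phase. -/
theorem lintegral_exp_potential_succ_le [IsProbabilityMeasure ν] (hP : P.Calibrated)
    (hx : IsRun P ν x) {A : Set ℕ} (hA : IsLowerSet A) (k : ℕ) {ψ : Ω → ℝ≥0∞}
    (hψ : Measurable[srcAlg x (Source.mid k)] ψ) {θ : ℝ} (hθ : 0 ≤ θ) :
    ∫⁻ ω, ψ ω * ENNReal.ofReal (Real.exp (θ * P.potential (x ω) A (k + 1))) ∂ν ≤
      ENNReal.ofReal (1 - P.cleanProb * (1 - Real.exp (-θ))) *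
        ∫⁻ ω, ψ ω * ENNReal.ofReal (Real.exp (θ * P.midPotential (x ω) A k)) ∂ν +
      ENNReal.ofReal (P.cleanProb * (1 - Real.exp (-θ))) * ∫⁻ ω, ψ ω ∂ν := by
  classical
  set δ := P.cleanProb * (1 - Real.exp (-θ)) with hδ
  have hexp1 : Real.exp (-θ) ≤ 1 := Real.exp_le_one_iff.2 (by linarith)
  have hc0 : 0 ≤ P.cleanProb := by unfold cleanProb; positivity
  have hm1 : (1 : ℝ) ≤ N.m := by exact_mod_cast hP.one_le_m
  have hc1 : P.cleanProb ≤ 1 := by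
    unfold cleanProb
    rw [div_le_one (by positivity)]
    linarith
  have hδ0 : 0 ≤ δ := mul_nonneg hc0 (by linarith)
  have hδ1 : δ ≤ 1 := mul_le_one₀ hc1 (by linarith) (by linarith [Real.exp_pos (-θ)])
  have hmid := P.dmeas_midPotential (x := x) A k
  -- the part of the weight on which the potential is positive
  have hψ' : Measurable[srcAlg x (Source.mid k)] (fun ω => ψ ω *
      (if 0 < P.midPotential (x ω) A k then
        ENNReal.ofReal (Real.exp (θ * P.midPotential (x ω) A k)) else 0)) :=
    hψ.mul (hmid.measurable
      (fun n => if 0 < n then ENNReal.ofReal (Real.exp (θ * n)) else 0))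
  have hψ0 := hψ'.mono (hx.srcAlg_le _) le_rfl
  have hψ1 : Measurable (fun ω => ψ ω * (if 0 < P.midPotential (x ω) A k then
      (0 : ℝ≥0∞) else 1)) :=
    (hψ.mul (hmid.measurable (fun n => if 0 < n then (0 : ℝ≥0∞) else 1))).mono
      (hx.srcAlg_le _) le_rfl
  have hfr := lintegral_mul_freeze_le (μ := ν) (hx.srcAlg_le _) (hx.srcAlg_le _)
    (hx.indep_srcAlg (Source.mid_disjoint_clean k)) hψ' (P.dmeas_cleanChoice A k)
    (φ := fun z ω => if z.1.Nonempty then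
      (if P.CleanSuccess (x ω) k z then ENNReal.ofReal (Real.exp (-θ)) else 1) else 0)
    (c := ENNReal.ofReal (1 - δ))
    (fun z => (dmeas_cleanSuccess k z).measurable (fun p => if z.1.Nonempty then
      (if p then ENNReal.ofReal (Real.exp (-θ)) else 1) else 0)) (fun z => by
      by_cases hz : z.1.Nonempty
      · simp only [hz, if_true]
        have hm : MeasurableSet {ω | P.CleanSuccess (x ω) k z} :=
          ((dmeas_cleanSuccess k z).mono (hx.srcAlg_le _)).prop
        have e : ∀ ω, (if P.CleanSuccess (x ω) k z then ENNReal.ofReal (Real.exp (-θ)) else 1) =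
            {ω | P.CleanSuccess (x ω) k z}.indicator
              (fun _ => ENNReal.ofReal (Real.exp (-θ))) ω +
            {ω | P.CleanSuccess (x ω) k z}ᶜ.indicator (fun _ => 1) ω := fun ω => by
          by_cases h : P.CleanSuccess (x ω) k z <;> simp [h]
        have hle := le_measure_cleanSuccess hP hx k hz
        rw [← ofReal_measureReal, ENNReal.ofReal_le_ofReal_iff measureReal_nonneg] at hle
        rw [lintegral_congr e, lintegral_add_left (measurable_const.indicator hm),
          lintegral_indicator_const hm, lintegral_indicator_const hm.compl, one_mul,
          ← ofReal_measureReal, ← ofReal_measureReal, probReal_compl_eq_one_sub hm,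
          ← ENNReal.ofReal_mul (Real.exp_nonneg _),
          ← ENNReal.ofReal_add (mul_nonneg (Real.exp_nonneg _) measureReal_nonneg)
            (sub_nonneg.2 measureReal_le_one)]
        refine ENNReal.ofReal_le_ofReal ?_
        rw [hδ]
        nlinarith
      · simp [hz])
  calc ∫⁻ ω, ψ ω * ENNReal.ofReal (Real.exp (θ * P.potential (x ω) A (k + 1))) ∂ν
      ≤ ∫⁻ ω, (ψ ω * (if 0 < P.midPotential (x ω) A k then
          ENNReal.ofReal (Real.exp (θ * P.midPotential (x ω) A k)) else 0)) *
          (if (P.cleanChoice (x ω) A k).1.Nonempty then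
            (if P.CleanSuccess (x ω) k (P.cleanChoice (x ω) A k) then
              ENNReal.ofReal (Real.exp (-θ)) else 1) else 0) +
          ψ ω * (if 0 < P.midPotential (x ω) A k then 0 else 1) ∂ν := by
        refine lintegral_mono (fun ω => ?_)
        dsimp only
        rw [mul_assoc, ← mul_add]
        refine mul_le_mul_right ?_ _
        have hle := P.potential_succ_le hP.T_pos (x ω) A k
        by_cases h0 : 0 < P.midPotential (x ω) A k
        · simp only [h0, if_true, cleanChoice_nonempty h0, add_zero]
          by_cases hs : P.CleanSuccess (x ω) k (P.cleanChoice (x ω) A k)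
          · have h1 := potential_succ_lt_of_cleanSuccess hP.T_pos hA hs
            rw [if_pos hs, ← ENNReal.ofReal_mul (Real.exp_nonneg _), ← Real.exp_add]
            refine ENNReal.ofReal_le_ofReal (Real.exp_le_exp.2 ?_)
            have h1' : (P.potential (x ω) A (k + 1) : ℝ) + 1 ≤ P.midPotential (x ω) A k := by
              exact_mod_cast h1
            nlinarith
          · rw [if_neg hs, mul_one]
            gcongr
        · have h1 : P.potential (x ω) A (k + 1) = 0 := by omega
          simp [h0, h1]
    _ ≤ ENNReal.ofReal (1 - δ) * ∫⁻ ω, ψ ω * (if 0 < P.midPotential (x ω) A k then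
          ENNReal.ofReal (Real.exp (θ * P.midPotential (x ω) A k)) else 0) ∂ν +
          ∫⁻ ω, ψ ω * (if 0 < P.midPotential (x ω) A k then 0 else 1) ∂ν := by
        rw [lintegral_add_right _ hψ1]
        gcongr
    _ = ∫⁻ ω, ENNReal.ofReal (1 - δ) * (ψ ω * (if 0 < P.midPotential (x ω) A k then
          ENNReal.ofReal (Real.exp (θ * P.midPotential (x ω) A k)) else 0)) +
          ψ ω * (if 0 < P.midPotential (x ω) A k then 0 else 1) ∂ν := by
        rw [lintegral_add_right _ hψ1, lintegral_const_mul _ hψ0]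
    _ ≤ ∫⁻ ω, ENNReal.ofReal (1 - δ) *
          (ψ ω * ENNReal.ofReal (Real.exp (θ * P.midPotential (x ω) A k))) +
          ENNReal.ofReal δ * ψ ω ∂ν := by
        refine lintegral_mono (fun ω => ?_)
        dsimp only
        by_cases h0 : 0 < P.midPotential (x ω) A k
        · simp [h0]
        · have h1 : P.midPotential (x ω) A k = 0 := by omega
          simp only [h1, lt_irrefl, if_false, mul_zero, zero_add, mul_one, Nat.cast_zero,
            Real.exp_zero, ENNReal.ofReal_one]
          rw [← add_mul, ← ENNReal.ofReal_add (by linarith) hδ0]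
          simp
    _ = _ := by
        have hψm := hψ.mono (hx.srcAlg_le _) le_rfl
        rw [lintegral_add_right _ (hψm.const_mul _), lintegral_const_mul _ hψm,
          lintegral_const_mul]
        exact hψm.mul ((hmid.mono (hx.srcAlg_le _)).measurable
          (fun n => ENNReal.ofReal (Real.exp (θ * n))))

end Protocol

end Clean

/-! ### Exponential moments of the potential -/

section Moments

set_option linter.unusedSectionVars false

variable {V E : Type*} [Fintype E] {N : Network V E} {G S : Type*} [Fintype G]
  [MeasurableSpace S]

/-- All injections. -/
def Source.injections : Set (Source G E)
  | .inject _ _ => True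
  | _ => False

theorem Source.injections_subset_past (k : ℕ) :
    Source.injections ⊆ (Source.past k : Set (Source G E)) := by
  rintro (_ | _ | _ | _) h
  · trivial
  all_goals exact h.elim

namespace Protocol

/-- The exponential moments of the interference of the planned requests are, up to the factor `2`,
at most those of a sum of independent variables in `[0, 1]` with mean `λ T`. -/
def TailBound (P : Protocol N G S) {Ω : Type*} [MeasurableSpace Ω] (ν : Measure Ω)
    (x : Ω → Sample N G S) : Prop :=
  ∀ k e, ∫⁻ ω, ENNReal.ofReal (Real.exp (P.ε / 2 * (N.W *ᵥ demand (P.planned (x ω) k)) e)) ∂ν ≤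
    ENNReal.ofReal (2 * Real.exp ((P.ε / 2 + (P.ε / 2) ^ 2) * (P.rate * P.T)))

variable {P : Protocol N G S} {Ω : Type*} [mΩ : MeasurableSpace Ω] {ν : Measure Ω}
  {x : Ω → Sample N G S}

/-- The parameter of the exponential moment of the potential. A burst is at most `m ^ 2` times the
interference of the planned requests, and another factor `m ≥ D` is lost by separating the frames
into residue classes; so `θ` is the reciprocal of the order of the exponent in a mild overload. -/
noncomputable def θ (P : Protocol N G S) : ℝ := 1 / (N.m ^ 3 * P.J)

/-- The expected relative decrease of the exponential of a positive potential in a clean-up phase: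
the bound for the probability of a decrease, times the relative decrease in this case. -/
noncomputable def drift (P : Protocol N G S) : ℝ := P.cleanProb * (1 - Real.exp (-P.θ))

theorem θ_pos (hP : P.Calibrated) : 0 < P.θ := by
  have := hP.J_pos
  have : (0 : ℝ) < N.m := by exact_mod_cast hP.one_le_m
  unfold θ
  positivity

theorem θ_le_one (hP : P.Calibrated) : P.θ ≤ 1 := by
  have h1 := hP.J_ge
  have h2 : (1 : ℝ) ≤ N.m ^ 3 := one_le_pow₀ (by exact_mod_cast hP.one_le_m)
  unfold θ
  rw [div_le_one (by positivity)]
  nlinarith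

theorem le_drift (hP : P.Calibrated) : 1 / (12 * N.m ^ 4 * P.J) ≤ P.drift := by
  have hm : (0 : ℝ) < N.m := by exact_mod_cast hP.one_le_m
  have hJ := hP.J_pos
  have h0 := θ_pos hP
  have h1 := θ_le_one hP
  have h2 : P.θ / 2 ≤ 1 - Real.exp (-P.θ) := by
    have h3 : Real.exp (-P.θ) ≤ 1 / (1 + P.θ) := by
      rw [Real.exp_neg, ← one_div]
      exact one_div_le_one_div_of_le (by linarith) (by linarith [Real.add_one_le_exp P.θ])
    have h4 : 1 / (1 + P.θ) ≤ 1 - P.θ / 2 := by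
      rw [div_le_iff₀ (by linarith)]
      nlinarith
    linarith
  calc 1 / (12 * N.m ^ 4 * P.J) = P.cleanProb * (P.θ / 2) := by
        unfold cleanProb θ
        field_simp
        norm_num
    _ ≤ _ := by
        unfold drift
        refine mul_le_mul_of_nonneg_left h2 ?_
        unfold cleanProb
        positivity

theorem drift_le_one (hP : P.Calibrated) : P.drift ≤ 1 := by
  have hm : (1 : ℝ) ≤ N.m := by exact_mod_cast hP.one_le_m
  have h0 := θ_pos hP
  have h1 : Real.exp (-P.θ) ≤ 1 := Real.exp_le_one_iff.2 (by linarith)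
  have h2 : P.cleanProb ≤ 1 := by
    unfold cleanProb
    rw [div_le_one (by positivity)]
    linarith
  exact mul_le_one₀ h2 (by linarith) (by linarith [Real.exp_pos (-P.θ)])

theorem drift_pos (hP : P.Calibrated) : 0 < P.drift := by
  have hm : (0 : ℝ) < N.m := by exact_mod_cast hP.one_le_m
  have hJ := hP.J_pos
  exact lt_of_lt_of_le (by positivity) (le_drift hP)

theorem window_subset_injections (k : ℕ) : P.window k ⊆ Source.injections := by
  rintro (_ | _ | _ | _) h
  · trivial
  all_goals exact h.elim

theorem dmeas_burst (k : ℕ) : DMeas (srcAlg x (P.window k)) (fun ω => P.burst (x ω) k) := by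
  classical
  exact (P.dmeas_planned k).comp (fun Q =>
    if P.J < N.interference (demand Q) then N.m * Q.card else 0)

/-- The factor by which the exponential moment of the potential changes per frame, apart from
bursts. -/
noncomputable def contraction (P : Protocol N G S) : ℝ :=
  (1 - P.drift) * (1 + Real.exp (P.θ * (N.m ^ 2 * P.J)) * P.failProb)

/-- The exponential of the bursts in the frames from `j` to `k - 1`. -/
noncomputable def burstWeight (P : Protocol N G S) (x : Sample N G S) (j k : ℕ) : ℝ≥0∞ :=
  ENNReal.ofReal (Real.exp (∑ i ∈ Finset.Ico j k, P.θ * P.burst x i))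

theorem burstWeight_self (x : Sample N G S) (k : ℕ) : P.burstWeight x k k = 1 := by
  simp [burstWeight]

theorem burstWeight_succ (x : Sample N G S) {j k : ℕ} (h : j ≤ k) :
    P.burstWeight x j (k + 1) =
      ENNReal.ofReal (Real.exp (P.θ * P.burst x k)) * P.burstWeight x j k := by
  unfold burstWeight
  rw [← ENNReal.ofReal_mul (Real.exp_nonneg _), ← Real.exp_add, Finset.sum_Ico_succ_top h,
    add_comm]

/-- One frame of the recursion for the exponential moment. The weight `ψ` collects the bursts of
later frames; it may be any function of the injections, since the contraction holds given all
of them. -/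
theorem lintegral_exp_step [IsProbabilityMeasure ν] (hP : P.Calibrated) (hx : IsRun P ν x)
    (k : ℕ) {ψ : Ω → ℝ≥0∞} (hψ : Measurable[srcAlg x Source.injections] ψ) :
    ∫⁻ ω, ψ ω * ENNReal.ofReal (Real.exp (P.θ * P.potential (x ω) Set.univ (k + 1))) ∂ν ≤
      ENNReal.ofReal P.contraction *
        ∫⁻ ω, (ψ ω * ENNReal.ofReal (Real.exp (P.θ * P.burst (x ω) k))) *
          ENNReal.ofReal (Real.exp (P.θ * P.potential (x ω) Set.univ k)) ∂ν +
      ENNReal.ofReal P.drift * ∫⁻ ω, ψ ω ∂ν := by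
  have hψp : Measurable[srcAlg x (Source.past k)] ψ :=
    hψ.mono (srcAlg_mono (Source.injections_subset_past k)) le_rfl
  have hψm : Measurable[srcAlg x (Source.mid k)] ψ :=
    hψp.mono (srcAlg_mono (Source.past_subset_mid k)) le_rfl
  have hb : Measurable[srcAlg x (Source.past k)] (fun ω => P.burst (x ω) k) :=
    ((dmeas_burst k).mono (srcAlg_mono ((window_subset_injections k).trans
      (Source.injections_subset_past k)))).measurable id
  have h1 := lintegral_exp_potential_succ_le hP hx (A := Set.univ) isLowerSet_univ k hψm
    (θ_pos hP).le
  have h2 := lintegral_exp_midPotential_le hP hx (θ_pos hP).le Set.univ k hψp hb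
  refine h1.trans (add_le_add_left ?_ _)
  refine (mul_le_mul_right h2 _).trans (le_of_eq ?_)
  rw [← mul_assoc]
  have hd := drift_le_one hP
  unfold contraction
  rw [ENNReal.ofReal_mul (by linarith), ENNReal.ofReal_add zero_le_one
    (mul_nonneg (Real.exp_nonneg _) P.failProb_nonneg), ENNReal.ofReal_one,
    ENNReal.ofReal_mul (Real.exp_nonneg _)]
  refine congrArg₂ _ rfl (lintegral_congr (fun ω => ?_))
  ring

/-- The recursion for the exponential moment, unrolled down to the empty system. -/
theorem lintegral_exp_unroll [IsProbabilityMeasure ν] (hP : P.Calibrated) (hx : IsRun P ν x)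
    (k : ℕ) {ψ : Ω → ℝ≥0∞} (hψ : Measurable[srcAlg x Source.injections] ψ) :
    ∫⁻ ω, ψ ω * ENNReal.ofReal (Real.exp (P.θ * P.potential (x ω) Set.univ k)) ∂ν ≤
      ENNReal.ofReal P.contraction ^ k * ∫⁻ ω, ψ ω * P.burstWeight (x ω) 0 k ∂ν +
      ∑ j ∈ Finset.range k, ENNReal.ofReal P.drift * ENNReal.ofReal P.contraction ^ j *
        ∫⁻ ω, ψ ω * P.burstWeight (x ω) (k - j) k ∂ν := by
  induction k generalizing ψ with
  | zero => simp [potential_zero, burstWeight_self]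
  | succ k ih =>
    have hψ' : Measurable[srcAlg x Source.injections]
        (fun ω => ψ ω * ENNReal.ofReal (Real.exp (P.θ * P.burst (x ω) k))) :=
      hψ.mul (((dmeas_burst k).mono (srcAlg_mono (window_subset_injections k))).measurable
        (fun n => ENNReal.ofReal (Real.exp (P.θ * n))))
    refine (lintegral_exp_step hP hx k hψ).trans ?_
    have hw : ∀ j ≤ k, ∫⁻ ω, (ψ ω * ENNReal.ofReal (Real.exp (P.θ * P.burst (x ω) k))) *
        P.burstWeight (x ω) j k ∂ν = ∫⁻ ω, ψ ω * P.burstWeight (x ω) j (k + 1) ∂ν := by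
      intro j hj
      refine lintegral_congr (fun ω => ?_)
      rw [burstWeight_succ _ hj, mul_assoc]
    refine (add_le_add_left (mul_le_mul_right (ih hψ') _) _).trans (le_of_eq ?_)
    rw [Finset.sum_range_succ', mul_add, Finset.mul_sum, hw 0 (Nat.zero_le _)]
    simp only [pow_zero, mul_one, Nat.sub_zero, burstWeight_self]
    rw [pow_succ', mul_assoc, add_assoc]
    congr 2
    refine Finset.sum_congr rfl (fun j _ => ?_)
    rw [hw _ (Nat.sub_le _ _), Nat.add_sub_add_right]
    ring

/-- Frames in the same residue class modulo `D` have disjoint windows of injections. -/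
theorem window_disjoint {i j : ℕ} (hij : i ≠ j) (h : i % N.D = j % N.D) :
    Disjoint (P.window i) (P.window j) := by
  have key : ∀ i j : ℕ, i < j → i % N.D = j % N.D → Disjoint (P.window i) (P.window j) := by
    intro i j hij h
    have h1 : i ≤ j - N.D := by
      have h2 : N.D ∣ j - i := (Nat.modEq_iff_dvd' hij.le).1 h
      have := Nat.le_of_dvd (by omega) h2
      omega
    rw [Set.disjoint_left]
    rintro (⟨t, g⟩ | _ | _ | _) ha hb
    · have h3 : i * P.T ≤ (j - N.D) * P.T := Nat.mul_le_mul_right _ h1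
      have h4 := ha.2
      have h5 := hb.1
      omega
    all_goals exact ha.elim
  rcases lt_or_gt_of_ne hij with h' | h'
  · exact key i j h' h
  · exact (key j i h' h.symm).symm

/-- Bursts in frames of the same residue class modulo `D` are independent, and by convexity these
classes may be treated separately. -/
theorem lintegral_burstWeight_le [IsProbabilityMeasure ν] (hP : P.Calibrated) (hx : IsRun P ν x)
    {B : ℝ≥0∞} (hB1 : 1 ≤ B)
    (hB : ∀ i, ∫⁻ ω, ENNReal.ofReal (Real.exp (N.D * (P.θ * P.burst (x ω) i))) ∂ν ≤ B)
    (j k : ℕ) : ∫⁻ ω, P.burstWeight (x ω) j k ∂ν ≤ B ^ (k - j) := by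
  have hD : (N.D : ℝ) ≠ 0 := by exact_mod_cast hP.D_pos.ne'
  have hmeas : ∀ i, Measurable[srcAlg x (P.window i)]
      (fun ω => ENNReal.ofReal (Real.exp (N.D * (P.θ * P.burst (x ω) i)))) := fun i =>
    (dmeas_burst i).measurable (fun n => ENNReal.ofReal (Real.exp (N.D * (P.θ * n))))
  have hclass : ∀ c, ∫⁻ ω, ∏ i ∈ (Finset.Ico j k).filter (fun i => i % N.D = c),
      ENNReal.ofReal (Real.exp (N.D * (P.θ * P.burst (x ω) i))) ∂ν ≤ B ^ (k - j) := by
    intro c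
    refine (lintegral_prod_le_of_iIndep hx.le hx.indep (U := P.window)
      (h := fun i ω => ENNReal.ofReal (Real.exp (N.D * (P.θ * P.burst (x ω) i)))) hmeas _ ?_
      (fun _ => B) (fun i _ => hB i)).trans ?_
    · intro a ha b hb hab
      simp only [Finset.coe_filter, Set.mem_ofPred_eq] at ha hb
      exact window_disjoint hab (ha.2.trans hb.2.symm)
    · rw [Finset.prod_const]
      refine pow_le_pow_right₀ hB1 ?_
      refine (Finset.card_filter_le _ _).trans ?_
      simp
  calc ∫⁻ ω, P.burstWeight (x ω) j k ∂ν
      ≤ ∫⁻ ω, ∑ c ∈ Finset.range N.D, ENNReal.ofReal (1 / (N.D : ℝ)) *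
          ∏ i ∈ (Finset.Ico j k).filter (fun i => i % N.D = c),
            ENNReal.ofReal (Real.exp (N.D * (P.θ * P.burst (x ω) i))) ∂ν := by
        refine lintegral_mono (fun ω => ?_)
        refine (ENNReal.ofReal_le_ofReal (exp_sum_le_residues hP.D_pos _ _)).trans (le_of_eq ?_)
        rw [ENNReal.ofReal_sum_of_nonneg (fun c _ => by positivity)]
        refine Finset.sum_congr rfl (fun c _ => ?_)
        rw [ENNReal.ofReal_mul (by positivity), Real.exp_sum,
          ENNReal.ofReal_prod_of_nonneg (fun i _ => Real.exp_nonneg _)]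
    _ ≤ ∑ c ∈ Finset.range N.D, ENNReal.ofReal (1 / (N.D : ℝ)) * B ^ (k - j) := by
        have hm : ∀ c, Measurable (fun ω => ∏ i ∈ (Finset.Ico j k).filter (fun i => i % N.D = c),
            ENNReal.ofReal (Real.exp (N.D * (P.θ * P.burst (x ω) i)))) := fun c =>
          Finset.measurable_fun_prod _ (fun i _ => (hmeas i).mono (hx.srcAlg_le _) le_rfl)
        rw [lintegral_finsetSum _ (fun c _ => (hm c).const_mul _)]
        refine Finset.sum_le_sum (fun c _ => ?_)
        rw [lintegral_const_mul _ (hm c)]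
        exact mul_le_mul_right (hclass c) _
    _ = B ^ (k - j) := by
        rw [Finset.sum_const, Finset.card_range, nsmul_eq_mul, ← mul_assoc,
          ← ENNReal.ofReal_natCast, ← ENNReal.ofReal_mul (Nat.cast_nonneg _), mul_one_div,
          div_self hD, ENNReal.ofReal_one, one_mul]

/-- The sum over all links of the exponential excess of the interference over `J`. -/
noncomputable def excess (P : Protocol N G S) (x : Sample N G S) (k : ℕ) : ℝ :=
  ∑ e, Real.exp (P.ε / 2 * ((N.W *ᵥ demand (P.planned x k)) e - P.J))

theorem excess_nonneg (x : Sample N G S) (k : ℕ) : 0 ≤ P.excess x k :=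
  Finset.sum_nonneg (fun _ _ => Real.exp_nonneg _)

theorem dmeas_excess (k : ℕ) : DMeas (srcAlg x (P.window k)) (fun ω => P.excess (x ω) k) :=
  (P.dmeas_planned k).comp (fun Q => ∑ e, Real.exp (P.ε / 2 * ((N.W *ᵥ demand Q) e - P.J)))

/-- The Chernoff bound, with a union bound over the links. -/
theorem lintegral_excess_le (hx : IsRun P ν x) (hX : P.TailBound ν x)
    (k : ℕ) : ∫⁻ ω, ENNReal.ofReal (P.excess (x ω) k) ∂ν ≤
      ENNReal.ofReal (2 * N.m * Real.exp (-P.tailExp)) := by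
  have hm : ∀ e, Measurable (fun ω =>
      ENNReal.ofReal (Real.exp (P.ε / 2 * (N.W *ᵥ demand (P.planned (x ω) k)) e))) := fun e =>
    ((P.dmeas_planned k).mono (hx.srcAlg_le _)).measurable
      (fun Q => ENNReal.ofReal (Real.exp (P.ε / 2 * (N.W *ᵥ demand Q) e)))
  calc ∫⁻ ω, ENNReal.ofReal (P.excess (x ω) k) ∂ν
      = ∫⁻ ω, ∑ e, ENNReal.ofReal (Real.exp (-(P.ε / 2 * P.J))) *
          ENNReal.ofReal (Real.exp (P.ε / 2 * (N.W *ᵥ demand (P.planned (x ω) k)) e)) ∂ν := by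
        refine lintegral_congr (fun ω => ?_)
        unfold excess
        rw [ENNReal.ofReal_sum_of_nonneg (fun _ _ => Real.exp_nonneg _)]
        refine Finset.sum_congr rfl (fun e _ => ?_)
        rw [← ENNReal.ofReal_mul (Real.exp_nonneg _), ← Real.exp_add]
        congr 2
        ring
    _ ≤ ∑ _e : E, ENNReal.ofReal (2 * Real.exp (-P.tailExp)) := by
        rw [lintegral_finsetSum _ (fun e _ => (hm e).const_mul _)]
        refine Finset.sum_le_sum (fun e _ => ?_)
        rw [lintegral_const_mul _ (hm e)]
        refine (mul_le_mul_right (hX k e) _).trans (le_of_eq ?_)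
        rw [← ENNReal.ofReal_mul (Real.exp_nonneg _), mul_left_comm, ← Real.exp_add]
        congr 3
        unfold tailExp J
        ring
    _ ≤ _ := by
        rw [Finset.sum_const, Finset.card_univ, nsmul_eq_mul, ← ENNReal.ofReal_natCast,
          ← ENNReal.ofReal_mul (Nat.cast_nonneg _)]
        refine ENNReal.ofReal_le_ofReal ?_
        have h1 : (Fintype.card E : ℝ) ≤ N.m := by exact_mod_cast le_max_left _ _
        have := Real.exp_pos (-P.tailExp)
        nlinarith

theorem exp_le_excess_of_overload (hP : P.Calibrated) {x : Sample N G S} {k : ℕ}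
    (h : P.Overload x k) :
    Real.exp (P.ε / 2 * (N.interference (demand (P.planned x k)) - P.J)) ≤ P.excess x k := by
  have hpos : 0 < N.interference (demand (P.planned x k)) := hP.J_pos.trans h
  obtain ⟨e, he⟩ : ∃ e, N.interference (demand (P.planned x k)) ≤
      (N.W *ᵥ demand (P.planned x k)) e := by
    by_contra hc
    push Not at hc
    refine lt_irrefl (N.interference (demand (P.planned x k))) ?_
    refine (pi_norm_lt_iff hpos).2 (fun e => ?_)
    rw [Real.norm_of_nonneg (mulVec_demand_nonneg N _ e)]
    exact hc e
  refine le_trans (Real.exp_le_exp.2 ?_) (Finset.single_le_sum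
    (f := fun e => Real.exp (P.ε / 2 * ((N.W *ᵥ demand (P.planned x k)) e - P.J)))
    (fun _ _ => Real.exp_nonneg _) (Finset.mem_univ e))
  have := hP.ε_pos
  gcongr

theorem measure_overload_le (hP : P.Calibrated) (hx : IsRun P ν x) (hX : P.TailBound ν x)
    (k : ℕ) : ν {ω | P.Overload (x ω) k} ≤
      ENNReal.ofReal (2 * N.m * Real.exp (-P.tailExp)) := by
  refine le_trans ?_ (lintegral_excess_le hx hX k)
  have hm : MeasurableSet {ω | P.Overload (x ω) k} :=
    ((P.dmeas_planned k).mono (hx.srcAlg_le _)).setOf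
      (fun Q => P.J < N.interference (demand Q))
  rw [← lintegral_indicator_one hm]
  refine lintegral_mono (fun ω => Set.indicator_le' (s := {ω | P.Overload (x ω) k}) (f := 1)
    (g := fun ω => ENNReal.ofReal (P.excess (x ω) k)) (fun ω hω => ?_) (fun _ _ => bot_le) ω)
  rw [Pi.one_apply, ← ENNReal.ofReal_one]
  refine ENNReal.ofReal_le_ofReal (le_trans (Real.one_le_exp ?_) (exp_le_excess_of_overload hP hω))
  have h1 : 0 ≤ N.interference (demand (P.planned (x ω) k)) - P.J := (sub_pos.2 hω).le
  have := hP.ε_pos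
  positivity

/-- The choice of `θ` makes the exponent of a burst at most `Y / J`, where `Y > J` is the
interference; as `ε J ≥ 2`, this is at most `1 + (ε / 2) (Y - J)`. -/
theorem exp_burst_le (hP : P.Calibrated) (x : Sample N G S) (k : ℕ) :
    Real.exp (N.D * (P.θ * P.burst x k)) ≤ 1 + 3 * P.excess x k := by
  have h0 := P.excess_nonneg x k
  have hJ := hP.J_pos
  have hm : (0 : ℝ) < N.m := by exact_mod_cast hP.one_le_m
  by_cases ho : P.Overload x k
  · have h1 := exp_le_excess_of_overload hP ho
    set Y := N.interference (demand (P.planned x k))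
    have hcard : ((P.planned x k).card : ℝ) ≤ N.m * Y := card_le_interference N _
    have hD : (N.D : ℝ) ≤ N.m := by exact_mod_cast le_max_right _ _
    have hYJ : P.J < Y := ho
    have h2 : N.D * (P.θ * P.burst x k) ≤ Y / P.J := by
      rw [burst, if_pos ho]
      push_cast
      calc (N.D : ℝ) * (P.θ * (N.m * (P.planned x k).card))
          ≤ N.m * (P.θ * (N.m * (N.m * Y))) := by
            have := θ_pos hP
            gcongr
        _ = Y / P.J := by
            unfold θ
            field_simp
    have h3 : Y / P.J ≤ 1 + P.ε / 2 * (Y - P.J) := by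
      rw [div_le_iff₀ hJ]
      nlinarith [hP.two_le]
    calc Real.exp (N.D * (P.θ * P.burst x k))
        ≤ Real.exp (1 + P.ε / 2 * (Y - P.J)) := Real.exp_le_exp.2 (h2.trans h3)
      _ = Real.exp 1 * Real.exp (P.ε / 2 * (Y - P.J)) := Real.exp_add _ _
      _ ≤ 3 * P.excess x k := by
          have := Real.exp_one_lt_d9
          gcongr
          linarith
      _ ≤ _ := by linarith
  · rw [burst, if_neg ho]
    simp only [Nat.cast_zero, mul_zero, Real.exp_zero]
    linarith

theorem lintegral_exp_burst_le [IsProbabilityMeasure ν] (hP : P.Calibrated) (hx : IsRun P ν x)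
    (hX : P.TailBound ν x) (k : ℕ) :
    ∫⁻ ω, ENNReal.ofReal (Real.exp (N.D * (P.θ * P.burst (x ω) k))) ∂ν ≤
      ENNReal.ofReal (1 + 6 * N.m * Real.exp (-P.tailExp)) := by
  have hm : Measurable (fun ω => ENNReal.ofReal (P.excess (x ω) k)) :=
    ((dmeas_excess k).mono (hx.srcAlg_le _)).measurable ENNReal.ofReal
  calc ∫⁻ ω, ENNReal.ofReal (Real.exp (N.D * (P.θ * P.burst (x ω) k))) ∂ν
      ≤ ∫⁻ ω, 1 + 3 * ENNReal.ofReal (P.excess (x ω) k) ∂ν := by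
        refine lintegral_mono (fun ω => ?_)
        refine (ENNReal.ofReal_le_ofReal (exp_burst_le hP (x ω) k)).trans (le_of_eq ?_)
        rw [ENNReal.ofReal_add zero_le_one (mul_nonneg (by norm_num) (P.excess_nonneg _ _)),
          ENNReal.ofReal_mul (by norm_num)]
        simp
    _ = 1 + 3 * ∫⁻ ω, ENNReal.ofReal (P.excess (x ω) k) ∂ν := by
        rw [lintegral_add_left measurable_const, lintegral_const_mul _ hm]
        simp
    _ ≤ 1 + 3 * ENNReal.ofReal (2 * N.m * Real.exp (-P.tailExp)) := by
        gcongr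
        exact lintegral_excess_le hx hX k
    _ = _ := by
        have : 6 * N.m * Real.exp (-P.tailExp) = 3 * (2 * N.m * Real.exp (-P.tailExp)) := by ring
        rw [this, ENNReal.ofReal_add zero_le_one (by positivity), ENNReal.ofReal_mul (by norm_num)]
        simp

theorem exp_neg_tailExp_le (hP : P.Calibrated) :
    Real.exp (-P.tailExp) ≤ 1 / (4 * N.m ^ 5 * P.J ^ 2) := by
  have hm : (0 : ℝ) < N.m := by exact_mod_cast hP.one_le_m
  have hJ := hP.J_pos
  rw [Real.exp_neg, ← one_div]
  exact one_div_le_one_div_of_le (by positivity) hP.le_exp_tailExp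

/-- The drift of the clean-up phases dominates the growth caused by failures. -/
theorem contraction_mul_le (hP : P.Calibrated) :
    P.contraction * (1 + 6 * N.m * Real.exp (-P.tailExp)) ≤ 1 - P.drift / 2 := by
  have hm : (1 : ℝ) ≤ N.m := by exact_mod_cast hP.one_le_m
  have hm0 : (0 : ℝ) < N.m := by linarith
  have hJ := hP.J_ge
  have hJ0 := hP.J_pos
  have hd := le_drift hP
  have hd1 := drift_le_one hP
  have hd0 := drift_pos hP
  have h1 : Real.exp (P.θ * (N.m ^ 2 * P.J)) * P.failProb ≤ P.drift / 8 := by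
    have h2 : P.θ * (N.m ^ 2 * P.J) ≤ 1 := by
      have : P.θ * (N.m ^ 2 * P.J) = 1 / N.m := by unfold θ; field_simp
      rw [this, div_le_one hm0]
      exact hm
    have h3 : Real.exp (P.θ * (N.m ^ 2 * P.J)) ≤ 3 :=
      (Real.exp_le_exp.2 h2).trans (by linarith [Real.exp_one_lt_d9])
    have hJ3 : (144 : ℝ) ≤ P.J ^ 3 := by nlinarith [pow_le_pow_left₀ (by norm_num) hJ 3]
    calc Real.exp (P.θ * (N.m ^ 2 * P.J)) * P.failProb ≤ 3 * P.failProb :=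
          mul_le_mul_of_nonneg_right h3 P.failProb_nonneg
      _ ≤ 1 / (12 * N.m ^ 4 * P.J) / 8 := by
          unfold failProb
          rw [div_div, mul_one_div, div_le_div_iff₀ (by positivity) (by positivity), mul_pow]
          have : (0 : ℝ) < N.m ^ 4 * P.J := by positivity
          nlinarith [mul_le_mul_of_nonneg_left hJ3 this.le]
      _ ≤ _ := by linarith
  have h4 : 6 * N.m * Real.exp (-P.tailExp) ≤ P.drift / 8 := by
    calc 6 * N.m * Real.exp (-P.tailExp) ≤ 6 * N.m * (1 / (4 * N.m ^ 5 * P.J ^ 2)) := by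
          gcongr
          exact exp_neg_tailExp_le hP
      _ ≤ 1 / (12 * N.m ^ 4 * P.J) / 8 := by
          rw [div_div, mul_one_div, div_le_div_iff₀ (by positivity) (by positivity)]
          have : (0 : ℝ) < N.m ^ 5 * P.J := by positivity
          nlinarith [mul_le_mul_of_nonneg_left hJ this.le]
      _ ≤ _ := by linarith
  have h5 : 0 ≤ Real.exp (P.θ * (N.m ^ 2 * P.J)) * P.failProb :=
    mul_nonneg (Real.exp_nonneg _) P.failProb_nonneg
  have h6 : 0 ≤ 6 * N.m * Real.exp (-P.tailExp) := by positivity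
  unfold contraction
  calc (1 - P.drift) * (1 + Real.exp (P.θ * (N.m ^ 2 * P.J)) * P.failProb) *
        (1 + 6 * N.m * Real.exp (-P.tailExp))
      ≤ (1 - P.drift) * (1 + P.drift / 8) * (1 + P.drift / 8) := by
        have : 0 ≤ 1 - P.drift := by linarith
        gcongr
    _ ≤ 1 - P.drift / 2 := by nlinarith [pow_pos hd0 2, pow_pos hd0 3]

/-- The exponential moment of the potential is bounded uniformly in time. -/
theorem lintegral_exp_potential_le [IsProbabilityMeasure ν] (hP : P.Calibrated)
    (hx : IsRun P ν x) (hX : P.TailBound ν x) (k : ℕ) :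
    ∫⁻ ω, ENNReal.ofReal (Real.exp (P.θ * P.potential (x ω) Set.univ k)) ∂ν ≤
      ENNReal.ofReal 3 := by
  have hd1 := drift_le_one hP
  have hd0 := drift_pos hP
  set β := 6 * N.m * Real.exp (-P.tailExp) with hβ
  have hβ0 : 0 ≤ β := by positivity
  have hW := lintegral_burstWeight_le hP hx (B := ENNReal.ofReal (1 + β))
    (by rw [← ENNReal.ofReal_one]; exact ENNReal.ofReal_le_ofReal (by linarith))
    (lintegral_exp_burst_le hP hx hX)
  have h := lintegral_exp_unroll hP hx k (ψ := fun _ => 1) measurable_const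
  simp only [one_mul] at h
  have hc0 : 0 ≤ P.contraction := by
    unfold contraction
    exact mul_nonneg (by linarith) (add_nonneg zero_le_one
      (mul_nonneg (Real.exp_nonneg _) P.failProb_nonneg))
  set s := 1 - P.drift / 2
  have hs0 : 0 ≤ s := by simp only [s]; linarith
  have hs1 : s ≤ 1 := by simp only [s]; linarith
  have hpow : ∀ j, ENNReal.ofReal P.contraction ^ j * ENNReal.ofReal (1 + β) ^ j ≤
      ENNReal.ofReal (s ^ j) := by
    intro j
    rw [← mul_pow, ← ENNReal.ofReal_mul hc0, ← ENNReal.ofReal_pow (mul_nonneg hc0 (by linarith))]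
    exact ENNReal.ofReal_le_ofReal (pow_le_pow_left₀ (mul_nonneg hc0 (by linarith))
      (contraction_mul_le hP) j)
  refine h.trans ?_
  calc _ ≤ ENNReal.ofReal (s ^ k) +
        ∑ j ∈ Finset.range k, ENNReal.ofReal P.drift * ENNReal.ofReal (s ^ j) := by
        refine add_le_add ?_ (Finset.sum_le_sum (fun j hj => ?_))
        · exact (mul_le_mul_right (hW 0 k) _).trans (hpow k)
        · have hj' : k - (k - j) = j := by
            have := Finset.mem_range.1 hj
            omega
          refine (mul_le_mul_right (hW (k - j) k) _).trans ?_
          rw [hj', mul_assoc]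
          exact mul_le_mul_right (hpow j) _
    _ = ENNReal.ofReal (s ^ k + P.drift * ∑ j ∈ Finset.range k, s ^ j) := by
        rw [ENNReal.ofReal_add (by positivity) (by positivity), ENNReal.ofReal_mul hd0.le,
          ENNReal.ofReal_sum_of_nonneg (fun _ _ => by positivity), Finset.mul_sum]
    _ ≤ _ := by
        refine ENNReal.ofReal_le_ofReal ?_
        have h1 := geom_sum_mul s k
        have h2 : P.drift * ∑ j ∈ Finset.range k, s ^ j = 2 * (1 - s ^ k) := by
          have h3 : s - 1 = -(P.drift / 2) := by simp only [s]; ring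
          rw [h3] at h1
          linarith
        rw [h2]
        have h4 : 0 ≤ s ^ k := by positivity
        linarith

end Protocol

end Moments

/-! ### The expected latency -/

section Latency

set_option linter.unusedSectionVars false

variable {V E : Type*} [Fintype E] {N : Network V E} {G S : Type*} [Fintype G]
  [MeasurableSpace S]

theorem Source.past_mono {j k : ℕ} (h : j ≤ k) :
    (Source.past j : Set (Source G E)) ⊆ Source.past k := by
  rintro (_ | _ | _ | _) h'
  · trivial
  all_goals exact lt_of_lt_of_le h' h

namespace Protocol

variable {P : Protocol N G S} {Ω : Type*} [mΩ : MeasurableSpace Ω] {ν : Measure Ω}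
  {x : Ω → Sample N G S}

theorem potential_le_midPotential (x : Sample N G S) (A : Set ℕ) (k : ℕ) :
    P.potential x A k ≤ P.midPotential x A k := by
  refine Finset.sum_le_sum (fun p _ => ?_)
  by_cases hp : (P.state x k p).failedAt = none
  · simp [debt, hp]
  · unfold debt
    rw [P.firstPhase_failedAt_of_some _ _ _ _ hp]

theorem potential_mono (x : Sample N G S) {A B : Set ℕ} (h : A ⊆ B) (k : ℕ) :
    P.potential x A k ≤ P.potential x B k := by
  refine Finset.sum_le_sum (fun p _ => ?_)
  unfold debt
  split_ifs with h1 h2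
  · exact le_rfl
  · obtain ⟨i, hi, hf⟩ := h1
    exact absurd ⟨i, h hi, hf⟩ h2
  · exact Nat.zero_le _
  · exact le_rfl

/-- The expected number of frames that it takes to clear all packets that failed until frame `j` is
at most their potential divided by the probability of a decrease, because packets that fail later
do not interfere. -/
theorem tsum_lintegral_potential_pos_le [IsProbabilityMeasure ν] (hP : P.Calibrated)
    (hx : IsRun P ν x) (j : ℕ) {ψ : Ω → ℝ≥0∞} (hψ : Measurable[srcAlg x (Source.past (j + 1))] ψ) :
    ENNReal.ofReal P.cleanProb * ∑' k, ∫⁻ ω, ψ ω *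
        {ω | j < k ∧ 0 < P.potential (x ω) (Set.Iic j) k}.indicator 1 ω ∂ν ≤
      ∫⁻ ω, ψ ω * P.potential (x ω) (Set.Iic j) (j + 1) ∂ν := by
  rw [← ENNReal.tsum_mul_left]
  refine ENNReal.tsum_le_of_sum_range_le (fun n => ?_)
  have key : ∑ k ∈ Finset.range n, ENNReal.ofReal P.cleanProb * ∫⁻ ω, ψ ω *
        {ω | j < k ∧ 0 < P.potential (x ω) (Set.Iic j) k}.indicator 1 ω ∂ν +
      ∫⁻ ω, ψ ω * P.potential (x ω) (Set.Iic j) (max n (j + 1)) ∂ν ≤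
      ∫⁻ ω, ψ ω * P.potential (x ω) (Set.Iic j) (j + 1) ∂ν := by
    induction n with
    | zero => simp
    | succ n ih =>
      refine le_trans ?_ ih
      rw [Finset.sum_range_succ, add_assoc]
      refine add_le_add_right ?_ _
      by_cases hn : j < n
      · have hψ' : Measurable[srcAlg x (Source.mid n)] ψ :=
          hψ.mono (srcAlg_mono ((Source.past_mono hn).trans (Source.past_subset_mid n))) le_rfl
        have h := lintegral_potential_succ_add_le hP hx (isLowerSet_Iic j) n hψ'
        have hnm : n ∉ Set.Iic j := fun hc => absurd hn (not_lt.2 hc)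
        have heq : ∀ ω, P.midPotential (x ω) (Set.Iic j) n = P.potential (x ω) (Set.Iic j) n :=
          fun ω => le_antisymm (P.midPotential_le_of_notMem _ _ _ hnm)
            (potential_le_midPotential _ _ _)
        simp only [heq] at h
        have h1 : max (n + 1) (j + 1) = n + 1 := by omega
        have h2 : max n (j + 1) = n := by omega
        simpa only [hn, true_and, h1, h2] using h
      · have h1 : max (n + 1) (j + 1) = max n (j + 1) := by omega
        simp [hn, h1]
  exact le_self_add.trans key

theorem tailExp_nonneg (hP : P.Calibrated) : 0 ≤ P.tailExp := by
  have := hP.rate_nonneg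
  unfold tailExp
  positivity

/-- Failures are so rare that the expected potential found by a failing packet is at most `1 / m`.
The exponential moment of the potential makes independence of the failure superfluous. -/
theorem lintegral_fail_mul_potential_le [IsProbabilityMeasure ν] (hP : P.Calibrated)
    (hx : IsRun P ν x) (hX : P.TailBound ν x) (p : Packet G) (j : ℕ) :
    ∫⁻ ω, {ω | (P.state (x ω) (j + 1) p).failedAt = some j}.indicator 1 ω *
        (P.potential (x ω) (Set.Iic j) (j + 1) : ℝ≥0∞) ∂ν ≤ ENNReal.ofReal (1 / N.m) := by
  have hθ := θ_pos hP
  have hu := tailExp_nonneg hP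
  have hm : (1 : ℝ) ≤ N.m := by exact_mod_cast hP.one_le_m
  have hm0 : (0 : ℝ) < N.m := by linarith
  have hJ := hP.J_ge
  have hJ0 := hP.J_pos
  have hF : MeasurableSet {ω | (P.state (x ω) (j + 1) p).failedAt = some j} :=
    ((P.dmeas_state (j + 1) p).mono (hx.srcAlg_le _)).setOf (fun s => s.failedAt = some j)
  have hfail := (measure_fail_le hP hx j p).trans
    (add_le_add_right (measure_overload_le hP hx hX j) _)
  have hpt : ∀ ω, {ω | (P.state (x ω) (j + 1) p).failedAt = some j}.indicator 1 ω *
      (P.potential (x ω) (Set.Iic j) (j + 1) : ℝ≥0∞) ≤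
      ENNReal.ofReal (1 / P.θ) * (ENNReal.ofReal P.tailExp *
        {ω | (P.state (x ω) (j + 1) p).failedAt = some j}.indicator 1 ω +
        ENNReal.ofReal (Real.exp (-P.tailExp)) *
          ENNReal.ofReal (Real.exp (P.θ * P.potential (x ω) Set.univ (j + 1)))) := by
    intro ω
    by_cases hω : ω ∈ {ω | (P.state (x ω) (j + 1) p).failedAt = some j}
    · rw [Set.indicator_of_mem hω, Pi.one_apply, one_mul, mul_one,
        ← ENNReal.ofReal_mul (Real.exp_nonneg _), ← Real.exp_add,
        ← ENNReal.ofReal_add hu (Real.exp_nonneg _), ← ENNReal.ofReal_mul (by positivity),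
        ← ENNReal.ofReal_natCast]
      refine ENNReal.ofReal_le_ofReal ?_
      rw [one_div, inv_mul_eq_div, le_div_iff₀ hθ]
      -- `θ Φ ≤ u + exp (θ Φ - u)`, where `u` is `tailExp`
      have h1 : (P.potential (x ω) (Set.Iic j) (j + 1) : ℝ) ≤
          P.potential (x ω) Set.univ (j + 1) := by
        exact_mod_cast potential_mono _ (Set.subset_univ _) _
      have h2 := Real.add_one_le_exp
        (-P.tailExp + P.θ * P.potential (x ω) Set.univ (j + 1))
      nlinarith
    · rw [Set.indicator_of_notMem hω, zero_mul]
      exact bot_le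
  have hm1 : Measurable (fun ω => ENNReal.ofReal P.tailExp *
      {ω | (P.state (x ω) (j + 1) p).failedAt = some j}.indicator 1 ω) :=
    (measurable_one.indicator hF).const_mul _
  have hm2 : Measurable (fun ω =>
      ENNReal.ofReal (Real.exp (P.θ * P.potential (x ω) Set.univ (j + 1)))) :=
    ((P.dmeas_potential _ _).mono (hx.srcAlg_le _)).measurable
      (fun n => ENNReal.ofReal (Real.exp (P.θ * n)))
  refine (lintegral_mono hpt).trans ?_
  rw [lintegral_const_mul' _ _ ENNReal.ofReal_ne_top, lintegral_add_left hm1,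
    lintegral_const_mul _ (measurable_one.indicator hF), lintegral_indicator_one hF,
    lintegral_const_mul _ hm2]
  calc _ ≤ ENNReal.ofReal (1 / P.θ) * (ENNReal.ofReal P.tailExp *
        (ENNReal.ofReal P.failProb + ENNReal.ofReal (2 * N.m * Real.exp (-P.tailExp))) +
        ENNReal.ofReal (Real.exp (-P.tailExp)) * ENNReal.ofReal 3) := by
        gcongr
        exact lintegral_exp_potential_le hP hx hX (j + 1)
    _ = ENNReal.ofReal (1 / P.θ * (P.tailExp * (P.failProb + 2 * N.m * Real.exp (-P.tailExp)) +
        Real.exp (-P.tailExp) * 3)) := by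
        have h0 := P.failProb_nonneg
        have he := Real.exp_nonneg (-P.tailExp)
        rw [ENNReal.ofReal_mul (p := 1 / P.θ) (by positivity), ENNReal.ofReal_add (by positivity)
          (by positivity), ENNReal.ofReal_mul hu, ENNReal.ofReal_add h0 (by positivity),
          ENNReal.ofReal_mul he]
    _ ≤ _ := by
        refine ENNReal.ofReal_le_ofReal ?_
        have h0 := P.failProb_nonneg
        have he := exp_neg_tailExp_le hP
        calc 1 / P.θ * (P.tailExp * (P.failProb + 2 * N.m * Real.exp (-P.tailExp)) +
              Real.exp (-P.tailExp) * 3)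
            ≤ 1 / P.θ * (P.J * (1 / (2 * (N.m * P.J) ^ 4) +
                2 * N.m * (1 / (4 * N.m ^ 5 * P.J ^ 2))) + 1 / (4 * N.m ^ 5 * P.J ^ 2) * 3) := by
              have := hP.tailExp_le
              have h3 : P.failProb = 1 / (2 * (N.m * P.J) ^ 4) := rfl
              rw [← h3]
              gcongr
          _ = (1 / (2 * P.J ^ 2) + 1 / 2 + 3 / (4 * N.m * P.J)) / N.m := by
              unfold θ
              field_simp
              ring
          _ ≤ 1 / N.m := by
              have h4 : 1 / (2 * P.J ^ 2) ≤ 1 / 4 := by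
                rw [div_le_div_iff₀ (by positivity) (by norm_num)]
                nlinarith
              have h5 : 3 / (4 * N.m * P.J) ≤ 1 / 4 := by
                rw [div_le_div_iff₀ (by positivity) (by norm_num)]
                nlinarith
              gcongr
              linarith

/-- After its failure in frame `j`, a packet stays in the system for at most `6` frames in
expectation, including the event that it does not fail. -/
theorem tsum_measure_undelivered_le [IsProbabilityMeasure ν] (hP : P.Calibrated)
    (hx : IsRun P ν x) (hX : P.TailBound ν x) (p : Packet G) (j : ℕ) :
    ∑' k, ∫⁻ ω, {ω | (P.state (x ω) (j + 1) p).failedAt = some j}.indicator 1 ω *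
      {ω | j < k ∧ 0 < P.potential (x ω) (Set.Iic j) k}.indicator 1 ω ∂ν ≤ ENNReal.ofReal 6 := by
  have hm0 : (0 : ℝ) < N.m := by exact_mod_cast hP.one_le_m
  have hF : MeasurableSet[srcAlg x (Source.past (j + 1))]
      {ω | (P.state (x ω) (j + 1) p).failedAt = some j} :=
    (P.dmeas_state (j + 1) p).setOf (fun s => s.failedAt = some j)
  have h := (tsum_lintegral_potential_pos_le hP hx j
    (ψ := {ω | (P.state (x ω) (j + 1) p).failedAt = some j}.indicator (fun _ => 1))
    (Measurable.indicator measurable_const hF)).trans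
    (lintegral_fail_mul_potential_le hP hx hX p j)
  have hc : (0 : ℝ) < P.cleanProb := by unfold cleanProb; positivity
  have h2 := mul_le_mul_right h (ENNReal.ofReal (1 / P.cleanProb))
  rw [← mul_assoc, ← ENNReal.ofReal_mul (by positivity), one_div_mul_cancel hc.ne',
    ENNReal.ofReal_one, one_mul, ← ENNReal.ofReal_mul (by positivity)] at h2
  refine h2.trans (ENNReal.ofReal_le_ofReal (le_of_eq ?_))
  unfold cleanProb
  field_simp

/-- The `d` frames of a packet that never fails, one frame of waiting, and `6` frames for each of
the `d` occasions to fail make up at most `8 d` frames. -/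
theorem lintegral_latency_le [IsProbabilityMeasure ν] (hP : P.Calibrated) (hx : IsRun P ν x)
    (hX : P.TailBound ν x) (p : Packet G) {d : ℕ} (hd : 0 < d)
    (hlen : ∀ᵐ ω ∂ν, (x ω).len p = d) :
    ∫⁻ ω, P.latency (x ω) p ∂ν ≤ ENNReal.ofReal (8 * d * P.T) := by
  set k₀ := p.2 / P.T + 1
  have hm1 : ∀ j, Measurable (fun ω =>
      {ω | (P.state (x ω) (j + 1) p).failedAt = some j}.indicator (1 : Ω → ℝ≥0∞) ω) := fun j =>
    measurable_one.indicator (((P.dmeas_state (j + 1) p).mono (hx.srcAlg_le _)).setOf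
      (fun s => s.failedAt = some j))
  have hm2 : ∀ j k, Measurable (fun ω =>
      {ω | j < k ∧ 0 < P.potential (x ω) (Set.Iic j) k}.indicator (1 : Ω → ℝ≥0∞) ω) := fun j k =>
    measurable_one.indicator (((P.dmeas_potential (Set.Iic j) k).mono (hx.srcAlg_le _)).setOf
      (fun n => j < k ∧ 0 < n))
  calc ∫⁻ ω, P.latency (x ω) p ∂ν
      ≤ ∫⁻ ω, P.T * (1 + ∑' k, ((Set.Ico k₀ (k₀ + d)).indicator (fun _ => 1) k +
          ∑ j ∈ Finset.range d,
            {ω | (P.state (x ω) (k₀ + j + 1) p).failedAt = some (k₀ + j)}.indicator 1 ω *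
            {ω | k₀ + j < k ∧ 0 < P.potential (x ω) (Set.Iic (k₀ + j)) k}.indicator 1 ω)) ∂ν := by
        refine lintegral_mono_ae (hlen.mono (fun ω hω => ?_))
        refine (P.latency_le_tsum hP.length_le hP.T_pos (x ω) p (hω ▸ hd)).trans ?_
        gcongr with k
        refine (P.undelivered_indicator_le hP.T_pos (x ω) p k).trans ?_
        rw [hω]
        refine add_le_add le_rfl (Finset.sum_le_sum (fun j _ => ?_))
        by_cases h1 : (P.state (x ω) (k₀ + j + 1) p).failedAt = some (k₀ + j) <;>
          by_cases h2 : k₀ + j < k ∧ 0 < P.potential (x ω) (Set.Iic (k₀ + j)) k <;>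
          simp [h1, h2, k₀]
    _ = P.T * (1 + ∑' k, ((Set.Ico k₀ (k₀ + d)).indicator (fun _ => 1) k +
          ∑ j ∈ Finset.range d, ∫⁻ ω,
            {ω | (P.state (x ω) (k₀ + j + 1) p).failedAt = some (k₀ + j)}.indicator 1 ω *
            {ω | k₀ + j < k ∧ 0 < P.potential (x ω) (Set.Iic (k₀ + j)) k}.indicator 1 ω ∂ν)) := by
        have hmp : ∀ k j, Measurable (fun ω =>
            {ω | (P.state (x ω) (k₀ + j + 1) p).failedAt = some (k₀ + j)}.indicator
              (1 : Ω → ℝ≥0∞) ω *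
            {ω | k₀ + j < k ∧ 0 < P.potential (x ω) (Set.Iic (k₀ + j)) k}.indicator 1 ω) :=
          fun k j => (hm1 _).mul (hm2 _ k)
        have hms : ∀ k, Measurable (fun ω => ∑ j ∈ Finset.range d,
            {ω | (P.state (x ω) (k₀ + j + 1) p).failedAt = some (k₀ + j)}.indicator
              (1 : Ω → ℝ≥0∞) ω *
            {ω | k₀ + j < k ∧ 0 < P.potential (x ω) (Set.Iic (k₀ + j)) k}.indicator 1 ω) :=
          fun k => Finset.measurable_fun_sum _ (fun j _ => hmp k j)
        have hmt : ∀ k, Measurable (fun ω => (Set.Ico k₀ (k₀ + d)).indicator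
            (fun _ => (1 : ℝ≥0∞)) k + ∑ j ∈ Finset.range d,
            {ω | (P.state (x ω) (k₀ + j + 1) p).failedAt = some (k₀ + j)}.indicator
              (1 : Ω → ℝ≥0∞) ω *
            {ω | k₀ + j < k ∧ 0 < P.potential (x ω) (Set.Iic (k₀ + j)) k}.indicator 1 ω) :=
          fun k => measurable_const.add (hms k)
        rw [lintegral_const_mul' _ _ (ENNReal.natCast_ne_top _),
          lintegral_add_left measurable_const, lintegral_tsum (fun k => (hmt k).aemeasurable)]
        simp only [lintegral_const, measure_univ, mul_one]
        congr 3
        ext k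
        rw [lintegral_add_left measurable_const,
          lintegral_finsetSum _ (fun j _ => hmp k j)]
        simp
    _ ≤ P.T * (1 + (d + d * ENNReal.ofReal 6)) := by
        gcongr
        rw [ENNReal.tsum_add]
        refine add_le_add ?_ ?_
        · rw [← tsum_subtype (Set.Ico k₀ (k₀ + d)) (fun _ => (1 : ℝ≥0∞)), ENNReal.tsum_const]
          simp
        · rw [Summable.tsum_finsetSum (fun _ _ => ENNReal.summable)]
          refine (Finset.sum_le_sum (fun j _ =>
            tsum_measure_undelivered_le hP hx hX p (k₀ + j))).trans ?_
          simp
    _ ≤ _ := by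
        have h1 : (P.T * (1 + (d + d * ENNReal.ofReal 6)) : ℝ≥0∞) =
            ENNReal.ofReal (P.T * (1 + (d + d * 6))) := by
          rw [ENNReal.ofReal_mul (by positivity), ENNReal.ofReal_add zero_le_one (by positivity),
            ENNReal.ofReal_add (by positivity) (by positivity),
            ENNReal.ofReal_mul (by positivity)]
          simp
        rw [h1]
        refine ENNReal.ofReal_le_ofReal ?_
        have hd' : (1 : ℝ) ≤ d := by exact_mod_cast hd
        have hT : (0 : ℝ) ≤ P.T := Nat.cast_nonneg _
        nlinarith

end Protocol

end Latency

/-! ### Concentration of the planned requests -/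

section Concentration

set_option linter.unusedSectionVars false

variable {V E : Type*} [Fintype E] {N : Network V E} {G S : Type*} [Fintype G]
  [MeasurableSpace S]

/-- The interference at link `e` caused by the `i`-th link of a route, `0` if there is none. -/
def hopWeight (N : Network V E) (e : E) (i : ℕ) (o : Option (Route N)) : ℝ :=
  (o.bind (fun r => r.links[i]?)).elim 0 (N.W e)

theorem hopWeight_nonneg (e : E) (i : ℕ) (o : Option (Route N)) : 0 ≤ hopWeight N e i o := by
  unfold hopWeight
  cases o.bind (fun r => r.links[i]?) with
  | none => exact le_rfl
  | some e' => exact N.W_nonneg e e'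

theorem hopWeight_le_one (e : E) (i : ℕ) (o : Option (Route N)) : hopWeight N e i o ≤ 1 := by
  unfold hopWeight
  cases o.bind (fun r => r.links[i]?) with
  | none => exact zero_le_one
  | some e' => exact N.W_le_one e e'

theorem sum_range_getElem?_elim {α : Type*} (w : α → ℝ) (l : List α) {n : ℕ}
    (h : l.length ≤ n) : ∑ i ∈ Finset.range n, (l[i]?).elim 0 w = (l.map w).sum := by
  induction l generalizing n with
  | nil => simp
  | cons a l ih =>
    obtain ⟨n, rfl⟩ : ∃ n', n = n' + 1 := ⟨n - 1, by simp at h; omega⟩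
    rw [Finset.sum_range_succ']
    simp only [List.getElem?_cons_succ, List.getElem?_cons_zero, Option.elim_some, List.map_cons,
      List.sum_cons]
    rw [ih (by simpa using h), add_comm]

open Classical in
theorem sum_mul_count (w : E → ℝ) (l : List E) :
    ∑ e, w e * (l.count e : ℝ) = (l.map w).sum := by
  induction l with
  | nil => simp
  | cons a l ih =>
    simp only [List.count_cons, Nat.cast_add, mul_add, Finset.sum_add_distrib, ih, List.map_cons,
      List.sum_cons]
    rw [add_comm]
    simp

open Classical in
theorem sum_hopWeight (e : E) (o : Option (Route N)) :
    ∑ i ∈ Finset.range N.D, hopWeight N e i o =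
      ∑ e', N.W e e' * o.elim (0 : ℝ) (fun r => (r.links.count e' : ℝ)) := by
  cases o with
  | none => simp [hopWeight]
  | some r =>
    simp only [hopWeight, Option.bind_some, Option.elim_some]
    rw [sum_range_getElem?_elim _ _ r.length_le, sum_mul_count]

theorem mulVec_demand_eq_sum {κ : Type*} (N : Network V E) (Q : Finset (κ × E)) (e : E) :
    (N.W *ᵥ demand Q) e = ∑ r ∈ Q, N.W e r.2 := by
  classical
  rw [← Finset.sum_fiberwise Q Prod.snd]
  refine Finset.sum_congr rfl (fun e' _ => ?_)
  rw [Finset.sum_congr rfl (g := fun _ => N.W e e')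
    (fun r hr => by rw [(Finset.mem_filter.1 hr).2]), Finset.sum_const, nsmul_eq_mul, mul_comm]
  unfold demand
  congr!

/-- The interference of the planned requests is a sum over the packets of the `D` preceding frames.
A packet contributes the weight of its `i`-th link, where `i` is the number of complete frames that
it has seen. -/
theorem Protocol.mulVec_demand_planned (P : Protocol N G S) (x : Sample N G S) (k : ℕ) (e : E) :
    (N.W *ᵥ demand (P.planned x k)) e =
      ∑ p ∈ (Finset.univ : Finset G) ×ˢ Finset.Ico ((k - N.D) * P.T) (k * P.T),
        hopWeight N e (k - (p.2 / P.T + 1)) (x.inj p.2 p.1) := by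
  classical
  rw [mulVec_demand_eq_sum, Protocol.planned, Finset.sum_filter, Finset.sum_product]
  refine Finset.sum_congr rfl (fun p _ => ?_)
  have key : ∀ o : Option E,
      ∑ e', (if o = some e' then N.W e e' else 0) = o.elim 0 (N.W e) := by
    rintro (_ | e') <;> simp
  refine Eq.trans ?_ (key (x.hop p (k - (p.2 / P.T + 1))))
  refine Finset.sum_congr rfl (fun e' _ => ?_)
  congr

theorem sum_Ico_mul_div (T : ℕ) (h : ℕ → ℝ) {a b : ℕ} (hab : a ≤ b) :
    ∑ t ∈ Finset.Ico (a * T) (b * T), h (t / T) = T * ∑ n ∈ Finset.Ico a b, h n := by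
  induction b, hab using Nat.le_induction with
  | base => simp
  | succ b hab ih =>
    rw [← Finset.sum_Ico_consecutive _ (Nat.mul_le_mul_right T hab)
      (Nat.mul_le_mul_right T (Nat.le_succ b)), ih, Finset.sum_Ico_succ_top hab, mul_add]
    congr 1
    rw [Finset.sum_congr rfl (g := fun _ => h b)]
    · simp [Nat.succ_mul]
    · intro t ht
      rw [Finset.mem_Ico] at ht
      rw [Nat.div_eq_of_lt_le ht.1 ht.2]

theorem sum_Ico_le_sum_range (h : ℕ → ℝ) (h0 : ∀ i, 0 ≤ h i) (D k : ℕ) :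
    ∑ n ∈ Finset.Ico (k - D) k, h (k - (n + 1)) ≤ ∑ i ∈ Finset.range D, h i := by
  rw [← Finset.sum_image (f := h) (g := fun n => k - (n + 1))]
  · refine Finset.sum_le_sum_of_subset_of_nonneg ?_ (fun i _ _ => h0 i)
    intro i hi
    simp only [Finset.mem_image, Finset.mem_Ico] at hi
    obtain ⟨n, hn, rfl⟩ := hi
    rw [Finset.mem_range]
    omega
  · intro a ha b hb hab
    simp only [Finset.coe_Ico, Set.mem_Ico] at ha hb
    simp only at hab
    omega

section Probability

variable {Ω : Type*} [mΩ : MeasurableSpace Ω] {μ : Measure Ω} {κ : Type*}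

theorem lintegral_comp_discrete [Countable κ] {Z : Ω → κ} (hZ : DMeas mΩ Z) (F : κ → ℝ≥0∞) :
    ∫⁻ ω, F (Z ω) ∂μ = ∑' z, F z * μ {ω | Z ω = z} := by
  rw [lintegral_discrete hZ (G := fun z _ => F z) (fun z => measurable_const)]
  exact tsum_congr (fun z => lintegral_indicator_const (hZ.setOf (· = z)) _)

theorem integrable_comp_discrete [IsFiniteMeasure μ] {Z : Ω → κ} (hZ : DMeas mΩ Z) {F : κ → ℝ}
    {c : ℝ} (hF : ∀ z, |F z| ≤ c) : Integrable (fun ω => F (Z ω)) μ :=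
  Integrable.of_bound (hZ.measurable F).aestronglyMeasurable c
    (Filter.Eventually.of_forall (fun _ => hF _))

/-- The exponential moment of a random variable with values in `[0, 1]`. -/
theorem lintegral_exp_le_exp_integral [IsProbabilityMeasure μ] {Z : Ω → κ} (hZ : DMeas mΩ Z)
    {F : κ → ℝ} (h0 : ∀ z, 0 ≤ F z) (h1 : ∀ z, F z ≤ 1) {s : ℝ} (hs0 : 0 ≤ s) (hs1 : s ≤ 1) :
    ∫⁻ ω, ENNReal.ofReal (Real.exp (s * F (Z ω))) ∂μ ≤
      ENNReal.ofReal (Real.exp ((s + s ^ 2) * ∫ ω, F (Z ω) ∂μ)) := by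
  have hint : Integrable (fun ω => F (Z ω)) μ :=
    integrable_comp_discrete hZ (c := 1) (fun z => by
      rw [abs_of_nonneg (h0 z)]
      exact h1 z)
  have hint' : Integrable (fun ω => 1 + (s + s ^ 2) * F (Z ω)) μ :=
    (integrable_const _).add (hint.const_mul _)
  have hpt : ∀ z, Real.exp (s * F z) ≤ 1 + (s + s ^ 2) * F z := by
    intro z
    have ha := h0 z
    have hb := h1 z
    have h2 : |s * F z| ≤ 1 := by
      rw [abs_of_nonneg (by positivity)]
      exact mul_le_one₀ hs1 ha hb
    have h3 := (abs_le.1 (Real.abs_exp_sub_one_sub_id_le h2)).2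
    have h4 : F z ^ 2 ≤ F z := by nlinarith
    have h5 : (s * F z) ^ 2 ≤ s ^ 2 * F z := by
      rw [mul_pow]
      exact mul_le_mul_of_nonneg_left h4 (sq_nonneg s)
    linarith
  calc ∫⁻ ω, ENNReal.ofReal (Real.exp (s * F (Z ω))) ∂μ
      ≤ ∫⁻ ω, ENNReal.ofReal (1 + (s + s ^ 2) * F (Z ω)) ∂μ :=
        lintegral_mono (fun ω => ENNReal.ofReal_le_ofReal (hpt _))
    _ = ENNReal.ofReal (∫ ω, (1 + (s + s ^ 2) * F (Z ω)) ∂μ) := by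
        rw [ofReal_integral_eq_lintegral_ofReal hint' (Filter.Eventually.of_forall (fun ω => ?_))]
        have := h0 (Z ω)
        simp only [Pi.zero_apply]
        positivity
    _ ≤ _ := by
        refine ENNReal.ofReal_le_ofReal ?_
        rw [integral_add (integrable_const _) (hint.const_mul _), integral_const_mul]
        simp only [integral_const, probReal_univ, smul_eq_mul, mul_one]
        linarith [Real.add_one_le_exp ((s + s ^ 2) * ∫ ω, F (Z ω) ∂μ)]

end Probability

namespace Protocol

variable {P : Protocol N G S} {Ω : Type*} [mΩ : MeasurableSpace Ω] {μ : Measure Ω}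
  {x : Ω → Sample N G S}

theorem _root_.PacketScheduling.IsExecution.sigma_le (hx : IsExecution P μ x) (i : Source G E) :
    Source.sigma x i ≤ mΩ := by
  cases i with
  | inject t g =>
    rintro _ ⟨s, -, rfl⟩
    exact DMeas.of_fiber (hx.measurable_inj t g) s
  | coin k e => exact (hx.measurable_coin k e).comap_le
  | first k => exact (hx.measurable_seed₁ k).comap_le
  | second k => exact (hx.measurable_seed₂ k).comap_le

/-- The sources stay independent and, apart from one injection, keep their laws when the route of
one packet is given. -/
theorem _root_.PacketScheduling.IsExecution.isRun_cond [IsProbabilityMeasure μ]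
    (hx : IsExecution P μ x) {g : G} {t : ℕ} {r : Route N}
    (hA : μ {ω | (x ω).inj t g = some r} ≠ 0) :
    IsRun P (μ[|{ω | (x ω).inj t g = some r}]) x := by
  have hAm : MeasurableSet[Source.sigma x (Source.inject t g)] {ω | (x ω).inj t g = some r} :=
    ⟨{some r}, MeasurableSpace.measurableSet_top, rfl⟩
  refine ⟨hx.sigma_le, fun k e => ?_, fun k => ?_, fun k => ?_,
    iIndep_cond hx.sigma_le hx.indep hAm hA⟩
  · rw [← hx.coin_law k e, measureReal_def, measureReal_def,
      cond_apply_of_iIndep hx.sigma_le hx.indep hAm hA (i := Source.coin k e) (by simp)]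
    exact ⟨{true}, MeasurableSet.of_discrete, rfl⟩
  · rw [← hx.seed₁_law k]
    refine Measure.ext (fun B hB => ?_)
    rw [Measure.map_apply (hx.measurable_seed₁ k) hB, Measure.map_apply (hx.measurable_seed₁ k) hB]
    exact cond_apply_of_iIndep hx.sigma_le hx.indep hAm hA (i := Source.first k) (by simp)
      ⟨B, hB, rfl⟩
  · rw [← hx.seed₂_law k]
    refine Measure.ext (fun B hB => ?_)
    rw [Measure.map_apply (hx.measurable_seed₂ k) hB, Measure.map_apply (hx.measurable_seed₂ k) hB]
    exact cond_apply_of_iIndep hx.sigma_le hx.indep hAm hA (i := Source.second k) (by simp)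
      ⟨B, hB, rfl⟩

/-- The expected interference at a link of the packets injected in one slot is at most the injection
rate, with multiplicities if a route repeats links. -/
theorem sum_integral_hopWeight_le [IsProbabilityMeasure μ] (hx : IsExecution P μ x) (e : E) :
    ∑ g, ∑ i ∈ Finset.range N.D, ∫ ω, hopWeight N e i ((x ω).inj 0 g) ∂μ ≤ P.rate := by
  classical
  refine le_trans (le_of_eq ?_) (hx.inj_rate e)
  have hZ : ∀ g, DMeas mΩ (fun ω => (x ω).inj 0 g) := fun g =>
    DMeas.of_fiber (hx.measurable_inj 0 g)
  have h1 : ∀ i g, Integrable (fun ω => hopWeight N e i ((x ω).inj 0 g)) μ := fun i g =>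
    integrable_comp_discrete (hZ g) (c := 1) (fun o => by
      rw [abs_of_nonneg (hopWeight_nonneg e i o)]
      exact hopWeight_le_one e i o)
  have h2 : ∀ e' g, Integrable (fun ω => ((x ω).inj 0 g).elim (0 : ℝ)
      (fun r => (r.links.count e' : ℝ))) μ := fun e' g =>
    integrable_comp_discrete (F := fun o => o.elim (0 : ℝ) (fun r => (r.links.count e' : ℝ)))
      (hZ g) (c := N.D) (fun o => by
      cases o with
      | none => simp
      | some r =>
        simp only [Option.elim_some, Nat.abs_cast, Nat.cast_le]
        exact List.count_le_length.trans r.length_le)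
  simp only [Matrix.mulVec, dotProduct, averageUse, Finset.mul_sum]
  rw [Finset.sum_comm (s := Finset.univ (α := E))]
  refine Finset.sum_congr rfl (fun g _ => ?_)
  rw [← integral_finsetSum _ (fun i _ => h1 i g)]
  simp_rw [sum_hopWeight, ← integral_const_mul]
  exact integral_finsetSum _ (fun e' _ => (h2 e' g).const_mul _)

/-- Conditioning on the injection of one packet changes the exponential moments of the interference
at most by the factor `exp (ε / 2) ≤ 2`. -/
theorem tailBound_cond [IsProbabilityMeasure μ] (hP : P.Calibrated) (hx : IsExecution P μ x)
    {g : G} {t : ℕ} {r : Route N} (hA : μ {ω | (x ω).inj t g = some r} ≠ 0) :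
    P.TailBound (μ[|{ω | (x ω).inj t g = some r}]) x := by
  classical
  have hAm : MeasurableSet[Source.sigma x (Source.inject t g)] {ω | (x ω).inj t g = some r} :=
    ⟨{some r}, MeasurableSpace.measurableSet_top, rfl⟩
  have hrun := hx.isRun_cond hA
  have hν : IsProbabilityMeasure (μ[|{ω | (x ω).inj t g = some r}]) :=
    cond_isProbabilityMeasure hA
  set ν := μ[|{ω | (x ω).inj t g = some r}] with hνdef
  intro k e
  set s := P.ε / 2 with hs
  have hs0 : 0 ≤ s := by have := hP.ε_pos; positivity
  have hs1 : s ≤ 1 / 4 := by have := hP.ε_le; simp only [hs]; linarith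
  set B := (Finset.univ : Finset G) ×ˢ Finset.Ico ((k - N.D) * P.T) (k * P.T) with hB
  set i : Packet G → ℕ := fun p => k - (p.2 / P.T + 1) with hi
  set a : G → ℕ → ℝ := fun g' n => ∫ ω, hopWeight N e n ((x ω).inj 0 g') ∂μ with ha
  have ha0 : ∀ g' n, 0 ≤ a g' n := fun g' n => integral_nonneg (fun ω => hopWeight_nonneg _ _ _)
  have hZ : ∀ t' g', DMeas mΩ (fun ω => (x ω).inj t' g') := fun t' g' =>
    DMeas.of_fiber (hx.measurable_inj t' g')
  have hK : ∀ p ∈ B, ∫⁻ ω, ENNReal.ofReal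
      (Real.exp (s * hopWeight N e (i p) ((x ω).inj p.2 p.1))) ∂ν ≤
      ENNReal.ofReal ((if p = (g, t) then 2 else 1) *
        Real.exp ((s + s ^ 2) * a p.1 (i p))) := by
    intro p _
    by_cases hp : p = (g, t)
    · rw [if_pos hp]
      calc ∫⁻ ω, ENNReal.ofReal (Real.exp (s * hopWeight N e (i p) ((x ω).inj p.2 p.1))) ∂ν
          ≤ ∫⁻ _, ENNReal.ofReal (Real.exp s) ∂ν := by
            refine lintegral_mono (fun ω => ENNReal.ofReal_le_ofReal (Real.exp_le_exp.2 ?_))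
            exact mul_le_of_le_one_right hs0 (hopWeight_le_one _ _ _)
        _ = ENNReal.ofReal (Real.exp s) := by simp
        _ ≤ _ := by
            refine ENNReal.ofReal_le_ofReal ?_
            have h1 : Real.exp s ≤ 2 := by
              have h2 := (abs_le.1 (Real.abs_exp_sub_one_sub_id_le
                (abs_le.2 ⟨by linarith, by linarith⟩ : |s| ≤ 1))).2
              nlinarith
            have h3 : 1 ≤ Real.exp ((s + s ^ 2) * a p.1 (i p)) :=
              Real.one_le_exp (mul_nonneg (by positivity) (ha0 _ _))
            linarith
    · rw [if_neg hp, one_mul]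
      have hne : Source.inject p.2 p.1 ≠ (Source.inject t g : Source G E) := by
        intro hc
        simp only [Source.inject.injEq] at hc
        exact hp (Prod.ext hc.2 hc.1)
      have heq : ∫⁻ ω, ENNReal.ofReal
          (Real.exp (s * hopWeight N e (i p) ((x ω).inj p.2 p.1))) ∂ν =
          ∫⁻ ω, ENNReal.ofReal (Real.exp (s * hopWeight N e (i p) ((x ω).inj 0 p.1))) ∂μ := by
        rw [lintegral_comp_discrete (hZ p.2 p.1)
            (fun o => ENNReal.ofReal (Real.exp (s * hopWeight N e (i p) o))),
          lintegral_comp_discrete (hZ 0 p.1)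
            (fun o => ENNReal.ofReal (Real.exp (s * hopWeight N e (i p) o)))]
        refine tsum_congr (fun o => ?_)
        rw [← hx.inj_identDistrib p.2 p.1 o, hνdef,
          cond_apply_of_iIndep hx.sigma_le hx.indep hAm hA hne]
        exact ⟨{o}, MeasurableSpace.measurableSet_top, rfl⟩
      rw [heq]
      exact lintegral_exp_le_exp_integral (hZ 0 p.1) (hopWeight_nonneg e (i p))
        (hopWeight_le_one e (i p)) hs0 (by linarith)
  have hprod := lintegral_prod_le_of_iIndep (μ := ν) hrun.le hrun.indep
    (U := fun p : Packet G => {Source.inject p.2 p.1})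
    (h := fun p ω => ENNReal.ofReal (Real.exp (s * hopWeight N e (i p) ((x ω).inj p.2 p.1))))
    (fun p => (dmeas_inj (x := x) (U := {Source.inject p.2 p.1}) rfl).measurable
      (fun o => ENNReal.ofReal (Real.exp (s * hopWeight N e (i p) o)))) B
    (fun p _ q _ hpq => by
      simp only [Function.onFun, Set.disjoint_singleton, ne_eq, Source.inject.injEq, not_and]
      exact fun h1 h2 => hpq (Prod.ext h2 h1)) _ hK
  have hsum : ∑ p ∈ B, a p.1 (i p) ≤ P.rate * P.T := by
    rw [hB, Finset.sum_product]
    calc ∑ g', ∑ t' ∈ Finset.Ico ((k - N.D) * P.T) (k * P.T), a g' (k - (t' / P.T + 1))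
        ≤ ∑ g', P.T * ∑ n ∈ Finset.range N.D, a g' n := by
          refine Finset.sum_le_sum (fun g' _ => ?_)
          rw [sum_Ico_mul_div P.T (fun n => a g' (k - (n + 1))) (Nat.sub_le k N.D)]
          gcongr
          exact sum_Ico_le_sum_range (a g') (ha0 g') N.D k
      _ = P.T * ∑ g', ∑ n ∈ Finset.range N.D, a g' n := by rw [Finset.mul_sum]
      _ ≤ P.T * P.rate := by
          gcongr
          exact sum_integral_hopWeight_le hx e
      _ = _ := mul_comm _ _
  calc ∫⁻ ω, ENNReal.ofReal (Real.exp (s * (N.W *ᵥ demand (P.planned (x ω) k)) e)) ∂ν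
      = ∫⁻ ω, ∏ p ∈ B, ENNReal.ofReal
          (Real.exp (s * hopWeight N e (i p) ((x ω).inj p.2 p.1))) ∂ν := by
        refine lintegral_congr (fun ω => ?_)
        rw [mulVec_demand_planned, Finset.mul_sum, Real.exp_sum,
          ENNReal.ofReal_prod_of_nonneg (fun _ _ => Real.exp_nonneg _)]
    _ ≤ ∏ p ∈ B, ENNReal.ofReal ((if p = (g, t) then 2 else 1) *
          Real.exp ((s + s ^ 2) * a p.1 (i p))) := hprod
    _ = ENNReal.ofReal ((∏ p ∈ B, (if p = (g, t) then (2 : ℝ) else 1)) *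
          Real.exp ((s + s ^ 2) * ∑ p ∈ B, a p.1 (i p))) := by
        rw [← ENNReal.ofReal_prod_of_nonneg (fun p _ => by positivity), Finset.prod_mul_distrib,
          ← Real.exp_sum, ← Finset.mul_sum]
    _ ≤ _ := by
        refine ENNReal.ofReal_le_ofReal ?_
        refine mul_le_mul ?_ (Real.exp_le_exp.2 ?_) (Real.exp_nonneg _) (by norm_num)
        · rw [Finset.prod_ite_eq']
          split_ifs <;> norm_num
        · exact mul_le_mul_of_nonneg_left hsum (by positivity)

end Protocol

end Concentration

/-! ### The choice of the parameters -/

section Parameters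

set_option linter.unusedSectionVars false

variable {V E : Type*} [Fintype E] {N : Network V E} {G S : Type*} [MeasurableSpace S]

/-- A static algorithm needs at least `n` slots for `n` requests on one link. As `g` is sublinear,
this forces `f ≥ 1`. -/
theorem StaticAlgorithm.Guarantee.one_le {A : StaticAlgorithm (Packet G) E S} {a : ℝ} {b : ℝ → ℝ}
    (h : A.Guarantee N a b) (hb : b =o[Filter.atTop] (fun n : ℝ => n)) (g₀ : G) (e₀ : E) :
    1 ≤ a := by
  classical
  by_contra ha
  push Not at ha
  have h1 := (hb.def (c := (1 - a) / 2) (by linarith)).and (Filter.eventually_ge_atTop 1)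
  obtain ⟨n, hn, hn1⟩ := (tendsto_natCast_atTop_atTop.eventually h1).exists
  have hn0 : (0 : ℝ) < n := by linarith
  rw [Real.norm_of_nonneg hn0.le] at hn
  have hbn : b n ≤ (1 - a) / 2 * n := (le_abs_self _).trans hn
  have hinj : Function.Injective (fun i : ℕ => (((g₀, i), e₀) : Packet G × E)) := fun i j hij => by
    simpa using hij
  set Q : Finset (Packet G × E) := (Finset.range n).map ⟨_, hinj⟩ with hQ
  have hcard : (Q.card : ℝ) = n := by simp [hQ]
  have hI : N.interference (demand Q) ≤ n := by
    refine (pi_norm_le_iff_of_nonneg hn0.le).2 (fun e => ?_)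
    rw [Real.norm_of_nonneg (mulVec_demand_nonneg N _ e), mulVec_demand_eq_sum, ← hcard]
    refine (Finset.sum_le_card_nsmul _ _ 1 (fun r _ => N.W_le_one e r.2)).trans ?_
    simp
  have hG := h n n hn1 Q hcard.le hI
  have hpos : 0 < A.seedLaw.real {σ | ∀ r ∈ Q, ∃ s : ℕ, A.run n n Q σ r = some s ∧
      (s : ℝ) + 1 ≤ a * n + b n} := by
    refine lt_of_lt_of_le ?_ hG
    have h2 : (1 : ℝ) ≤ (n : ℝ) ^ 4 := one_le_pow₀ hn1
    rw [sub_pos, div_lt_one (by positivity)]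
    linarith
  obtain ⟨σ, hσ⟩ : {σ | ∀ r ∈ Q, ∃ s : ℕ, A.run n n Q σ r = some s ∧
      (s : ℝ) + 1 ≤ a * n + b n}.Nonempty := by
    by_contra hc
    rw [Set.not_nonempty_iff_eq_empty] at hc
    rw [hc] at hpos
    simp at hpos
  choose! s hs using hσ
  -- the slots used by the requests are distinct
  have hle : Q.card ≤ (Finset.range ⌊a * n + b n⌋₊).card := by
    refine Finset.card_le_card_of_injOn s (fun r hr => ?_) (fun r hr r' hr' hrr => ?_)
    · rw [Finset.coe_range, Set.mem_Iio]
      have := (hs r hr).2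
      exact Nat.le_floor (by exact_mod_cast this)
    · refine A.one_per_link n n Q σ r hr r' hr' ?_ (s r) (hs r hr).1 ?_
      · simp only [hQ, Finset.coe_map, Function.Embedding.coeFn_mk, Set.mem_image] at hr hr'
        obtain ⟨i, -, rfl⟩ := hr
        obtain ⟨j, -, rfl⟩ := hr'
        rfl
      · rw [hrr]
        exact (hs r' hr').1
  rw [Finset.card_range] at hle
  have h3 : (n : ℝ) ≤ (⌊a * n + b n⌋₊ : ℝ) := by
    exact_mod_cast hcard ▸ (Nat.cast_le (α := ℝ)).2 hle
  have h4 : 0 ≤ a * n + b n := by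
    by_contra hc
    rw [Nat.floor_of_nonpos (not_le.1 hc).le] at h3
    simp only [Nat.cast_zero] at h3
    linarith
  have h5 := Nat.floor_le h4
  nlinarith

variable [Fintype G]

/-- The part `6 ln m` of the exponent pays for `m ^ 5`, and the remaining part for `J ^ 2`, which is
at most of order `u ^ 6`. -/
theorem four_mul_pow_le_exp {m u J : ℝ} (hm : 1 ≤ m) (hJ0 : 0 ≤ J) (hu : 25 + 6 * Real.log m ≤ u)
    (hJ : 625 * J ≤ 24 * u ^ 3) : 4 * m ^ 5 * J ^ 2 ≤ Real.exp u := by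
  have hlog : 0 ≤ Real.log m := Real.log_nonneg hm
  have hu0 : 0 ≤ u := by linarith
  have h1 : 5 * Real.log m + (20 + u / 6) ≤ u := by linarith
  have h2 : Real.exp (5 * Real.log m) = m ^ 5 := by
    rw [mul_comm, Real.exp_mul, Real.exp_log (by linarith)]
    norm_cast
  have h3 : (2 : ℝ) ^ 20 ≤ Real.exp 20 := by
    have h4 : Real.exp 20 = Real.exp 1 ^ 20 := by
      rw [← Real.exp_nat_mul]
      norm_num
    rw [h4]
    exact pow_le_pow_left₀ (by norm_num) (by linarith [Real.exp_one_gt_d9]) 20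
  have h5 := Real.pow_div_factorial_le_exp (u / 6) (by linarith) 6
  have h6 : J ^ 2 ≤ (24 / 625 * u ^ 3) ^ 2 := pow_le_pow_left₀ hJ0 (by linarith) 2
  have h7 : 4 * J ^ 2 ≤ 2 ^ 20 * ((u / 6) ^ 6 / (Nat.factorial 6)) := by
    have h8 : (Nat.factorial 6 : ℝ) = 720 := by norm_num [Nat.factorial]
    rw [h8]
    have h9 : 0 ≤ u ^ 6 := by positivity
    nlinarith
  calc 4 * m ^ 5 * J ^ 2 = m ^ 5 * (4 * J ^ 2) := by ring
    _ ≤ m ^ 5 * (2 ^ 20 * ((u / 6) ^ 6 / (Nat.factorial 6))) := by gcongr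
    _ ≤ m ^ 5 * (Real.exp 20 * Real.exp (u / 6)) := by gcongr
    _ = Real.exp (5 * Real.log m + (20 + u / 6)) := by
        rw [Real.exp_add, Real.exp_add, h2]
    _ ≤ Real.exp u := Real.exp_le_exp.2 h1

/-- The two phases fit into a frame: the first one leaves the fraction `3 ε² / 4` of the frame to
the clean-up phase. -/
theorem Protocol.firstLength_add_cleanLength_le (P : Protocol N G S) (hmJ : 1 ≤ N.m * P.J)
    (hF : 1 ≤ P.f N.m) (hg : MonotoneOn (P.g N.m) (Set.Ici 1)) (hε0 : 0 < P.ε)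
    (hε1 : P.ε ≤ 1 / 2) (hTpos : (0 : ℝ) < P.T) (hT1 : 100 * P.f N.m / P.ε ^ 3 ≤ P.T)
    (hT' : 4 * P.f N.m / P.ε ^ 2 * P.g N.m (N.m / P.f N.m * P.T) ≤ P.T) :
    P.firstLength + P.cleanLength ≤ P.T := by
  have hrate : P.rate = (1 - P.ε) / P.f N.m := rfl
  have hJdef : P.J = (1 + P.ε) * P.rate * P.T := rfl
  set F := P.f N.m
  set ε := P.ε
  have hF0 : 0 < F := by linarith
  have hε2 : ε ^ 2 ≤ 1 := by nlinarith
  have hFJ : F * P.J = (1 - ε ^ 2) * P.T := by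
    rw [hJdef, hrate]
    field_simp
    ring
  have hJle : P.J ≤ P.T / F := by
    rw [le_div_iff₀ hF0, mul_comm, hFJ]
    nlinarith
  have hmJle : N.m * P.J ≤ N.m / F * P.T := by
    calc N.m * P.J ≤ N.m * (P.T / F) := by gcongr
      _ = _ := by ring
  have hgle : P.g N.m (N.m * P.J) ≤ ε ^ 2 * P.T / 4 := by
    refine (hg hmJ (hmJ.trans hmJle) hmJle).trans ?_
    set g₁ := P.g N.m (N.m / F * P.T)
    by_cases hg1 : g₁ ≤ 0
    · exact hg1.trans (by positivity)
    · push Not at hg1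
      have h1 : 4 / ε ^ 2 * g₁ ≤ P.T := by
        refine le_trans ?_ hT'
        gcongr
        linarith
      rw [div_mul_eq_mul_div, div_le_iff₀ (by positivity)] at h1
      linarith
  have hFle : F ≤ ε ^ 3 * P.T / 100 := by
    rw [div_le_iff₀ (by positivity)] at hT1
    linarith
  have h1 : (P.firstLength : ℝ) ≤ (1 - ε ^ 2) * P.T + ε ^ 2 * P.T / 4 := by
    have h0 : 0 ≤ (1 - ε ^ 2) * P.T + ε ^ 2 * P.T / 4 := by nlinarith
    refine le_trans ?_ (Nat.floor_le h0)
    refine Nat.cast_le.2 (Nat.floor_mono ?_)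
    linarith
  have h2 : (P.cleanLength : ℝ) ≤ ε ^ 3 * P.T / 100 + ε ^ 2 * P.T / 4 := by
    have h0 : 0 ≤ ε ^ 3 * P.T / 100 + ε ^ 2 * P.T / 4 := by positivity
    refine le_trans ?_ (Nat.floor_le h0)
    refine Nat.cast_le.2 (Nat.floor_mono ?_)
    linarith
  have h3 : ε ^ 3 * P.T ≤ ε ^ 2 * P.T := by
    refine mul_le_mul_of_nonneg_right ?_ hTpos.le
    nlinarith [sq_nonneg ε]
  have h4 : (0 : ℝ) ≤ ε ^ 2 * P.T := by positivity
  have h5 : ((P.firstLength + P.cleanLength : ℕ) : ℝ) ≤ P.T := by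
    push_cast
    linarith
  exact_mod_cast h5

/-- The size of the planned interference `J = (1 + ε) y` and of the exponent `u = ε² y / 4`, where
`y` is the expected interference per frame. -/
theorem planned_bounds {ε L y : ℝ} (hε0 : 0 < ε) (hε1 : ε ≤ 1 / 2) (hL0 : 0 ≤ L)
    (hy : 50 / ε ^ 3 + 24 * L / ε ^ 2 ≤ y) :
    600 ≤ (1 + ε) * y ∧ 2 ≤ ε * ((1 + ε) * y) ∧ ε ^ 2 * y / 4 ≤ (1 + ε) * y ∧
      625 * ((1 + ε) * y) ≤ 24 * (ε ^ 2 * y / 4) ^ 3 ∧ 25 + 6 * L ≤ ε ^ 2 * y / 4 := by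
  have hy2 : 50 / ε ^ 3 ≤ y := by
    have : 0 ≤ 24 * L / ε ^ 2 := by positivity
    linarith
  have hy0 : 0 < y := lt_of_lt_of_le (by positivity) hy2
  have hyε : 50 ≤ ε ^ 3 * y := by
    rw [div_le_iff₀ (by positivity)] at hy2
    linarith
  have hε2 : ε ^ 2 ≤ 1 / 4 := by nlinarith
  have hε3 : ε ^ 3 ≤ ε / 4 := by nlinarith
  have hεy : 200 ≤ ε * y := by
    have := mul_le_mul_of_nonneg_right hε3 hy0.le
    linarith
  have hy400 : 400 ≤ y := by
    have := mul_le_mul_of_nonneg_right hε1 hy0.le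
    linarith
  have hu1 : 25 / 2 / ε + 6 * L ≤ ε ^ 2 * y / 4 := by
    calc 25 / 2 / ε + 6 * L = ε ^ 2 / 4 * (50 / ε ^ 3 + 24 * L / ε ^ 2) := by
          field_simp
          ring
      _ ≤ ε ^ 2 / 4 * y := by gcongr
      _ = _ := by ring
  set u := ε ^ 2 * y / 4 with hu
  have huε : 25 / 2 ≤ ε * u := by
    have h1 : 25 / 2 / ε ≤ u := by linarith
    rw [div_le_iff₀ hε0] at h1
    linarith
  have hu0 : 0 ≤ u := by positivity
  have hε2y : ε ^ 2 * y ≤ 1 / 4 * y := mul_le_mul_of_nonneg_right hε2 hy0.le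
  refine ⟨by linarith, ?_, by linarith, ?_, ?_⟩
  · have : 0 ≤ ε ^ 2 * y := by positivity
    linarith
  · have h1 : ε ^ 2 * ((1 + ε) * y) ≤ 6 * u := by
      have : ε ^ 2 * y * ε ≤ ε ^ 2 * y * (1 / 2) := by gcongr
      rw [hu]
      linarith
    have h2 : 625 ≤ 4 * (ε * u) ^ 2 := by nlinarith
    calc 625 * ((1 + ε) * y) ≤ 4 * (ε * u) ^ 2 * ((1 + ε) * y) := by gcongr
      _ = 4 * u ^ 2 * (ε ^ 2 * ((1 + ε) * y)) := by ring
      _ ≤ 4 * u ^ 2 * (6 * u) := by gcongr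
      _ = 24 * u ^ 3 := by ring
  · have h1 : 25 ≤ 25 / 2 / ε := by
      rw [le_div_iff₀ hε0]
      linarith
    linarith

/-- The conditions on the frame length give all that the analysis needs. -/
theorem Protocol.calibrated {P : Protocol N G S} (hD : 0 < N.D) (hf : 1 ≤ P.f N.m)
    (hg : MonotoneOn (P.g N.m) (Set.Ici 1)) (hA : P.alg.Guarantee N (P.f N.m) (P.g N.m))
    (hε0 : 0 < P.ε) (hε1 : P.ε ≤ 1 / 2)
    (hT : 100 * P.f N.m / P.ε ^ 3 + 48 * P.f N.m * Real.log N.m / P.ε ^ 2 ≤ P.T)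
    (hT' : 4 * P.f N.m / P.ε ^ 2 * P.g N.m (N.m / P.f N.m * P.T) ≤ P.T) : P.Calibrated := by
  have hm : 1 ≤ N.m := hD.trans_le (le_max_right _ _)
  have hm' : (1 : ℝ) ≤ N.m := by exact_mod_cast hm
  have hL0 : 0 ≤ Real.log N.m := Real.log_nonneg hm'
  have hF0 : 0 < P.f N.m := by linarith
  have hrate0 : 0 ≤ P.rate := div_nonneg (by linarith) hF0.le
  have hT1 : 100 * P.f N.m / P.ε ^ 3 ≤ P.T := by
    have : 0 ≤ 48 * P.f N.m * Real.log N.m / P.ε ^ 2 := by positivity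
    linarith
  have hTpos : (0 : ℝ) < P.T := lt_of_lt_of_le (by positivity) hT1
  have hy : 50 / P.ε ^ 3 + 24 * Real.log N.m / P.ε ^ 2 ≤ P.rate * P.T := by
    calc 50 / P.ε ^ 3 + 24 * Real.log N.m / P.ε ^ 2
        = 1 / 2 / P.f N.m *
            (100 * P.f N.m / P.ε ^ 3 + 48 * P.f N.m * Real.log N.m / P.ε ^ 2) := by
          field_simp
          ring
      _ ≤ (1 - P.ε) / P.f N.m * P.T := by
          refine mul_le_mul ?_ hT (by positivity) hrate0
          gcongr
          linarith
  have hJ : P.J = (1 + P.ε) * (P.rate * P.T) := by rw [Protocol.J, mul_assoc]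
  have hu : P.tailExp = P.ε ^ 2 * (P.rate * P.T) / 4 := by rw [Protocol.tailExp, mul_assoc]
  obtain ⟨h1, h2, h3, h4, h5⟩ := planned_bounds hε0 hε1 hL0 hy
  rw [← hJ] at h1 h2 h3 h4
  rw [← hu] at h3 h4 h5
  have hmJ : 1 ≤ N.m * P.J := one_le_mul_of_one_le_of_one_le hm' (by linarith)
  exact ⟨hA, hD, hm, hε0, hε1, hrate0, by exact_mod_cast hTpos,
    P.firstLength_add_cleanLength_le hmJ hf hg hε0 hε1 hTpos hT1 hT', h1, h2, h3,
    four_mul_pow_le_exp hm' (by linarith) h5 h4⟩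

end Parameters

end PacketScheduling

theorem mainTheorem3 :
    ∃ C : ℝ, ∀ (V E G S Ω : Type*) [Fintype E] [Fintype G] [MeasurableSpace S]
      [MeasurableSpace Ω] (μ : Measure Ω) [IsProbabilityMeasure μ]
      (N : PacketScheduling.Network V E) (P : PacketScheduling.Protocol N G S)
      (x : Ω → PacketScheduling.Sample N G S),
      0 < P.f N.m →
      MonotoneOn (P.g N.m) (Set.Ici 1) →
      P.g N.m =o[Filter.atTop] (fun n : ℝ => n) →
      P.alg.Guarantee N (P.f N.m) (P.g N.m) →
      0 < P.ε → P.ε ≤ 1 / 2 →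
      100 * P.f N.m / P.ε ^ 3 + 48 * P.f N.m * Real.log N.m / P.ε ^ 2 ≤ P.T →
      4 * P.f N.m / P.ε ^ 2 * P.g N.m (N.m / P.f N.m * P.T) ≤ P.T →
      PacketScheduling.IsExecution P μ x →
      ∀ (g : G) (t : ℕ) (r : PacketScheduling.Route N),
        Measurable (fun ω => P.latency (x ω) (g, t)) ∧
        ∫⁻ ω, P.latency (x ω) (g, t) ∂(μ[|{ω | (x ω).inj t g = some r}]) ≤
          ENNReal.ofReal (C * r.links.length * P.T) := by
  refine ⟨8, ?_⟩
  intro V E G S Ω _ _ _ _ μ _ N P x _ hg hgo hA hε0 hε1 hT hT' hx g t r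
  refine ⟨P.measurable_latency hx.sigma_le (g, t), ?_⟩
  by_cases h0 : μ {ω | (x ω).inj t g = some r} = 0
  · rw [ProbabilityTheory.cond_eq_zero_of_meas_eq_zero h0]
    simp
  · have hlen : 0 < r.links.length := List.length_pos_of_ne_nil r.ne_nil
    have hP : P.Calibrated := PacketScheduling.Protocol.calibrated (hlen.trans_le r.length_le)
      (hA.one_le hgo g (r.links.head r.ne_nil)) hg hA hε0 hε1 hT hT'
    have : IsProbabilityMeasure (μ[|{ω | (x ω).inj t g = some r}]) :=
      cond_isProbabilityMeasure h0
    refine PacketScheduling.Protocol.lintegral_latency_le hP (hx.isRun_cond h0)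
      (PacketScheduling.Protocol.tailBound_cond hP hx h0) (g, t) hlen ?_
    filter_upwards [ProbabilityTheory.ae_cond_mem (μ := μ) (hx.measurable_inj t g (some r))]
      with ω hω
    have hω' : (x ω).inj t g = some r := hω
    simp [PacketScheduling.Sample.len, hω']
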